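/- Let $n\ge 3$, $\ell>0$ and $B_\ell=\{x\in\mathbb R^2:|x|<\ell\}$. Let $\alpha_1,\dots,\alpha_n\in S^1$ be the vertices, listed in their order along the unit circle (clockwise or counterclockwise), of a regular $n$-gon $P$ inscribed in the unit circle; let $L$ be the side length of $P$ and let $h$ be the height (from the origin) of each of the $n$ isosceles triangles with a vertex at the origin and a side of $P$ as base. Let $u:B_\ell\to S^1$ be a symmetric $n$-junction map, i.e. $u$ takes the values $\alpha_1,\dots,\alpha_n$, in this order, on $n$ consecutive non-overlapping angular sectors of opening $2\pi/n$ with common vertex at the origin (the values of $u$ on the interfaces between the sectors, a null set, are irrelevant). For an open set $\Omega\subset\mathbb R^2$ and $v\in C^1(\Omega;\mathbb R^2)$ set $$\mathcal A(v;\Omega)=\int_\Omega\sqrt{1+|\nabla v_1|^2+|\nabla v_2|^2+(\det\nabla v)^2}\,dx\in[0,+\infty].$$ For $w\in BV(\Omega;\mathbb R^2)$ let $|Dw|(\Omega)$ be the total variation of its distributional derivative (with respect to the Frobenius norm). Say that $v_k\to w$ strictly in $BV(\Omega;\mathbb R^2)$ if $v_k,w\in BV(\Omega;\mathbb R^2)$,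 $v_k\to w$ in $L^1(\Omega;\mathbb R^2)$ and $|Dv_k|(\Omega)\to|Dw|(\Omega)$, and set $$\overline{\mathcal A}_{BV}(w;\Omega)=\inf\Big\{\liminf_{k\to+\infty}\mathcal A(v_k;\Omega):\ (v_k)\subset C^1(\Omega;\mathbb R^2)\cap BV(\Omega;\mathbb R^2),\ v_k\to w\text{ strictly in }BV(\Omega;\mathbb R^2)\Big\}.$$ Then, with $|\cdot|$ denoting Lebesgue measure on subsets of $\mathbb R^2$, $$\overline{\mathcal A}_{BV}(u;B_\ell)=|B_\ell|+|Du|(B_\ell)+|P|=\pi\ell^2+nL\ell+\frac n2\,hL.$$ -/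

import Mathlib

open MeasureTheory Filter Topology
open scoped ENNReal

/-- The Euclidean plane `ℝ²`. -/
abbrev Plane : Type := EuclideanSpace ℝ (Fin 2)

noncomputable section

/-- The partial derivative `∂ⱼ vᵢ (x)` of a map `v = (v₀, v₁)` of the plane. -/
def partialD (v : Plane → Plane) (i j : Fin 2) (x : Plane) : ℝ :=
  (fderiv ℝ v x (EuclideanSpace.single j 1)) i

/-- The Jacobian determinant `det ∇v = ∂₀v₀ ∂₁v₁ - ∂₁v₀ ∂₀v₁`. -/
def jacobianDet (v : Plane → Plane) (x : Plane) : ℝ :=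
  partialD v 0 0 x * partialD v 1 1 x - partialD v 0 1 x * partialD v 1 0 x

/-- The area of the graph of a `C¹` map `v` over `Ω`,
`∫_Ω √(1 + |∇v₀|² + |∇v₁|² + (det ∇v)²) dx`, with values in `[0, ∞]`. -/
def graphArea (v : Plane → Plane) (Ω : Set Plane) : ℝ≥0∞ :=
  ∫⁻ x in Ω, ENNReal.ofReal
    (Real.sqrt (1 + ∑ i, ∑ j, partialD v i j x ^ 2 + jacobianDet v x ^ 2))

/-- The divergence of a vector field on the plane. -/
def divergence (ψ : Plane → Plane) (x : Plane) : ℝ := ∑ j, partialD ψ j j x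

/-- Admissible test fields for the total variation in `Ω`: a matrix field of class `C¹_c(Ω; ℝ^{2×2})`,
given by its two rows `φ 0`, `φ 1`, whose Frobenius norm is at most `1` everywhere. -/
structure IsVariationTest (Ω : Set Plane) (φ : Fin 2 → Plane → Plane) : Prop where
  contDiff : ∀ i, ContDiff ℝ 1 (φ i)
  compactSupport : ∀ i, HasCompactSupport (φ i)
  support_subset : ∀ i, tsupport (φ i) ⊆ Ω
  norm_le : ∀ x, ∑ i, ‖φ i x‖ ^ 2 ≤ 1

/-- The total variation `|Du|(Ω) ∈ [0, ∞]` of (the distributional derivative of) `u ∈ L¹(Ω; ℝ²)`: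
the supremum of `∑ᵢ ∫_Ω uᵢ div φᵢ dx` over all test fields, with respect to the Frobenius norm. -/
def totalVariation (u : Plane → Plane) (Ω : Set Plane) : ℝ≥0∞ :=
  ⨆ (φ : Fin 2 → Plane → Plane) (_ : IsVariationTest Ω φ),
    ENNReal.ofReal (∑ i, ∫ x in Ω, u x i * divergence (φ i) x)

/-- `u ∈ BV(Ω; ℝ²)`: `u` is integrable on `Ω` and has finite total variation there. -/
def MemBV (u : Plane → Plane) (Ω : Set Plane) : Prop :=
  IntegrableOn u Ω volume ∧ totalVariation u Ω < ∞

/-- Strict convergence `v k → u` in `BV(Ω; ℝ²)`. -/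
structure StrictBVConverges (v : ℕ → Plane → Plane) (u : Plane → Plane) (Ω : Set Plane) :
    Prop where
  memBV_seq : ∀ k, MemBV (v k) Ω
  memBV_limit : MemBV u Ω
  tendsto_L1 : Tendsto (fun k => eLpNorm (v k - u) 1 (volume.restrict Ω)) atTop (𝓝 0)
  tendsto_variation :
    Tendsto (fun k => totalVariation (v k) Ω) atTop (𝓝 (totalVariation u Ω))

/-- The relaxed area of the graph with respect to strict convergence in `BV(Ω; ℝ²)`: the infimum of
`liminf_k graphArea (v k) Ω` over the sequences of maps `v k ∈ C¹(Ω; ℝ²) ∩ BV(Ω; ℝ²)` which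
converge to `u` strictly in `BV(Ω; ℝ²)`. -/
def relaxedAreaBV (u : Plane → Plane) (Ω : Set Plane) : ℝ≥0∞ :=
  ⨅ (v : ℕ → Plane → Plane) (_ : ∀ k, ContDiffOn ℝ 1 (v k) Ω) (_ : StrictBVConverges v u Ω),
    liminf (fun k => graphArea (v k) Ω) atTop

/-- The point of the plane with polar coordinates `(r, t)`. -/
def polarPoint (r t : ℝ) : Plane := !₂[r * Real.cos t, r * Real.sin t]

/-- The open angular sector with vertex at the origin formed by the directions with angle strictly
between `θ + 2πk/n` and `θ + 2π(k+1)/n`. -/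
def openSector (n : ℕ) (θ : ℝ) (k : ℕ) : Set Plane :=
  {x | ∃ r : ℝ, 0 < r ∧ ∃ t : ℝ, θ + 2 * Real.pi * k / n < t ∧
    t < θ + 2 * Real.pi * (k + 1) / n ∧ x = polarPoint r t}

/-- `α 0, …, α (n-1)` are the vertices of a regular `n`-gon inscribed in the unit circle, listed in
their order along the circle, counterclockwise (`s = 1`) or clockwise (`s = -1`). -/
def IsInscribedRegularPolygon {n : ℕ} (α : Fin n → Plane) : Prop :=
  ∃ φ s : ℝ, (s = 1 ∨ s = -1) ∧
    ∀ k : Fin n, α k = polarPoint 1 (φ + s * (2 * Real.pi * (k : ℕ) / n))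

/-- `u` is a symmetric `n`-junction map on the disk of radius `ℓ` centred at the origin, with values
`α 0, …, α (n-1)`: it takes values in the unit circle, and on `n` consecutive sectors of opening
`2π/n` it takes, in this order, as values the consecutive vertices of an inscribed regular `n`-gon.
Nothing more is required on the interfaces between the sectors, which form a null set. -/
structure IsSymmetricJunctionMap {n : ℕ} (α : Fin n → Plane) (ℓ : ℝ) (u : Plane → Plane) :
    Prop where
  regular : IsInscribedRegularPolygon α
  mapsTo_circle : Set.MapsTo u (Metric.ball 0 ℓ) (Metric.sphere 0 1)
  eq_on_sectors : ∃ θ : ℝ, ∀ k : Fin n, ∀ x ∈ Metric.ball (0 : Plane) ℓ ∩ openSector n θ k,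
    u x = α k

/-- The length of the side joining `α k` to the next vertex (cyclically). -/
def sideLength {n : ℕ} (α : Fin n → Plane) (k : Fin n) : ℝ :=
  dist (α k) (α (finRotate n k))

/-- The height, from the origin, of the triangle with vertices `0`, `α k` and the next vertex:
the distance of the origin from the line through the two vertices. -/
def triangleHeight {n : ℕ} (α : Fin n → Plane) (k : Fin n) : ℝ :=
  Metric.infDist 0 (affineSpan ℝ {α k, α (finRotate n k)} : Set Plane)

end

/-!
In polar coordinates `(r, t)` the three terms have separate origins: away from the interfaces the
graph has the area of the disk, each interface costs its length times the jump across it, and near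
the vertex, where the values of `u` go once around the polygon on arbitrarily small circles, a
continuous map has to fill the polygon. Strict convergence is what forces the filling to be the
polygon itself.

*Total variation of `u`.* For `C¹` maps, `|Dv|(B)` is the integral of `|∇v|`
(`totalVariation_le_lintegral_gradNorm`, `lintegral_gradNorm_le_totalVariation`), and `|D·|(B)` is
lower semicontinuous in `L¹` (`totalVariation_le_liminf`). Testing `u` against angular fields gives
`|Du|(B) ≥ nLℓ`; the recovery sequence below gives `≤` (`IsJunction.totalVariation_eq`).

*Upper bound* (`IsJunction.relaxedAreaBV_le`). The maps `x ↦ ρ(|x|) Γ(arg x)`, where the cutoff `ρ`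
vanishes near the origin and equals `1` off a small disk, and the curve `Γ` rests at the vertices
of the polygon and runs quickly along its sides, converge strictly to `u`. Their area is estimated
by `√(1 + |∇v|² + (det ∇v)²) ≤ 1 + |∇v| + |det ∇v|`, and `∫ |det ∇v| = ½ ∫ |Γ × Γ'|` is the area of
the polygon.

*Lower bound* (`IsJunction.le_relaxedAreaBV`). Let `v k → u` strictly, and almost everywhere after
passing to a subsequence. On almost every circle the length of the image curve is asymptotically at
least the sum `nL` of the jumps, since almost every point converges. The integral over `r` of these
lengths is at most `|D(v k)|(B) → nLℓ`, so by Fatou's lemma the lower limit of the lengths is exactly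
`nL` on almost every circle (`IsJunction.ae_liminf_length_eq`). Fix such a circle of small radius
`s`. Along a subsequence the image curves pass near the vertices and have nearly the minimal length
`nL`, so the area they sweep tends to that of the polygon (`abs_integral_cross_sub_le`,
`tendsto_integral_cross_polygon`). By Green's formula, that swept area is at most the integral of
`|det ∇(v k)|`, hence of the area density, over the disk of radius `s`
(`ofReal_abs_circleCross_le`). On the annulus `s < r < ℓ`, the density integrated over thin sectors
around the interfaces dominates the jumps, and elsewhere it is at least `1`. Letting `s` and the
opening of the thin sectors tend to `0` yields the three terms.

The proof uses only the consecutive distance `L` and cross product `κ` of the values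
(`IsJunction`). The area of the regular polygon, `½ n |κ|`, is computed in polar coordinates
(`volume_convexHull_regularVertex`).
-/

/-! ### Polar coordinates -/

@[simp] lemma polarPoint_zero_coord (r t : ℝ) : polarPoint r t 0 = r * Real.cos t := by
  simp [polarPoint]

@[simp] lemma polarPoint_one_coord (r t : ℝ) : polarPoint r t 1 = r * Real.sin t := by
  simp [polarPoint]

lemma norm_polarPoint (r t : ℝ) : ‖polarPoint r t‖ = |r| := by
  rw [EuclideanSpace.norm_eq, Fin.sum_univ_two, polarPoint_zero_coord, polarPoint_one_coord,
    ← Real.sqrt_sq_eq_abs]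
  congr 1
  simp only [Real.norm_eq_abs, sq_abs]
  linear_combination r ^ 2 * Real.cos_sq_add_sin_sq t

lemma polarPoint_add_two_pi_mul_int (r t : ℝ) (m : ℤ) :
    polarPoint r (t + 2 * Real.pi * m) = polarPoint r t := by
  have h : t + 2 * Real.pi * m = t + m * (2 * Real.pi) := by ring
  rw [polarPoint, h, Real.cos_add_int_mul_two_pi, Real.sin_add_int_mul_two_pi, polarPoint]

lemma polarPoint_add_two_pi (r t : ℝ) : polarPoint r (t + 2 * Real.pi) = polarPoint r t := by
  simpa using polarPoint_add_two_pi_mul_int r t 1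

lemma continuous_polarPoint : Continuous fun p : ℝ × ℝ => polarPoint p.1 p.2 := by
  refine (PiLp.continuous_toLp 2 _).comp (continuous_pi fun i => ?_)
  fin_cases i
  · change Continuous fun p : ℝ × ℝ => p.1 * Real.cos p.2
    fun_prop
  · change Continuous fun p : ℝ × ℝ => p.1 * Real.sin p.2
    fun_prop

lemma polarPoint_mem_ball {r t ℓ : ℝ} : polarPoint r t ∈ Metric.ball (0 : Plane) ℓ ↔ |r| < ℓ := by
  rw [mem_ball_zero_iff, norm_polarPoint]

/-- The integral of a periodic function over a period does not depend on the period chosen. -/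
lemma setLIntegral_Ioo_periodic {T : ℝ} (hT : 0 < T) {f : ℝ → ℝ≥0∞} (hf : Function.Periodic f T)
    (a b : ℝ) : ∫⁻ t in Set.Ioo a (a + T), f t = ∫⁻ t in Set.Ioo b (b + T), f t := by
  rw [setLIntegral_congr Ioo_ae_eq_Ioc, setLIntegral_congr (Ioo_ae_eq_Ioc (a := b))]
  exact (isAddFundamentalDomain_Ioc hT a).setLIntegral_eq (isAddFundamentalDomain_Ioc hT b) f
    hf.map_vadd_zmultiples

/-- Integration in polar coordinates over the plane, with the angles taken in any period. -/
lemma lintegral_polar {f : Plane → ℝ≥0∞} (hf : Measurable f) (a : ℝ) :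
    ∫⁻ x, f x = ∫⁻ r in Set.Ioi (0 : ℝ), ENNReal.ofReal r *
      ∫⁻ t in Set.Ioo a (a + 2 * Real.pi), f (polarPoint r t) := by
  have he : MeasurePreserving (fun q : ℝ × ℝ => (!₂[q.1, q.2] : Plane)) := by
    have h1 := (volume_preserving_finTwoArrow ℝ).symm
    have h2 := (PiLp.volume_preserving_toLp (Fin 2))
    have h3 := h2.comp h1
    convert! h3 using 1
  rw [← he.lintegral_comp hf, ← lintegral_comp_polarCoord_symm]
  have htarget : polarCoord.target = Set.Ioi (0 : ℝ) ×ˢ Set.Ioo (-Real.pi) Real.pi := rfl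
  have hmeas : Measurable fun p : ℝ × ℝ => f (polarPoint p.1 p.2) :=
    hf.comp continuous_polarPoint.measurable
  rw [htarget, Measure.volume_eq_prod, ← Measure.prod_restrict]
  have hfun : (fun p : ℝ × ℝ => ENNReal.ofReal p.1 • f !₂[(polarCoord.symm p).1,
      (polarCoord.symm p).2]) = fun p => ENNReal.ofReal p.1 * f (polarPoint p.1 p.2) := by
    ext p
    simp [polarPoint, polarCoord]
  rw [hfun, lintegral_prod]
  · refine lintegral_congr fun r => ?_
    have hr : Measurable fun t : ℝ => f (polarPoint r t) := by
      exact hmeas.comp (measurable_const.prodMk measurable_id)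
    dsimp only
    rw [lintegral_const_mul _ hr]
    congr 1
    have := setLIntegral_Ioo_periodic Real.two_pi_pos
      (f := fun t => f (polarPoint r t)) (fun t => by dsimp only; rw [polarPoint_add_two_pi])
      (-Real.pi) a
    rw [← this]
    congr 3
    ring
  · exact ((measurable_fst.ennreal_ofReal).mul hmeas).aemeasurable

/-- The measure `r dr dt` on the rectangle `(0, ℓ) × (a, a + 2π)`. -/
noncomputable def polarMeasure (ℓ a : ℝ) : Measure (ℝ × ℝ) :=
  ((volume.restrict (Set.Ioo 0 ℓ)).withDensity fun r => ENNReal.ofReal r).prod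
    (volume.restrict (Set.Ioo a (a + 2 * Real.pi)))

lemma setLIntegral_ball_polar {f : Plane → ℝ≥0∞} (hf : Measurable f) (ℓ a : ℝ) :
    ∫⁻ x in Metric.ball 0 ℓ, f x = ∫⁻ r in Set.Ioo (0 : ℝ) ℓ, ENNReal.ofReal r *
      ∫⁻ t in Set.Ioo a (a + 2 * Real.pi), f (polarPoint r t) := by
  rw [← lintegral_indicator measurableSet_ball,
    lintegral_polar (hf.indicator measurableSet_ball) a, ← Set.Ioi_inter_Iio (a := (0 : ℝ)),
    Set.inter_comm (Set.Ioi (0 : ℝ)), ← Measure.restrict_restrict measurableSet_Iio,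
    ← lintegral_indicator measurableSet_Iio]
  refine setLIntegral_congr_fun measurableSet_Ioi fun r hr => ?_
  have hr0 : |r| = r := abs_of_pos hr
  by_cases h : r < ℓ
  · have : ∀ t, (Metric.ball (0 : Plane) ℓ).indicator f (polarPoint r t) = f (polarPoint r t) :=
      fun t => Set.indicator_of_mem (polarPoint_mem_ball.2 (by rwa [hr0])) _
    simp only [this]
    rw [Set.indicator_of_mem (show r ∈ Set.Iio ℓ from h)]
  · have : ∀ t, (Metric.ball (0 : Plane) ℓ).indicator f (polarPoint r t) = 0 :=
      fun t => Set.indicator_of_notMem (fun h' => h (by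
        have := polarPoint_mem_ball.1 h'; rwa [hr0] at this)) _
    simp only [this]
    rw [Set.indicator_of_notMem (show r ∉ Set.Iio ℓ from h)]
    simp

lemma measurePreserving_polarPoint (ℓ a : ℝ) :
    MeasurePreserving (fun p : ℝ × ℝ => polarPoint p.1 p.2) (polarMeasure ℓ a)
      (volume.restrict (Metric.ball 0 ℓ)) := by
  refine ⟨continuous_polarPoint.measurable, ?_⟩
  ext A hA
  rw [Measure.map_apply continuous_polarPoint.measurable hA, ← lintegral_indicator_one hA,
    setLIntegral_ball_polar (measurable_one.indicator hA),
    ← lintegral_indicator_one (continuous_polarPoint.measurable hA), polarMeasure]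
  have hm : Measurable (((fun p : ℝ × ℝ => polarPoint p.1 p.2) ⁻¹' A).indicator
      (1 : ℝ × ℝ → ℝ≥0∞)) :=
    measurable_one.indicator (continuous_polarPoint.measurable hA)
  rw [lintegral_prod _ hm.aemeasurable, lintegral_withDensity_eq_lintegral_mul _ (by fun_prop)]
  · rfl
  · exact hm.lintegral_prod_right'

/-- A property that holds almost everywhere in a disk holds, for almost every angle, almost
everywhere on the corresponding radius. -/
lemma ae_angle_ae_radius {ℓ : ℝ} {p : Plane → Prop}
    (hp : ∀ᵐ x ∂(volume.restrict (Metric.ball (0 : Plane) ℓ)), p x) :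
    ∀ᵐ t : ℝ, ∀ᵐ r ∂(volume.restrict (Set.Ioo 0 ℓ)), p (polarPoint r t) := by
  have key : ∀ a : ℝ, ∀ᵐ t ∂(volume.restrict (Set.Ioo a (a + 2 * Real.pi))),
      ∀ᵐ r ∂(volume.restrict (Set.Ioo 0 ℓ)), p (polarPoint r t) := by
    intro a
    have h1 := (measurePreserving_polarPoint ℓ a).quasiMeasurePreserving.ae hp
    rw [polarMeasure] at h1
    have h2 := (Measure.measurePreserving_swap (μ := volume.restrict (Set.Ioo a (a + 2 * Real.pi)))
      (ν := (volume.restrict (Set.Ioo 0 ℓ)).withDensity fun r =>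
        ENNReal.ofReal r)).quasiMeasurePreserving.ae h1
    filter_upwards [Measure.ae_ae_of_ae_prod h2] with t ht
    have ht' := (ae_withDensity_iff (by fun_prop)).1 ht
    filter_upwards [ht', ae_restrict_mem measurableSet_Ioo] with r hr hr0
    exact hr (by simpa using hr0.1)
  have hcover : (⋃ m : ℤ, Set.Ioo ((m : ℝ) * 1) ((m : ℝ) * 1 + 2 * Real.pi)) = Set.univ := by
    refine Set.eq_univ_of_forall fun t => Set.mem_iUnion.2 ⟨⌈t⌉ - 1, ?_, ?_⟩
    · push_cast; linarith [Int.ceil_lt_add_one t]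
    · push_cast; linarith [Int.le_ceil t, Real.pi_gt_three]
  have := (ae_restrict_iUnion_iff (μ := volume)
    (fun m : ℤ => Set.Ioo ((m : ℝ) * 1) ((m : ℝ) * 1 + 2 * Real.pi)) (fun t =>
      ∀ᵐ r ∂(volume.restrict (Set.Ioo 0 ℓ)), p (polarPoint r t))).2 fun m => key _
  rwa [hcover, Measure.restrict_univ] at this

/-- Every point of the plane has polar coordinates, with angle in any given period. -/
lemma exists_polarPoint (x : Plane) (a : ℝ) :
    ∃ t ∈ Set.Ico a (a + 2 * Real.pi), x = polarPoint ‖x‖ t := by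
  have h0 : x = polarPoint ‖x‖ (Complex.arg ⟨x 0, x 1⟩) := by
    have hn : ‖x‖ = ‖(⟨x 0, x 1⟩ : ℂ)‖ := by
      rw [EuclideanSpace.norm_eq, Complex.norm_def, Complex.normSq_mk, Fin.sum_univ_two]
      congr 1
      simp only [Real.norm_eq_abs, sq_abs]
      ring
    ext i
    fin_cases i
    · simp [hn, Complex.norm_mul_cos_arg]
    · simp [hn, Complex.norm_mul_sin_arg]
  set t := Complex.arg ⟨x 0, x 1⟩ with ht
  refine ⟨toIcoMod Real.two_pi_pos a t, toIcoMod_mem_Ico _ _ _, ?_⟩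
  have := self_sub_toIcoDiv_zsmul Real.two_pi_pos a t
  rw [← this, zsmul_eq_mul]
  have h2 : t - (toIcoDiv Real.two_pi_pos a t : ℝ) * (2 * Real.pi) =
      t + 2 * Real.pi * ((-toIcoDiv Real.two_pi_pos a t : ℤ) : ℝ) := by push_cast; ring
  rw [h2, polarPoint_add_two_pi_mul_int]
  exact h0

/-- A property that fails on a disk only along countably many directions holds almost everywhere. -/
lemma ae_ball_of_forall_angle {ℓ : ℝ} {p : Plane → Prop} {Z : Set ℝ} (hZ : Z.Countable)
    (hp : ∀ r, 0 < r → r < ℓ → ∀ t, t ∉ Z → p (polarPoint r t)) :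
    ∀ᵐ x ∂(volume.restrict (Metric.ball (0 : Plane) ℓ)), p x := by
  let N : Set Plane :=
    ⋃ z ∈ Z, ((Submodule.span ℝ {polarPoint 1 z} : Submodule ℝ Plane) : Set Plane)
  have hN : volume N = 0 := by
    refine (measure_biUnion_null_iff hZ).2 fun z _ => Measure.addHaar_submodule _ _ fun htop => ?_
    have h1 : Module.finrank ℝ (Submodule.span ℝ {polarPoint 1 z}) ≤ 1 :=
      (finrank_span_le_card _).trans (by simp)
    rw [htop, finrank_top] at h1
    simp at h1
  have h0 : volume ({0} : Set Plane) = 0 := measure_singleton 0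
  rw [ae_restrict_iff' measurableSet_ball]
  filter_upwards [measure_eq_zero_iff_ae_notMem.1 hN, measure_eq_zero_iff_ae_notMem.1 h0]
    with x hxN hx0 hxb
  obtain ⟨t, -, ht⟩ := exists_polarPoint x 0
  rw [ht]
  refine hp _ (norm_pos_iff.2 fun h => hx0 h) (mem_ball_zero_iff.1 hxb) t fun htZ => hxN ?_
  refine Set.mem_biUnion htZ (Submodule.mem_span_singleton.2 ⟨‖x‖, ?_⟩)
  conv_rhs => rw [ht]
  ext i
  fin_cases i <;> simp

/-! ### Gradients in polar coordinates -/

/-- The planar cross product `x₀ y₁ - x₁ y₀`. -/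
def cross (x y : Plane) : ℝ := x 0 * y 1 - x 1 * y 0

/-- The squared Frobenius norm of the gradient of `v`. -/
noncomputable def gradSq (v : Plane → Plane) (x : Plane) : ℝ := ∑ i, ∑ j, partialD v i j x ^ 2

/-- The Frobenius norm of the gradient of `v`. -/
noncomputable def gradNorm (v : Plane → Plane) (x : Plane) : ℝ := √(gradSq v x)

lemma gradSq_nonneg (v : Plane → Plane) (x : Plane) : 0 ≤ gradSq v x :=
  Finset.sum_nonneg fun _ _ => Finset.sum_nonneg fun _ _ => sq_nonneg _

lemma gradNorm_nonneg (v : Plane → Plane) (x : Plane) : 0 ≤ gradNorm v x := Real.sqrt_nonneg _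

lemma norm_sq_plane (x : Plane) : ‖x‖ ^ 2 = x 0 ^ 2 + x 1 ^ 2 := by
  rw [EuclideanSpace.norm_sq_eq, Fin.sum_univ_two]
  simp only [Real.norm_eq_abs, sq_abs]

lemma fderiv_apply_coord (v : Plane → Plane) (x e : Plane) (i : Fin 2) :
    (fderiv ℝ v x e) i = e 0 * partialD v i 0 x + e 1 * partialD v i 1 x := by
  have he : e = e 0 • EuclideanSpace.single 0 1 + e 1 • EuclideanSpace.single 1 1 := by
    ext j; fin_cases j <;> simp
  conv_lhs => rw [he]
  simp [partialD]

lemma abs_cross_le (x y : Plane) : |cross x y| ≤ ‖x‖ * ‖y‖ := by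
  apply abs_le_of_sq_le_sq _ (by positivity)
  rw [mul_pow, norm_sq_plane, norm_sq_plane, cross]
  nlinarith [sq_nonneg (x 0 * y 0 + x 1 * y 1)]

/-- The squared norm of the gradient is the sum of those of the radial and of the normalized angular
derivative. The direction `s (-sin t, cos t)` of the angular derivative at the point with polar
coordinates `(s, t)` has polar coordinates `(s, t + π / 2)`. -/
lemma sq_mul_gradSq (v : Plane → Plane) (x : Plane) (s t : ℝ) :
    s ^ 2 * gradSq v x = s ^ 2 * ‖fderiv ℝ v x (polarPoint 1 t)‖ ^ 2 +
      ‖fderiv ℝ v x (polarPoint s (t + Real.pi / 2))‖ ^ 2 := by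
  simp only [norm_sq_plane, fderiv_apply_coord, gradSq, Fin.sum_univ_two, polarPoint_zero_coord,
    polarPoint_one_coord, Real.cos_add_pi_div_two, Real.sin_add_pi_div_two]
  have h : Real.sin t ^ 2 = 1 - Real.cos t ^ 2 := by
    linear_combination Real.sin_sq_add_cos_sq t
  ring_nf
  simp only [h]
  ring

lemma norm_angular_le (v : Plane → Plane) (x : Plane) {s : ℝ} (hs : 0 ≤ s) (t : ℝ) :
    ‖fderiv ℝ v x (polarPoint s (t + Real.pi / 2))‖ ≤ s * gradNorm v x := by
  apply (sq_le_sq₀ (by positivity) (mul_nonneg hs (gradNorm_nonneg v x))).1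
  rw [mul_pow, gradNorm, Real.sq_sqrt (gradSq_nonneg v x), sq_mul_gradSq v x s t]
  nlinarith [sq_nonneg (s * ‖fderiv ℝ v x (polarPoint 1 t)‖)]

lemma gradNorm_le_polar (v : Plane → Plane) (x : Plane) {s : ℝ} (hs : 0 ≤ s) (t : ℝ) :
    s * gradNorm v x ≤ s * ‖fderiv ℝ v x (polarPoint 1 t)‖ +
      ‖fderiv ℝ v x (polarPoint s (t + Real.pi / 2))‖ := by
  apply (sq_le_sq₀ (mul_nonneg hs (gradNorm_nonneg v x)) (by positivity)).1
  rw [mul_pow, gradNorm, Real.sq_sqrt (gradSq_nonneg v x), sq_mul_gradSq v x s t]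
  nlinarith [mul_nonneg (mul_nonneg hs (norm_nonneg (fderiv ℝ v x (polarPoint 1 t))))
    (norm_nonneg (fderiv ℝ v x (polarPoint s (t + Real.pi / 2))))]

lemma cross_polar_eq (v : Plane → Plane) (x : Plane) (s t : ℝ) :
    cross (fderiv ℝ v x (polarPoint 1 t)) (fderiv ℝ v x (polarPoint s (t + Real.pi / 2))) =
      s * jacobianDet v x := by
  simp only [cross, fderiv_apply_coord, jacobianDet, polarPoint_zero_coord,
    polarPoint_one_coord, Real.cos_add_pi_div_two, Real.sin_add_pi_div_two]
  linear_combination (s * (partialD v 0 0 x * partialD v 1 1 x -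
    partialD v 0 1 x * partialD v 1 0 x)) * Real.sin_sq_add_cos_sq t

lemma hasDerivAt_plane {f : ℝ → Plane} {f' : Plane} {t : ℝ}
    (h : ∀ i, HasDerivAt (fun t => f t i) (f' i) t) : HasDerivAt f f' t :=
  (PiLp.continuousLinearEquiv 2 ℝ (fun _ : Fin 2 => ℝ)).symm.toContinuousLinearMap.hasFDerivAt
    |>.comp_hasDerivAt t (hasDerivAt_pi.2 h)

lemma hasDerivAt_polarPoint_angle (s t : ℝ) :
    HasDerivAt (fun t => polarPoint s t) (polarPoint s (t + Real.pi / 2)) t := by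
  refine hasDerivAt_plane fun i => ?_
  fin_cases i
  · simpa [polarPoint, Real.cos_add_pi_div_two] using (Real.hasDerivAt_cos t).const_mul s
  · simpa [polarPoint, Real.sin_add_pi_div_two] using (Real.hasDerivAt_sin t).const_mul s

lemma hasDerivAt_polarPoint_radius (s t : ℝ) :
    HasDerivAt (fun s => polarPoint s t) (polarPoint 1 t) s := by
  refine hasDerivAt_plane fun i => ?_
  fin_cases i
  · simpa [polarPoint] using (hasDerivAt_id s).mul_const (Real.cos t)
  · simpa [polarPoint] using (hasDerivAt_id s).mul_const (Real.sin t)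

/-- The angular derivative `∂_t (v (polarPoint s t))`. -/
noncomputable def angularDeriv (v : Plane → Plane) (s t : ℝ) : Plane :=
  fderiv ℝ v (polarPoint s t) (polarPoint s (t + Real.pi / 2))

/-- The radial derivative `∂_s (v (polarPoint s t))`. -/
noncomputable def radialDeriv (v : Plane → Plane) (s t : ℝ) : Plane :=
  fderiv ℝ v (polarPoint s t) (polarPoint 1 t)

section Ball

variable {v : Plane → Plane} {ℓ : ℝ}

lemma hasDerivAt_angle (hv : DifferentiableOn ℝ v (Metric.ball 0 ℓ)) {s : ℝ} (hs : |s| < ℓ)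
    (t : ℝ) : HasDerivAt (fun t => v (polarPoint s t)) (angularDeriv v s t) t := by
  have h := (hv.differentiableAt (Metric.isOpen_ball.mem_nhds
    (polarPoint_mem_ball (t := t).2 hs))).hasFDerivAt
  exact h.comp_hasDerivAt t (hasDerivAt_polarPoint_angle s t)

lemma hasDerivAt_radius (hv : DifferentiableOn ℝ v (Metric.ball 0 ℓ)) {s : ℝ} (hs : |s| < ℓ)
    (t : ℝ) : HasDerivAt (fun s => v (polarPoint s t)) (radialDeriv v s t) s := by
  have h := (hv.differentiableAt (Metric.isOpen_ball.mem_nhds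
    (polarPoint_mem_ball (t := t).2 hs))).hasFDerivAt
  exact h.comp_hasDerivAt s (hasDerivAt_polarPoint_radius s t)

lemma continuousOn_angularDeriv (hv : ContDiffOn ℝ 1 v (Metric.ball 0 ℓ)) :
    ContinuousOn (fun p : ℝ × ℝ => angularDeriv v p.1 p.2) {p | |p.1| < ℓ} := by
  have h := hv.continuousOn_fderiv_of_isOpen Metric.isOpen_ball le_rfl
  have h1 : ContinuousOn (fun p : ℝ × ℝ => fderiv ℝ v (polarPoint p.1 p.2)) {p | |p.1| < ℓ} :=
    h.comp continuous_polarPoint.continuousOn fun p hp => polarPoint_mem_ball.2 hp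
  refine h1.clm_apply (Continuous.continuousOn ?_)
  exact continuous_polarPoint.comp (g := fun p : ℝ × ℝ => polarPoint p.1 p.2)
    (f := fun p : ℝ × ℝ => (p.1, p.2 + Real.pi / 2)) (by fun_prop)

lemma continuousOn_radialDeriv (hv : ContDiffOn ℝ 1 v (Metric.ball 0 ℓ)) :
    ContinuousOn (fun p : ℝ × ℝ => radialDeriv v p.1 p.2) {p | |p.1| < ℓ} := by
  have h := hv.continuousOn_fderiv_of_isOpen Metric.isOpen_ball le_rfl
  have h1 : ContinuousOn (fun p : ℝ × ℝ => fderiv ℝ v (polarPoint p.1 p.2)) {p | |p.1| < ℓ} :=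
    h.comp continuous_polarPoint.continuousOn fun p hp => polarPoint_mem_ball.2 hp
  refine h1.clm_apply (Continuous.continuousOn ?_)
  exact continuous_polarPoint.comp (g := fun p : ℝ × ℝ => polarPoint p.1 p.2)
    (f := fun p : ℝ × ℝ => (1, p.2)) (by fun_prop)

lemma continuous_angularDeriv (hv : ContDiffOn ℝ 1 v (Metric.ball 0 ℓ)) {s : ℝ} (hs : |s| < ℓ) :
    Continuous (angularDeriv v s) := by
  rw [← continuousOn_univ]
  exact (continuousOn_angularDeriv hv).comp (f := fun t : ℝ => (s, t)) (by fun_prop) fun _ _ => hs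

end Ball

lemma measurable_partialD (v : Plane → Plane) (i j : Fin 2) : Measurable (partialD v i j) := by
  have h := (measurable_fderiv_apply_const ℝ v (EuclideanSpace.single j 1))
  exact (EuclideanSpace.proj i : Plane →L[ℝ] ℝ).continuous.measurable.comp h

lemma measurable_jacobianDet (v : Plane → Plane) : Measurable (jacobianDet v) :=
  ((measurable_partialD v 0 0).mul (measurable_partialD v 1 1)).sub
    ((measurable_partialD v 0 1).mul (measurable_partialD v 1 0))

lemma measurable_gradSq (v : Plane → Plane) : Measurable (gradSq v) :=
  Finset.measurable_sum _ fun i _ => Finset.measurable_sum _ fun j _ =>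
    (measurable_partialD v i j).pow_const 2

lemma measurable_gradNorm (v : Plane → Plane) : Measurable (gradNorm v) :=
  (measurable_gradSq v).sqrt

/-- The area integrand `√(1 + |∇v|² + (det ∇v)²)`. -/
noncomputable def areaDensity (v : Plane → Plane) (x : Plane) : ℝ :=
  √(1 + gradSq v x + jacobianDet v x ^ 2)

lemma graphArea_eq (v : Plane → Plane) (Ω : Set Plane) :
    graphArea v Ω = ∫⁻ x in Ω, ENNReal.ofReal (areaDensity v x) := rfl

lemma measurable_areaDensity (v : Plane → Plane) : Measurable (areaDensity v) :=
  (((measurable_gradSq v).const_add 1).add ((measurable_jacobianDet v).pow_const 2)).sqrt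

lemma one_le_areaDensity (v : Plane → Plane) (x : Plane) : 1 ≤ areaDensity v x := by
  apply Real.le_sqrt_of_sq_le
  nlinarith [gradSq_nonneg v x, sq_nonneg (jacobianDet v x)]

lemma gradNorm_le_areaDensity (v : Plane → Plane) (x : Plane) : gradNorm v x ≤ areaDensity v x :=
  Real.sqrt_le_sqrt (by nlinarith [sq_nonneg (jacobianDet v x)])

lemma abs_jacobianDet_le_areaDensity (v : Plane → Plane) (x : Plane) :
    |jacobianDet v x| ≤ areaDensity v x := by
  rw [← Real.sqrt_sq_eq_abs]
  exact Real.sqrt_le_sqrt (by nlinarith [gradSq_nonneg v x])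

lemma areaDensity_le (v : Plane → Plane) (x : Plane) :
    areaDensity v x ≤ 1 + gradNorm v x + |jacobianDet v x| := by
  have h1 := gradNorm_nonneg v x
  have h2 := abs_nonneg (jacobianDet v x)
  apply Real.sqrt_le_iff.2 ⟨by positivity, ?_⟩
  have h3 : gradNorm v x ^ 2 = gradSq v x := Real.sq_sqrt (gradSq_nonneg v x)
  have h4 := sq_abs (jacobianDet v x)
  nlinarith [mul_nonneg h1 h2]

/-! ### Total variation -/

section IntegrationByParts

variable {Ω : Set Plane}

lemma integrable_mul_of_tsupport_subset {f g : Plane → ℝ} (hf : ContinuousOn f Ω)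
    (hg : Continuous g) (hgc : HasCompactSupport g) (hgΩ : tsupport g ⊆ Ω) :
    Integrable (fun x => f x * g x) := by
  have hsub : Function.support (fun x => f x * g x) ⊆ tsupport g := fun x hx =>
    subset_tsupport g (fun h0 => hx (by simp [h0]))
  rw [← integrableOn_iff_integrable_of_support_subset hsub]
  exact ((hf.mono hgΩ).mul hg.continuousOn).integrableOn_compact hgc

lemma contDiff_coord {ψ : Plane → Plane} (hψ : ContDiff ℝ 1 ψ) (j : Fin 2) :
    ContDiff ℝ 1 fun x => ψ x j :=
  (EuclideanSpace.proj j : Plane →L[ℝ] ℝ).contDiff.comp hψ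

lemma partialD_eq_fderiv_coord {v : Plane → Plane} {x : Plane} (hv : DifferentiableAt ℝ v x)
    (i j : Fin 2) :
    partialD v i j x = fderiv ℝ (fun y => v y i) x (EuclideanSpace.single j 1) := by
  have h := ((EuclideanSpace.proj i : Plane →L[ℝ] ℝ).hasFDerivAt.comp x hv.hasFDerivAt).fderiv
  have h' : fderiv ℝ (fun y => v y i) x =
    (EuclideanSpace.proj i : Plane →L[ℝ] ℝ).comp (fderiv ℝ v x) := h
  rw [h']
  rfl

lemma tsupport_coord_subset (ψ : Plane → Plane) (j : Fin 2) :
    tsupport (fun x => ψ x j) ⊆ tsupport ψ :=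
  closure_mono fun x hx h0 => hx (by simp [h0])

lemma hasCompactSupport_coord {ψ : Plane → Plane} (hψ : HasCompactSupport ψ) (j : Fin 2) :
    HasCompactSupport fun x => ψ x j :=
  hψ.of_isClosed_subset (isClosed_tsupport _) (tsupport_coord_subset ψ j)

lemma continuousOn_partialD {v : Plane → Plane} (hΩ : IsOpen Ω) (hv : ContDiffOn ℝ 1 v Ω)
    (i j : Fin 2) : ContinuousOn (partialD v i j) Ω :=
  (EuclideanSpace.proj i : Plane →L[ℝ] ℝ).continuous.comp_continuousOn
    ((hv.continuousOn_fderiv_of_isOpen hΩ le_rfl).clm_apply continuousOn_const)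

lemma continuous_partialD {ψ : Plane → Plane} (hψ : ContDiff ℝ 1 ψ) (i j : Fin 2) :
    Continuous (partialD ψ i j) := by
  rw [← continuousOn_univ]
  exact continuousOn_partialD isOpen_univ hψ.contDiffOn i j

lemma tsupport_partialD_subset (ψ : Plane → Plane) (i j : Fin 2) :
    tsupport (partialD ψ i j) ⊆ tsupport ψ := by
  refine (closure_mono fun x hx => ?_).trans (tsupport_fderiv_subset ℝ (f := ψ))
  intro h0
  exact hx (by simp [partialD, h0])

lemma hasCompactSupport_partialD {ψ : Plane → Plane} (hψ : HasCompactSupport ψ) (i j : Fin 2) :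
    HasCompactSupport (partialD ψ i j) :=
  hψ.of_isClosed_subset (isClosed_tsupport _) (tsupport_partialD_subset ψ i j)

/-- Integration by parts against a compactly supported field. -/
lemma integral_mul_partialD (hΩ : IsOpen Ω) {v ψ : Plane → Plane} (hv : ContDiffOn ℝ 1 v Ω)
    (hψ : ContDiff ℝ 1 ψ) (hψc : HasCompactSupport ψ) (hψΩ : tsupport ψ ⊆ Ω) (i j : Fin 2) :
    ∫ x in Ω, v x i * partialD ψ j j x = - ∫ x in Ω, partialD v i j x * ψ x j := by
  have hvi : ContinuousOn (fun x => v x i) Ω :=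
    (EuclideanSpace.proj i : Plane →L[ℝ] ℝ).continuous.comp_continuousOn hv.continuousOn
  have hgΩ := (tsupport_coord_subset ψ j).trans hψΩ
  have hψd : ∀ x, partialD ψ j j x =
      fderiv ℝ (fun y => ψ y j) x (EuclideanSpace.single j 1) := fun x =>
    partialD_eq_fderiv_coord (hψ.differentiable one_ne_zero x) j j
  have hd : ∀ x ∈ Ω, DifferentiableAt ℝ v x := fun x hx =>
    (hv.differentiableOn one_ne_zero).differentiableAt (hΩ.mem_nhds hx)
  have hdi : ∀ x ∈ Ω, DifferentiableAt ℝ (fun y => v y i) x := fun x hx =>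
    (EuclideanSpace.proj i : Plane →L[ℝ] ℝ).differentiableAt.comp x (hd x hx)
  have hz : ∀ x, x ∉ Ω → ψ x j = 0 := fun x hx =>
    image_eq_zero_of_notMem_tsupport (f := fun x => ψ x j) fun h => hx (hgΩ h)
  have hz' : ∀ x, x ∉ Ω → partialD ψ j j x = 0 := fun x hx =>
    image_eq_zero_of_notMem_tsupport fun h => hx (hψΩ (tsupport_partialD_subset ψ j j h))
  rw [setIntegral_eq_integral_of_forall_compl_eq_zero fun x hx => by rw [hz' x hx, mul_zero],
    setIntegral_eq_integral_of_forall_compl_eq_zero fun x hx => by rw [hz x hx, mul_zero]]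
  have hfun : (fun x => partialD v i j x * ψ x j) =
      fun x => fderiv ℝ (fun y => v y i) x (EuclideanSpace.single j 1) * ψ x j := by
    ext x
    by_cases hx : x ∈ Ω
    · rw [partialD_eq_fderiv_coord (hd x hx)]
    · rw [hz x hx, mul_zero, mul_zero]
  have h1 := integrable_mul_of_tsupport_subset (continuousOn_partialD hΩ hv i j)
    (contDiff_coord hψ j).continuous (hasCompactSupport_coord hψc j) hgΩ
  have h2 := integrable_mul_of_tsupport_subset hvi (continuous_partialD hψ j j)
    (hasCompactSupport_partialD hψc j j) ((tsupport_partialD_subset ψ j j).trans hψΩ)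
  have h3 := integrable_mul_of_tsupport_subset hvi
    (contDiff_coord hψ j).continuous (hasCompactSupport_coord hψc j) hgΩ
  rw [hfun] at h1 ⊢
  simp only [hψd] at h2 ⊢
  exact integral_mul_fderiv_eq_neg_fderiv_mul_of_integrable h1 h2 h3
    (fun x hx => hdi x (hgΩ hx))
    fun x _ => (contDiff_coord hψ j).differentiable one_ne_zero x

lemma IsVariationTest.sum_integral_divergence {φ : Fin 2 → Plane → Plane}
    (hφ : IsVariationTest Ω φ) (hΩ : IsOpen Ω) {v : Plane → Plane} (hv : ContDiffOn ℝ 1 v Ω) :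
    ∑ i, ∫ x in Ω, v x i * divergence (φ i) x =
      - ∫ x in Ω, ∑ i, ∑ j, partialD v i j x * φ i x j := by
  have hvi : ∀ i, ContinuousOn (fun x => v x i) Ω := fun i =>
    (EuclideanSpace.proj i : Plane →L[ℝ] ℝ).continuous.comp_continuousOn hv.continuousOn
  have h1 : ∀ i j, Integrable (fun x => partialD v i j x * φ i x j) (volume.restrict Ω) :=
    fun i j => (integrable_mul_of_tsupport_subset (continuousOn_partialD hΩ hv i j)
      (contDiff_coord (hφ.contDiff i) j).continuous
      (hasCompactSupport_coord (hφ.compactSupport i) j)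
      ((tsupport_coord_subset _ j).trans (hφ.support_subset i))).integrableOn
  have h2 : ∀ i j, Integrable (fun x => v x i * partialD (φ i) j j x) (volume.restrict Ω) :=
    fun i j => (integrable_mul_of_tsupport_subset (hvi i)
      (continuous_partialD (hφ.contDiff i) j j)
      (hasCompactSupport_partialD (hφ.compactSupport i) j j)
      ((tsupport_partialD_subset _ j j).trans (hφ.support_subset i))).integrableOn
  rw [integral_finsetSum _ fun i _ => integrable_finsetSum _ fun j _ => h1 i j,
    ← Finset.sum_neg_distrib]
  refine Finset.sum_congr rfl fun i _ => ?_
  rw [integral_finsetSum _ fun j _ => h1 i j, ← Finset.sum_neg_distrib]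
  simp only [divergence, Finset.mul_sum]
  rw [integral_finsetSum _ fun j _ => h2 i j]
  exact Finset.sum_congr rfl fun j _ => integral_mul_partialD hΩ hv (hφ.contDiff i)
    (hφ.compactSupport i) (hφ.support_subset i) i j

end IntegrationByParts

lemma abs_sum_mul_le_gradNorm (v : Plane → Plane) (x : Plane) {z : Fin 2 → Plane}
    (hz : ∑ i, ‖z i‖ ^ 2 ≤ 1) : |∑ i, ∑ j, partialD v i j x * z i j| ≤ gradNorm v x := by
  have h := Finset.sum_mul_sq_le_sq_mul_sq (Finset.univ : Finset (Fin 2 × Fin 2))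
    (fun p => partialD v p.1 p.2 x) (fun p => z p.1 p.2)
  simp only [Fintype.sum_prod_type] at h
  have hz' : ∑ i, ∑ j, z i j ^ 2 ≤ 1 := by
    simpa only [norm_sq_plane, Fin.sum_univ_two] using hz
  rw [← Real.sqrt_sq_eq_abs]
  refine Real.sqrt_le_sqrt (h.trans ?_)
  exact mul_le_of_le_one_right (gradSq_nonneg v x) hz'

/-- The total variation of a `C¹` map is at most the integral of the norm of its gradient. -/
lemma totalVariation_le_lintegral_gradNorm {Ω : Set Plane} (hΩ : IsOpen Ω) {v : Plane → Plane}
    (hv : ContDiffOn ℝ 1 v Ω) :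
    totalVariation v Ω ≤ ∫⁻ x in Ω, ENNReal.ofReal (gradNorm v x) := by
  refine iSup₂_le fun φ hφ => ?_
  rw [hφ.sum_integral_divergence hΩ hv, ← integral_neg]
  refine (ENNReal.ofReal_le_ofReal (le_abs_self _)).trans ?_
  rw [← Real.norm_eq_abs, ofReal_norm]
  refine (enorm_integral_le_lintegral_enorm _).trans (lintegral_mono fun x => ?_)
  rw [enorm_neg, ← ofReal_norm, Real.norm_eq_abs]
  exact ENNReal.ofReal_le_ofReal (abs_sum_mul_le_gradNorm v x (hφ.norm_le x))

lemma continuous_divergence {ψ : Plane → Plane} (hψ : ContDiff ℝ 1 ψ) :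
    Continuous (divergence ψ) :=
  continuous_finsetSum _ fun j _ => continuous_partialD hψ j j

lemma exists_bound_divergence {ψ : Plane → Plane} (hψ : ContDiff ℝ 1 ψ)
    (hψc : HasCompactSupport ψ) : ∃ C : ℝ, ∀ x, ‖divergence ψ x‖ ≤ C := by
  refine (continuous_divergence hψ).bounded_above_of_compact_support ?_
  refine hψc.of_isClosed_subset (isClosed_tsupport _) (closure_minimal ?_ (isClosed_tsupport _))
  intro x hx
  by_contra h
  refine hx (Finset.sum_eq_zero fun j _ => ?_)
  exact image_eq_zero_of_notMem_tsupport fun h' => h (tsupport_partialD_subset ψ j j h')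

/-- The total variation is lower semicontinuous with respect to convergence in `L¹`. -/
lemma totalVariation_le_liminf {Ω : Set Plane} {v : ℕ → Plane → Plane} {u : Plane → Plane}
    (hv : ∀ k, IntegrableOn (v k) Ω) (hu : IntegrableOn u Ω)
    (h : Tendsto (fun k => eLpNorm (v k - u) 1 (volume.restrict Ω)) atTop (𝓝 0)) :
    totalVariation u Ω ≤ liminf (fun k => totalVariation (v k) Ω) atTop := by
  refine iSup₂_le fun φ hφ => ?_
  have hcoord : ∀ {w : Plane → Plane} (_ : IntegrableOn w Ω) (i : Fin 2),
      Integrable (fun x => w x i * divergence (φ i) x) (volume.restrict Ω) := by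
    intro w hw i
    obtain ⟨C, hC⟩ := exists_bound_divergence (hφ.contDiff i) (hφ.compactSupport i)
    exact ((EuclideanSpace.proj i : Plane →L[ℝ] ℝ).integrable_comp hw).mul_bdd
      (continuous_divergence (hφ.contDiff i)).aestronglyMeasurable (ae_of_all _ hC)
  have hlim : Tendsto (fun k => ∑ i, ∫ x in Ω, v k x i * divergence (φ i) x) atTop
      (𝓝 (∑ i, ∫ x in Ω, u x i * divergence (φ i) x)) := by
    refine tendsto_finsetSum _ fun i _ => ?_
    refine tendsto_integral_of_L1' _ (hcoord hu i).aestronglyMeasurable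
      (Eventually.of_forall fun k => hcoord (hv k) i) ?_
    obtain ⟨C, hC⟩ := exists_bound_divergence (hφ.contDiff i) (hφ.compactSupport i)
    have hle : ∀ k, eLpNorm ((fun x => v k x i * divergence (φ i) x) -
        fun x => u x i * divergence (φ i) x) 1 (volume.restrict Ω) ≤
        ENNReal.ofReal C * eLpNorm (v k - u) 1 (volume.restrict Ω) := by
      intro k
      refine eLpNorm_le_mul_eLpNorm_of_ae_le_mul (ae_of_all _ fun x => ?_) 1
      simp only [Pi.sub_apply]
      rw [← sub_mul, norm_mul, mul_comm]
      refine mul_le_mul (hC x) ?_ (norm_nonneg _) ((norm_nonneg _).trans (hC x))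
      exact PiLp.norm_apply_le (v k x - u x) i
    refine tendsto_of_tendsto_of_tendsto_of_le_of_le tendsto_const_nhds ?_ (fun k => zero_le) hle
    simpa using ENNReal.Tendsto.const_mul h (Or.inr ENNReal.ofReal_ne_top)
  rw [← (ENNReal.tendsto_ofReal hlim).liminf_eq]
  refine liminf_le_liminf (Eventually.of_forall fun k => ?_)
  exact le_iSup₂ (f := fun (φ : Fin 2 → Plane → Plane) (_ : IsVariationTest Ω φ) =>
    ENNReal.ofReal (∑ i, ∫ x in Ω, v k x i * divergence (φ i) x)) φ hφ

open scoped Manifold in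
/-- Admissible test fields are rich enough to recover the norm of a continuous gradient up to `ε` on
a compact disk: locally, the normalized (constant) gradient at the centre does it, and the
constraints are convex in the value of the field. -/
lemma exists_isVariationTest {v : Plane → Plane} {ℓ r : ℝ} (hr : r < ℓ)
    (hv : ContDiffOn ℝ 1 v (Metric.ball 0 ℓ)) {ε : ℝ} (hε : 0 < ε) :
    ∃ φ : Fin 2 → Plane → Plane, IsVariationTest (Metric.ball 0 ℓ) φ ∧
      ∀ x ∈ Metric.ball (0 : Plane) ℓ,
        (Metric.closedBall (0 : Plane) r).indicator (gradNorm v) x - ε ≤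
          ∑ i, ∑ j, partialD v i j x * φ i x j := by
  classical
  let F := EuclideanSpace ℝ (Fin 2 × Fin 2)
  let a : Plane → F := fun x => WithLp.toLp 2 fun p => partialD v p.1 p.2 x
  have hinner : ∀ (z : F) x, inner ℝ z (a x) = ∑ i, ∑ j, partialD v i j x * z (i, j) := by
    intro z x
    rw [PiLp.inner_apply, Fintype.sum_prod_type]
    rfl
  have hnorm : ∀ x, ‖a x‖ = gradNorm v x := by
    intro x
    rw [EuclideanSpace.norm_eq, Fintype.sum_prod_type, gradNorm, gradSq]
    simp only [Real.norm_eq_abs, sq_abs]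
    rfl
  have ha : ContinuousOn a (Metric.ball 0 ℓ) :=
    (PiLp.continuous_toLp 2 _).comp_continuousOn (continuousOn_pi.2 fun p =>
      continuousOn_partialD Metric.isOpen_ball hv p.1 p.2)
  obtain ⟨ρ, hrρ, hρ⟩ := exists_between hr
  let t : Plane → Set F := fun x => {z | ‖z‖ ≤ 1 ∧
    (x ∈ Metric.ball (0 : Plane) ℓ →
      (Metric.closedBall (0 : Plane) r).indicator (gradNorm v) x - ε ≤ inner ℝ z (a x)) ∧
    (x ∉ Metric.ball (0 : Plane) ρ → z = 0)}
  have ht : ∀ x, Convex ℝ (t x) := by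
    intro x z hz w hw p q hp hq hpq
    refine ⟨?_, fun hx => ?_, fun hx => ?_⟩
    · have := (convex_closedBall (0 : F) 1) (mem_closedBall_zero_iff.2 hz.1)
        (mem_closedBall_zero_iff.2 hw.1) hp hq hpq
      exact mem_closedBall_zero_iff.1 this
    · rw [inner_add_left, real_inner_smul_left, real_inner_smul_left]
      have h1 := mul_le_mul_of_nonneg_left (hz.2.1 hx) hp
      have h2 := mul_le_mul_of_nonneg_left (hw.2.1 hx) hq
      calc _ = (p + q) * ((Metric.closedBall (0 : Plane) r).indicator (gradNorm v) x - ε) := by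
            rw [hpq, one_mul]
        _ ≤ _ := by rw [add_mul]; exact add_le_add h1 h2
    · rw [hz.2.2 hx, hw.2.2 hx]; simp
  -- Near a point of the ball of radius `ρ` take the normalized gradient at that point; near other
  -- points, which lie outside the closed disk of radius `r`, take `0`.
  have hloc : ∀ x : Plane, ∃ c : F, ∀ᶠ y in 𝓝 x, c ∈ t y := by
    intro x
    by_cases hx : x ∈ Metric.ball (0 : Plane) ρ
    · have hxℓ : x ∈ Metric.ball (0 : Plane) ℓ := Metric.ball_subset_ball hρ.le hx
      let c : F := ‖a x‖⁻¹ • a x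
      have hc : inner ℝ c (a x) = ‖a x‖ := by
        rw [real_inner_smul_left, real_inner_self_eq_norm_sq]
        by_cases h0 : ‖a x‖ = 0
        · simp [h0]
        · field_simp
      have hax := ha.continuousAt (Metric.isOpen_ball.mem_nhds hxℓ)
      have hcont : ContinuousAt (fun y => inner ℝ c (a y) - ‖a y‖) x :=
        (continuousAt_const.inner hax).sub hax.norm
      have hlt : -ε < inner ℝ c (a x) - ‖a x‖ := by rw [hc, sub_self]; linarith
      refine ⟨c, ?_⟩
      filter_upwards [hcont.eventually (lt_mem_nhds hlt), Metric.isOpen_ball.mem_nhds hx]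
        with y hy hyρ
      refine ⟨?_, fun _ => ?_, fun h => absurd hyρ h⟩
      · rw [norm_smul, norm_inv, norm_norm]
        exact inv_mul_le_one
      · have : (Metric.closedBall (0 : Plane) r).indicator (gradNorm v) y ≤ gradNorm v y :=
          Set.indicator_le_self' (fun _ _ => gradNorm_nonneg v y) y
        rw [hnorm] at hy
        linarith
    · refine ⟨0, ?_⟩
      have hx' : x ∈ (Metric.closedBall (0 : Plane) r)ᶜ := fun h =>
        hx (Metric.closedBall_subset_ball hrρ h)
      filter_upwards [Metric.isClosed_closedBall.isOpen_compl.mem_nhds hx'] with y hy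
      refine ⟨by simp, fun _ => ?_, fun _ => rfl⟩
      rw [Set.indicator_of_notMem hy, inner_zero_left]
      linarith
  obtain ⟨g, hg⟩ := exists_contMDiffMap_forall_mem_convex_of_local_const (n := 1) 𝓘(ℝ, Plane)
    ht hloc
  have hgs : ContDiff ℝ 1 g := g.contMDiff.contDiff
  have hsupp : ∀ i, tsupport (fun x => (!₂[g x (i, 0), g x (i, 1)] : Plane)) ⊆
      Metric.closedBall 0 ρ := by
    intro i
    refine closure_minimal (fun x hx => ?_) Metric.isClosed_closedBall
    by_contra h
    refine hx ?_
    have := (hg x).2.2 fun h' => h (Metric.ball_subset_closedBall h')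
    ext j
    fin_cases j <;> simp [this]
  refine ⟨fun i x => !₂[g x (i, 0), g x (i, 1)], ⟨fun i => ?_, fun i => ?_, fun i => ?_, fun x => ?_⟩,
    fun x hx => ?_⟩
  · rw [contDiff_euclidean]
    intro j
    have hp : ∀ p, ContDiff ℝ 1 fun x => g x p := fun p =>
      (EuclideanSpace.proj p : F →L[ℝ] ℝ).contDiff.comp hgs
    fin_cases j
    · exact hp (i, 0)
    · exact hp (i, 1)
  · exact (isCompact_closedBall (0 : Plane) ρ).of_isClosed_subset (isClosed_tsupport _) (hsupp i)
  · exact (hsupp i).trans (Metric.closedBall_subset_ball hρ)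
  · have h1 : ‖g x‖ ^ 2 ≤ 1 := pow_le_one₀ (norm_nonneg _) (hg x).1
    rw [EuclideanSpace.norm_sq_eq, Fintype.sum_prod_type] at h1
    simpa [norm_sq_plane, Fin.sum_univ_two] using h1
  · have h1 := (hg x).2.1 hx
    rw [hinner] at h1
    simpa [Fin.sum_univ_two] using h1

/-- The total variation of a `C¹` map on a disk is at least the integral of the norm of its
gradient. -/
lemma lintegral_gradNorm_le_totalVariation {v : Plane → Plane} {ℓ : ℝ}
    (hv : ContDiffOn ℝ 1 v (Metric.ball 0 ℓ)) :
    ∫⁻ x in Metric.ball 0 ℓ, ENNReal.ofReal (gradNorm v x) ≤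
      totalVariation v (Metric.ball 0 ℓ) := by
  have hcompact : ∀ r < ℓ, ∫⁻ x in Metric.closedBall 0 r, ENNReal.ofReal (gradNorm v x) ≤
      totalVariation v (Metric.ball 0 ℓ) := by
    intro r hr
    have hcont : ContinuousOn (gradNorm v) (Metric.ball 0 ℓ) :=
      (continuousOn_finsetSum _ fun i _ => continuousOn_finsetSum _ fun j _ =>
        (continuousOn_partialD Metric.isOpen_ball hv i j).pow 2).sqrt
    have hint : IntegrableOn (gradNorm v) (Metric.closedBall 0 r) :=
      (hcont.mono (Metric.closedBall_subset_ball hr)).integrableOn_compact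
        (isCompact_closedBall _ _)
    have hint' : Integrable ((Metric.closedBall (0 : Plane) r).indicator (gradNorm v))
        (volume.restrict (Metric.ball 0 ℓ)) :=
      (hint.integrable_indicator Metric.isClosed_closedBall.measurableSet).integrableOn
    have hvol : volume (Metric.ball (0 : Plane) ℓ) ≠ ∞ := measure_ball_lt_top.ne
    have heq : ∫ x in Metric.ball 0 ℓ, (Metric.closedBall (0 : Plane) r).indicator (gradNorm v) x =
        ∫ x in Metric.closedBall 0 r, gradNorm v x := by
      rw [setIntegral_indicator Metric.isClosed_closedBall.measurableSet,
        Set.inter_eq_right.2 (Metric.closedBall_subset_ball hr)]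
    rw [← ofReal_integral_eq_lintegral_ofReal hint (ae_of_all _ (gradNorm_nonneg v))]
    have hstep : ∀ ε : ℝ, 0 < ε → ENNReal.ofReal ((∫ x in Metric.closedBall 0 r, gradNorm v x) -
        ε * volume.real (Metric.ball (0 : Plane) ℓ)) ≤ totalVariation v (Metric.ball 0 ℓ) := by
      intro ε hε
      obtain ⟨φ, hφ, hφv⟩ := exists_isVariationTest hr hv hε
      -- The sign in the integration by parts is absorbed into the test field.
      have hφ' : IsVariationTest (Metric.ball 0 ℓ) fun i x => - φ i x :=
        ⟨fun i => (hφ.contDiff i).neg, fun i => (hφ.compactSupport i).neg,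
          fun i => by
            have : tsupport (fun x => - φ i x) = tsupport (φ i) := tsupport_neg (φ i)
            rw [this]; exact hφ.support_subset i,
          fun x => by simpa only [norm_neg] using hφ.norm_le x⟩
      refine le_trans (ENNReal.ofReal_le_ofReal ?_) (le_iSup₂ (f := fun (φ : Fin 2 → Plane → Plane)
        (_ : IsVariationTest (Metric.ball 0 ℓ) φ) =>
        ENNReal.ofReal (∑ i, ∫ x in Metric.ball 0 ℓ, v x i * divergence (φ i) x)) _ hφ')
      rw [hφ'.sum_integral_divergence Metric.isOpen_ball hv, ← integral_neg, ← heq]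
      have hI : Integrable (fun x => ∑ i, ∑ j, partialD v i j x * φ i x j)
          (volume.restrict (Metric.ball 0 ℓ)) :=
        integrable_finsetSum _ fun i _ => integrable_finsetSum _ fun j _ =>
          (integrable_mul_of_tsupport_subset (continuousOn_partialD Metric.isOpen_ball hv i j)
            (contDiff_coord (hφ.contDiff i) j).continuous
            (hasCompactSupport_coord (hφ.compactSupport i) j)
            ((tsupport_coord_subset _ j).trans (hφ.support_subset i))).integrableOn
      have hc : Integrable (fun _ : Plane => ε) (volume.restrict (Metric.ball 0 ℓ)) :=
        integrableOn_const hvol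
      have hsub : ∫ x in Metric.ball 0 ℓ,
          ((Metric.closedBall (0 : Plane) r).indicator (gradNorm v) x - ε) =
          (∫ x in Metric.ball 0 ℓ, (Metric.closedBall (0 : Plane) r).indicator (gradNorm v) x) -
            ε * volume.real (Metric.ball (0 : Plane) ℓ) := by
        rw [integral_sub hint' hc, setIntegral_const, smul_eq_mul, mul_comm ε]
      rw [← hsub]
      have hneg : (fun x => -∑ i, ∑ j, partialD v i j x * (fun i x => -φ i x) i x j) =
          fun x => ∑ i, ∑ j, partialD v i j x * φ i x j := by
        ext x; simp [add_comm]
      rw [hneg]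
      exact setIntegral_mono_on (hint'.sub hc) hI measurableSet_ball hφv
    have hlim : Tendsto (fun ε : ℝ => ENNReal.ofReal ((∫ x in Metric.closedBall 0 r, gradNorm v x) -
        ε * volume.real (Metric.ball (0 : Plane) ℓ))) (𝓝[>] 0)
        (𝓝 (ENNReal.ofReal (∫ x in Metric.closedBall 0 r, gradNorm v x))) := by
      refine (ENNReal.continuous_ofReal.tendsto _).comp (tendsto_nhdsWithin_of_tendsto_nhds ?_)
      have : Continuous fun ε : ℝ => (∫ x in Metric.closedBall 0 r, gradNorm v x) -
        ε * volume.real (Metric.ball (0 : Plane) ℓ) := by fun_prop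
      simpa using this.tendsto 0
    exact le_of_tendsto hlim (eventually_mem_nhdsWithin.mono fun ε hε => hstep ε hε)
  have hU : Metric.ball (0 : Plane) ℓ = ⋃ k : ℕ, Metric.closedBall 0 (ℓ - 1 / (k + 1 : ℝ)) := by
    ext x
    simp only [mem_ball_zero_iff, Set.mem_iUnion, mem_closedBall_zero_iff]
    constructor
    · intro h
      obtain ⟨k, hk⟩ := exists_nat_one_div_lt (sub_pos.2 h)
      exact ⟨k, by linarith⟩
    · rintro ⟨k, hk⟩
      have : (0 : ℝ) < 1 / (k + 1) := by positivity
      linarith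
  rw [hU, setLIntegral_iUnion_of_directed, ← hU]
  · refine iSup_le fun k => hcompact _ ?_
    have : (0 : ℝ) < 1 / (k + 1) := by positivity
    linarith
  · refine Monotone.directed_le fun i j hij => Metric.closedBall_subset_closedBall ?_
    have : (1 : ℝ) / (j + 1) ≤ 1 / (i + 1) := by gcongr
    linarith

/-! ### Maps with separated polar variables -/

lemma exists_int_of_polarPoint_eq {r s t : ℝ} (hr : 0 < r) (h : polarPoint r s = polarPoint r t) :
    ∃ m : ℤ, s = t + 2 * Real.pi * m := by
  have h0 := congrArg (fun x : Plane => x 0) h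
  have h1 := congrArg (fun x : Plane => x 1) h
  simp only [polarPoint_zero_coord, polarPoint_one_coord, mul_right_inj' hr.ne'] at h0 h1
  obtain ⟨m, hm⟩ := Real.Angle.angle_eq_iff_two_pi_dvd_sub.1 (Real.Angle.cos_sin_inj h0 h1)
  exact ⟨m, by linarith⟩

/-- The map whose value at the point with polar coordinates `(s, t)` is `g s • Γ t`, for a
`2π`-periodic function `Γ`. At the origin the angle, and hence the value, is an arbitrary choice. -/
noncomputable def polarMap (g : ℝ → ℝ) (Γ : ℝ → Plane) (x : Plane) : Plane :=
  g ‖x‖ • Γ (exists_polarPoint x 0).choose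

lemma polarMap_polarPoint {g : ℝ → ℝ} {Γ : ℝ → Plane} (hΓ : Function.Periodic Γ (2 * Real.pi))
    {s : ℝ} (hs : 0 < s) (t : ℝ) : polarMap g Γ (polarPoint s t) = g s • Γ t := by
  have h := (exists_polarPoint (polarPoint s t) 0).choose_spec.2
  have hn : ‖polarPoint s t‖ = s := by rw [norm_polarPoint, abs_of_pos hs]
  rw [polarMap]
  set τ := (exists_polarPoint (polarPoint s t) 0).choose
  rw [hn] at h ⊢
  obtain ⟨m, hm⟩ := exists_int_of_polarPoint_eq hs h
  rw [hm, mul_comm, hΓ.int_mul m]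

/-- Near the ray of direction `t`, the angle is `t + arctan (q / p)`, where `p` and `q` are the
coordinates in the orthonormal frame of that direction. -/
lemma eq_polarPoint_arctan (y : Plane) (t : ℝ) (hp : 0 < y 0 * Real.cos t + y 1 * Real.sin t) :
    y = polarPoint ‖y‖ (t + Real.arctan ((y 1 * Real.cos t - y 0 * Real.sin t) /
      (y 0 * Real.cos t + y 1 * Real.sin t))) := by
  set p := y 0 * Real.cos t + y 1 * Real.sin t with hp_def
  set q := y 1 * Real.cos t - y 0 * Real.sin t with hq_def
  have hn : ‖y‖ = p * √(1 + (q / p) ^ 2) := by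
    have h1 : 0 ≤ p * √(1 + (q / p) ^ 2) := by positivity
    rw [← abs_of_nonneg (norm_nonneg y), ← abs_of_nonneg h1, ← sq_eq_sq_iff_abs_eq_abs, mul_pow,
      Real.sq_sqrt (by positivity), norm_sq_plane]
    field_simp
    rw [hp_def, hq_def]
    linear_combination (-(y 0 ^ 2 + y 1 ^ 2)) * Real.sin_sq_add_cos_sq t
  have hs : 0 < √(1 + (q / p) ^ 2) := by positivity
  have hc : ‖y‖ * Real.cos (Real.arctan (q / p)) = p := by
    rw [hn, Real.cos_arctan]; field_simp
  have hsn : ‖y‖ * Real.sin (Real.arctan (q / p)) = q := by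
    rw [hn, Real.sin_arctan]; field_simp
  ext i
  fin_cases i
  · simp only [Fin.zero_eta, polarPoint_zero_coord, Real.cos_add]
    linear_combination (-Real.cos t) * hc + Real.sin t * hsn - Real.cos t * hp_def +
      Real.sin t * hq_def - (y 0) * Real.sin_sq_add_cos_sq t
  · simp only [Fin.mk_one, polarPoint_one_coord, Real.sin_add]
    linear_combination (-Real.sin t) * hc - Real.cos t * hsn - Real.sin t * hp_def -
      Real.cos t * hq_def - (y 1) * Real.sin_sq_add_cos_sq t

/-- The hypothesis that the radial factor vanishes near `0` removes the singularity at the origin. -/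
lemma contDiff_polarMap {g : ℝ → ℝ} {Γ : ℝ → Plane} (hΓ : Function.Periodic Γ (2 * Real.pi))
    (hΓc : ContDiff ℝ 1 Γ) (hg : ContDiff ℝ 1 g) {r : ℝ} (hr : 0 < r)
    (hg0 : ∀ s ≤ r, g s = 0) : ContDiff ℝ 1 (polarMap g Γ) := by
  rw [contDiff_iff_contDiffAt]
  intro x
  by_cases hx : ‖x‖ < r
  · have hev : polarMap g Γ =ᶠ[𝓝 x] fun _ => 0 := by
      filter_upwards [(continuous_norm.tendsto x).eventually (gt_mem_nhds hx)] with y hy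
      rw [polarMap, hg0 _ hy.le, zero_smul]
    exact contDiffAt_const.congr_of_eventuallyEq hev
  have hx0 : 0 < ‖x‖ := hr.trans_le (not_lt.1 hx)
  obtain ⟨t, -, ht⟩ := exists_polarPoint x 0
  have hproj : ∀ i, ContDiff ℝ 1 fun y : Plane => y i := fun i =>
    (EuclideanSpace.proj i : Plane →L[ℝ] ℝ).contDiff
  let p : Plane → ℝ := fun y => y 0 * Real.cos t + y 1 * Real.sin t
  let q : Plane → ℝ := fun y => y 1 * Real.cos t - y 0 * Real.sin t
  have hpc : ContDiff ℝ 1 p := ((hproj 0).mul contDiff_const).add ((hproj 1).mul contDiff_const)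
  have hqc : ContDiff ℝ 1 q := ((hproj 1).mul contDiff_const).sub ((hproj 0).mul contDiff_const)
  have hpx : 0 < p x := by
    have : p x = ‖x‖ := by
      simp only [p]
      rw [ht, polarPoint_zero_coord, polarPoint_one_coord, norm_polarPoint, abs_norm]
      linear_combination ‖x‖ * Real.sin_sq_add_cos_sq t
    rwa [this]
  have hev : polarMap g Γ =ᶠ[𝓝 x] fun y => g ‖y‖ • Γ (t + Real.arctan (q y / p y)) := by
    filter_upwards [(hpc.continuous.tendsto x).eventually (lt_mem_nhds hpx),
      (continuous_norm.tendsto x).eventually (lt_mem_nhds hx0)] with y hy hy0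
    conv_lhs => rw [eq_polarPoint_arctan y t hy]
    exact polarMap_polarPoint hΓ hy0 _
  refine ContDiffAt.congr_of_eventuallyEq ?_ hev
  have hnorm : ContDiffAt ℝ 1 (fun y : Plane => g ‖y‖) x :=
    hg.contDiffAt.comp x (contDiffAt_norm ℝ (norm_pos_iff.1 hx0))
  refine hnorm.smul (hΓc.contDiffAt.comp x (contDiffAt_const.add ?_))
  exact Real.contDiff_arctan.contDiffAt.comp x (hqc.contDiffAt.div hpc.contDiffAt hpx.ne')

section PolarMapDerivatives

variable {g : ℝ → ℝ} {Γ : ℝ → Plane}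

lemma angularDeriv_polarMap (hΓ : Function.Periodic Γ (2 * Real.pi)) (hΓc : ContDiff ℝ 1 Γ)
    (hd : Differentiable ℝ (polarMap g Γ)) {s : ℝ} (hs : 0 < s) (t : ℝ) :
    angularDeriv (polarMap g Γ) s t = g s • deriv Γ t := by
  have h1 := hasDerivAt_angle (ℓ := s + 1) hd.differentiableOn
    (by rw [abs_of_pos hs]; linarith) t
  simp only [polarMap_polarPoint hΓ hs] at h1
  exact h1.unique ((hΓc.differentiable one_ne_zero t).hasDerivAt.const_smul (g s))

lemma radialDeriv_polarMap (hΓ : Function.Periodic Γ (2 * Real.pi)) (hg : ContDiff ℝ 1 g)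
    (hd : Differentiable ℝ (polarMap g Γ)) {s : ℝ} (hs : 0 < s) (t : ℝ) :
    radialDeriv (polarMap g Γ) s t = deriv g s • Γ t := by
  have h1 := hasDerivAt_radius (ℓ := s + 1) hd.differentiableOn
    (by rw [abs_of_pos hs]; linarith) t
  have h2 : (fun s => polarMap g Γ (polarPoint s t)) =ᶠ[𝓝 s] fun s => g s • Γ t := by
    filter_upwards [lt_mem_nhds hs] with s' hs'
    exact polarMap_polarPoint hΓ hs' t
  exact (h1.congr_of_eventuallyEq h2.symm).unique
    ((hg.differentiable one_ne_zero s).hasDerivAt.smul_const (Γ t))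

end PolarMapDerivatives

/-! ### Smooth interpolation of a sequence of points -/

/-- A smooth nondecreasing step from `0` to `1`, with the transition in a neighbourhood of `1 / 2` of
width `δ`. -/
noncomputable def smoothStep (δ x : ℝ) : ℝ := Real.smoothTransition ((x - 1 / 2) / δ + 1 / 2)

section SmoothStep

variable {δ : ℝ}

lemma contDiff_smoothStep : ContDiff ℝ 1 (smoothStep δ) :=
  Real.smoothTransition.contDiff.comp (by fun_prop)

lemma smoothStep_of_le (hδ : 0 < δ) {x : ℝ} (hx : x ≤ (1 - δ) / 2) : smoothStep δ x = 0 := by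
  apply Real.smoothTransition.zero_of_nonpos
  have : (x - 1 / 2) / δ ≤ -(1 / 2) := by rw [div_le_iff₀ hδ]; linarith
  linarith

lemma smoothStep_of_ge (hδ : 0 < δ) {x : ℝ} (hx : (1 + δ) / 2 ≤ x) : smoothStep δ x = 1 := by
  apply Real.smoothTransition.one_of_one_le
  have : 1 / 2 ≤ (x - 1 / 2) / δ := by rw [le_div_iff₀ hδ]; linarith
  linarith

lemma smoothStep_mem (x : ℝ) : smoothStep δ x ∈ Set.Icc (0 : ℝ) 1 :=
  ⟨Real.smoothTransition.nonneg _, Real.smoothTransition.le_one _⟩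

lemma deriv_smoothStep_nonneg (hδ : 0 < δ) (x : ℝ) : 0 ≤ deriv (smoothStep δ) x := by
  refine Monotone.deriv_nonneg fun x y hxy => Real.smoothTransition.monotone ?_
  gcongr

lemma continuous_deriv_smoothStep : Continuous (deriv (smoothStep δ)) :=
  contDiff_smoothStep.continuous_deriv_one

lemma integral_deriv_smoothStep (hδ : 0 < δ) (hδ1 : δ < 1) :
    ∫ x in (0 : ℝ)..1, deriv (smoothStep δ) x = 1 := by
  rw [intervalIntegral.integral_deriv_eq_sub
    (fun x _ => contDiff_smoothStep.differentiable one_ne_zero x)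
    (continuous_deriv_smoothStep.intervalIntegrable _ _),
    smoothStep_of_ge hδ (by linarith), smoothStep_of_le hδ (by linarith), sub_zero]

end SmoothStep

/-- The curve that rests at `β m` near each integer `m` and runs along the segment from `β m` to
`β (m + 1)` in a neighbourhood of `m + 1 / 2` of width `δ`. -/
noncomputable def interpCurve (δ : ℝ) (β : ℤ → Plane) (τ : ℝ) : Plane :=
  β ⌊τ⌋ + smoothStep δ (Int.fract τ) • (β (⌊τ⌋ + 1) - β ⌊τ⌋)

section InterpCurve

variable {δ : ℝ} {β : ℤ → Plane}

lemma interpCurve_eq (hδ : 0 < δ) (hδ1 : δ < 1) {m : ℤ} {τ : ℝ} (h1 : m - (1 - δ) / 2 < τ)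
    (h2 : τ < m + 1 + (1 - δ) / 2) :
    interpCurve δ β τ = β m + smoothStep δ (τ - m) • (β (m + 1) - β m) := by
  rcases lt_trichotomy ⌊τ⌋ m with h | h | h
  · have hfl : ⌊τ⌋ = m - 1 := by
      have : m - 1 ≤ ⌊τ⌋ := Int.le_floor.2 (by push_cast; linarith)
      omega
    have hlt : τ < m := Int.floor_lt.1 h
    rw [interpCurve, Int.fract, hfl, smoothStep_of_ge hδ (by push_cast; linarith),
      smoothStep_of_le hδ (by linarith)]
    simp
  · rw [interpCurve, Int.fract, h]
  · have hfl : ⌊τ⌋ = m + 1 := by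
      have : ⌊τ⌋ < m + 2 := Int.floor_lt.2 (by push_cast; linarith)
      omega
    have hle : ((m + 1 : ℤ) : ℝ) ≤ τ := Int.le_floor.1 (by omega)
    push_cast at hle
    rw [interpCurve, Int.fract, hfl, smoothStep_of_le hδ (by push_cast; linarith),
      smoothStep_of_ge hδ (by linarith)]
    simp

lemma interpCurve_eventuallyEq (hδ : 0 < δ) (hδ1 : δ < 1) {m : ℤ} {τ : ℝ}
    (h1 : m ≤ τ) (h2 : τ ≤ m + 1) :
    interpCurve δ β =ᶠ[𝓝 τ] fun τ => β m + smoothStep δ (τ - m) • (β (m + 1) - β m) := by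
  have h1' : m - (1 - δ) / 2 < τ := by linarith
  have h2' : τ < m + 1 + (1 - δ) / 2 := by linarith
  filter_upwards [lt_mem_nhds h1', gt_mem_nhds h2'] with y hy1 hy2
  exact interpCurve_eq hδ hδ1 hy1 hy2

lemma contDiff_interpCurve (hδ : 0 < δ) (hδ1 : δ < 1) : ContDiff ℝ 1 (interpCurve δ β) := by
  rw [contDiff_iff_contDiffAt]
  intro τ
  refine ContDiffAt.congr_of_eventuallyEq ?_
    (interpCurve_eventuallyEq hδ hδ1 (Int.floor_le τ) (Int.lt_floor_add_one τ).le)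
  have h : ContDiff ℝ 1 fun y : ℝ => smoothStep δ (y - ⌊τ⌋) :=
    contDiff_smoothStep.comp (contDiff_id.sub contDiff_const)
  exact (contDiff_const.add (h.smul contDiff_const)).contDiffAt

lemma deriv_interpCurve (hδ : 0 < δ) (hδ1 : δ < 1) {m : ℤ} {τ : ℝ} (h1 : m ≤ τ)
    (h2 : τ ≤ m + 1) :
    deriv (interpCurve δ β) τ = deriv (smoothStep δ) (τ - m) • (β (m + 1) - β m) := by
  rw [(interpCurve_eventuallyEq hδ hδ1 h1 h2).deriv_eq]
  have h3 : HasDerivAt (fun y : ℝ => smoothStep δ (y - m)) (deriv (smoothStep δ) (τ - m)) τ :=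
    (contDiff_smoothStep.differentiable one_ne_zero _).hasDerivAt.comp_sub_const τ (m : ℝ)
  exact ((h3.smul_const (β (m + 1) - β m)).const_add (β m)).deriv

lemma interpCurve_of_near (hδ : 0 < δ) (hδ1 : δ < 1) {m : ℤ} {τ : ℝ}
    (h : |τ - m| < (1 - δ) / 2) : interpCurve δ β τ = β m := by
  rw [abs_lt] at h
  rw [interpCurve_eq hδ hδ1 (m := m) (by linarith) (by linarith),
    smoothStep_of_le hδ (by linarith), zero_smul, add_zero]

lemma norm_interpCurve_le (hβ : ∀ m, ‖β m‖ ≤ 1) (τ : ℝ) : ‖interpCurve δ β τ‖ ≤ 1 := by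
  have hs := smoothStep_mem (δ := δ) (Int.fract τ)
  have := (convex_closedBall (0 : Plane) 1) (mem_closedBall_zero_iff.2 (hβ ⌊τ⌋))
    (mem_closedBall_zero_iff.2 (hβ (⌊τ⌋ + 1))) (sub_nonneg.2 hs.2) hs.1 (sub_add_cancel _ _)
  rw [mem_closedBall_zero_iff] at this
  refine le_of_eq_of_le (congrArg norm ?_) this
  unfold interpCurve
  module

lemma interpCurve_periodic {n : ℕ} (hβ : ∀ m, β (m + n) = β m) :
    Function.Periodic (interpCurve δ β) n := by
  intro τ
  have h1 : ⌊τ + n⌋ = ⌊τ⌋ + n := by exact_mod_cast Int.floor_add_natCast τ n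
  rw [interpCurve, interpCurve, h1, Int.fract_add_natCast, hβ, add_right_comm, hβ]

/-- Each unit interval contributes the weight of its transition. -/
lemma integral_interpCurve (hδ : 0 < δ) (hδ1 : δ < 1) (n : ℕ) {F : ℝ → ℝ} (hF : Continuous F)
    {c : ℤ → ℝ} (h : ∀ (m : ℤ) (τ : ℝ), m ≤ τ → τ ≤ m + 1 →
      F τ = deriv (smoothStep δ) (τ - m) * c m) :
    ∫ τ in (0 : ℝ)..n, F τ = ∑ m ∈ Finset.range n, c m := by
  have h0 := intervalIntegral.sum_integral_adjacent_intervals (μ := volume) (f := F)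
    (a := fun m : ℕ => (m : ℝ)) (n := n) fun m _ => hF.intervalIntegrable _ _
  rw [Nat.cast_zero] at h0
  rw [← h0]
  refine Finset.sum_congr rfl fun m _ => ?_
  have h1 : ∫ τ in (m : ℝ)..((m + 1 : ℕ) : ℝ), F τ =
      ∫ τ in (m : ℝ)..((m + 1 : ℕ) : ℝ), deriv (smoothStep δ) (τ - m) * c m := by
    refine intervalIntegral.integral_congr fun τ hτ => ?_
    rw [Set.uIcc_of_le (by push_cast; linarith)] at hτ
    push_cast at hτ
    exact_mod_cast h m τ (by exact_mod_cast hτ.1) (by exact_mod_cast hτ.2)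
  rw [h1, intervalIntegral.integral_mul_const,
    intervalIntegral.integral_comp_sub_right (fun τ => deriv (smoothStep δ) τ) (m : ℝ)]
  have h2 : ((m + 1 : ℕ) : ℝ) - m = 1 := by push_cast; ring
  rw [sub_self, h2, integral_deriv_smoothStep hδ hδ1, one_mul]

lemma integral_norm_deriv_interpCurve (hδ : 0 < δ) (hδ1 : δ < 1) (n : ℕ) :
    ∫ τ in (0 : ℝ)..n, ‖deriv (interpCurve δ β) τ‖ =
      ∑ m ∈ Finset.range n, ‖β (m + 1) - β m‖ := by
  refine integral_interpCurve (c := fun m => ‖β (m + 1) - β m‖) hδ hδ1 n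
    (contDiff_interpCurve hδ hδ1).continuous_deriv_one.norm ?_
  intro m τ h1 h2
  rw [deriv_interpCurve hδ hδ1 h1 h2, norm_smul, Real.norm_eq_abs,
    abs_of_nonneg (deriv_smoothStep_nonneg hδ _)]

lemma continuous_cross {f g : ℝ → Plane} (hf : Continuous f) (hg : Continuous g) :
    Continuous fun t => cross (f t) (g t) := by
  have hp : ∀ i, Continuous fun x : Plane => x i := fun i =>
    (EuclideanSpace.proj i : Plane →L[ℝ] ℝ).continuous
  exact (((hp 0).comp hf).mul ((hp 1).comp hg)).sub (((hp 1).comp hf).mul ((hp 0).comp hg))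

lemma integral_abs_cross_interpCurve (hδ : 0 < δ) (hδ1 : δ < 1) (n : ℕ) :
    ∫ τ in (0 : ℝ)..n, |cross (interpCurve δ β τ) (deriv (interpCurve δ β) τ)| =
      ∑ m ∈ Finset.range n, |cross (β m) (β (m + 1))| := by
  refine integral_interpCurve (c := fun m => |cross (β m) (β (m + 1))|) hδ hδ1 n
    (continuous_cross (contDiff_interpCurve hδ hδ1).continuous
      (contDiff_interpCurve hδ hδ1).continuous_deriv_one).abs ?_
  intro m τ h1 h2
  rw [deriv_interpCurve hδ hδ1 h1 h2, interpCurve_eq hδ hδ1 (m := m) (by linarith) (by linarith)]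
  rw [← abs_of_nonneg (deriv_smoothStep_nonneg hδ (τ - m)), ← abs_mul]
  congr 1
  simp only [cross, PiLp.add_apply, PiLp.smul_apply, PiLp.sub_apply, smul_eq_mul]
  rw [abs_of_nonneg (deriv_smoothStep_nonneg hδ (τ - m))]
  ring

end InterpCurve

section ScaledCurve

/-- The interpolating curve run at speed `1 / ω`, with its rest at `β m` centred at `ω (m + c)`. -/
noncomputable def scaledCurve (δ : ℝ) (β : ℤ → Plane) (ω c t : ℝ) : Plane :=
  interpCurve δ β (t / ω - c)

variable {δ ω : ℝ} {β : ℤ → Plane} {n : ℕ}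

lemma contDiff_scaledCurve (hδ : 0 < δ) (hδ1 : δ < 1) (c : ℝ) :
    ContDiff ℝ 1 (scaledCurve δ β ω c) :=
  (contDiff_interpCurve hδ hδ1).comp (by fun_prop)

lemma deriv_scaledCurve (hδ : 0 < δ) (hδ1 : δ < 1) (c t : ℝ) :
    deriv (scaledCurve δ β ω c) t = ω⁻¹ • deriv (interpCurve δ β) (t / ω - c) := by
  have h1 : HasDerivAt (fun t : ℝ => t / ω - c) ω⁻¹ t := by
    simpa [div_eq_mul_inv] using ((hasDerivAt_id t).mul_const ω⁻¹).sub_const c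
  have h2 := ((contDiff_interpCurve (β := β) hδ hδ1).differentiable one_ne_zero
    (t / ω - c)).hasDerivAt
  exact (h2.scomp t h1).deriv

lemma scaledCurve_periodic (hω : 0 < ω) (hωn : ω * n = 2 * Real.pi) (hβ : ∀ m, β (m + n) = β m)
    (c : ℝ) : Function.Periodic (scaledCurve δ β ω c) (2 * Real.pi) := by
  intro t
  have h : (t + 2 * Real.pi) / ω - c = t / ω - c + n := by
    rw [← hωn]; field_simp; ring
  rw [scaledCurve, h, interpCurve_periodic hβ]
  rfl

lemma scaledCurve_of_near (hδ : 0 < δ) (hδ1 : δ < 1) (c : ℝ) {m : ℤ} {t : ℝ}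
    (h : |t / ω - c - m| < (1 - δ) / 2) : scaledCurve δ β ω c t = β m :=
  interpCurve_of_near hδ hδ1 h

lemma integral_norm_deriv_scaledCurve (hδ : 0 < δ) (hδ1 : δ < 1) (hω : 0 < ω)
    (hωn : ω * n = 2 * Real.pi) (c : ℝ) :
    ∫ t in (ω * c)..(ω * c + 2 * Real.pi), ‖deriv (scaledCurve δ β ω c) t‖ =
      ∑ m ∈ Finset.range n, ‖β (m + 1) - β m‖ := by
  rw [← integral_norm_deriv_interpCurve hδ hδ1 n]
  have h1 : ∀ t, ‖deriv (scaledCurve δ β ω c) t‖ =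
      ω⁻¹ * ‖deriv (interpCurve δ β) (t / ω - c)‖ := fun t => by
    rw [deriv_scaledCurve hδ hδ1, norm_smul, Real.norm_eq_abs, abs_of_pos (inv_pos.2 hω)]
  simp only [h1]
  rw [intervalIntegral.integral_const_mul,
    intervalIntegral.integral_comp_div_sub (fun τ => ‖deriv (interpCurve δ β) τ‖) hω.ne',
    smul_eq_mul, ← mul_assoc, inv_mul_cancel₀ hω.ne', one_mul]
  have h2 : ω * c / ω - c = 0 := by field_simp; ring
  have h3 : (ω * c + 2 * Real.pi) / ω - c = n := by rw [← hωn]; field_simp; ring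
  rw [h2, h3]

lemma integral_abs_cross_scaledCurve (hδ : 0 < δ) (hδ1 : δ < 1) (hω : 0 < ω)
    (hωn : ω * n = 2 * Real.pi) (c : ℝ) :
    ∫ t in (ω * c)..(ω * c + 2 * Real.pi),
      |cross (scaledCurve δ β ω c t) (deriv (scaledCurve δ β ω c) t)| =
      ∑ m ∈ Finset.range n, |cross (β m) (β (m + 1))| := by
  rw [← integral_abs_cross_interpCurve hδ hδ1 n]
  have h1 : ∀ t, |cross (scaledCurve δ β ω c t) (deriv (scaledCurve δ β ω c) t)| =
      ω⁻¹ * |cross (interpCurve δ β (t / ω - c)) (deriv (interpCurve δ β) (t / ω - c))| :=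
    fun t => by
    rw [deriv_scaledCurve hδ hδ1, ← abs_of_pos (inv_pos.2 hω), ← abs_mul]
    congr 1
    simp only [cross, scaledCurve, PiLp.smul_apply, smul_eq_mul]
    ring_nf
    simp only [abs_of_pos (inv_pos.2 hω)]
    ring
  simp only [h1]
  rw [intervalIntegral.integral_const_mul,
    intervalIntegral.integral_comp_div_sub
      (fun τ => |cross (interpCurve δ β τ) (deriv (interpCurve δ β) τ)|) hω.ne',
    smul_eq_mul, ← mul_assoc, inv_mul_cancel₀ hω.ne', one_mul]
  have h2 : ω * c / ω - c = 0 := by field_simp; ring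
  have h3 : (ω * c + 2 * Real.pi) / ω - c = n := by rw [← hωn]; field_simp; ring
  rw [h2, h3]

end ScaledCurve

/-! ### Integral estimates for maps with separated polar variables -/

lemma setLIntegral_Ioo_ofReal {a b : ℝ} (hab : a ≤ b) {f : ℝ → ℝ} (hf : Continuous f)
    (h0 : ∀ t ∈ Set.Ioo a b, 0 ≤ f t) :
    ∫⁻ t in Set.Ioo a b, ENNReal.ofReal (f t) = ENNReal.ofReal (∫ t in a..b, f t) := by
  rw [intervalIntegral.integral_of_le hab, integral_Ioc_eq_integral_Ioo,
    ofReal_integral_eq_lintegral_ofReal]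
  · exact (hf.integrableOn_Icc (a := a) (b := b)).mono_set Set.Ioo_subset_Icc_self
  · exact (ae_restrict_iff' measurableSet_Ioo).2 (ae_of_all _ h0)

/-- An integral over a disk, bounded by products of functions of the radius and of the angle. -/
lemma setLIntegral_ball_le_of_polar {f : Plane → ℝ} (hf : Measurable f) {ℓ : ℝ} (hℓ : 0 ≤ ℓ)
    {p q p' q' : ℝ → ℝ} (hp : Continuous p) (hq : Continuous q) (hp' : Continuous p')
    (hq' : Continuous q') (hp0 : ∀ s, 0 ≤ p s) (hq0 : ∀ t, 0 ≤ q t) (hp'0 : ∀ s, 0 ≤ p' s)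
    (hq'0 : ∀ t, 0 ≤ q' t) (a : ℝ)
    (h : ∀ s ∈ Set.Ioo 0 ℓ, ∀ t, s * f (polarPoint s t) ≤ p s * q t + p' s * q' t) :
    ∫⁻ x in Metric.ball 0 ℓ, ENNReal.ofReal (f x) ≤
      ENNReal.ofReal ((∫ s in 0..ℓ, p s) * (∫ t in a..(a + 2 * Real.pi), q t) +
        (∫ s in 0..ℓ, p' s) * (∫ t in a..(a + 2 * Real.pi), q' t)) := by
  have hpi := Real.two_pi_pos
  rw [setLIntegral_ball_polar hf.ennreal_ofReal ℓ a]
  set Q := ∫ t in a..(a + 2 * Real.pi), q t with hQ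
  set Q' := ∫ t in a..(a + 2 * Real.pi), q' t with hQ'
  have hQ0 : 0 ≤ Q := intervalIntegral.integral_nonneg (by linarith) fun t _ => hq0 t
  have hQ'0 : 0 ≤ Q' := intervalIntegral.integral_nonneg (by linarith) fun t _ => hq'0 t
  have hinner : ∀ s ∈ Set.Ioo 0 ℓ, ENNReal.ofReal s * ∫⁻ t in Set.Ioo a (a + 2 * Real.pi),
      ENNReal.ofReal (f (polarPoint s t)) ≤ ENNReal.ofReal (p s * Q + p' s * Q') := by
    intro s hs
    rw [← lintegral_const_mul' _ _ ENNReal.ofReal_ne_top]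
    calc _ ≤ ∫⁻ t in Set.Ioo a (a + 2 * Real.pi), ENNReal.ofReal (p s * q t + p' s * q' t) := by
          refine lintegral_mono fun t => ?_
          rw [← ENNReal.ofReal_mul hs.1.le]
          exact ENNReal.ofReal_le_ofReal (h s hs t)
      _ = _ := by
          rw [setLIntegral_Ioo_ofReal (by linarith) (by fun_prop) fun t _ =>
              add_nonneg (mul_nonneg (hp0 s) (hq0 t)) (mul_nonneg (hp'0 s) (hq'0 t)),
            intervalIntegral.integral_add ((hq.const_mul (p s)).intervalIntegrable _ _)
              ((hq'.const_mul (p' s)).intervalIntegrable _ _),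
            intervalIntegral.integral_const_mul, intervalIntegral.integral_const_mul]
  refine (setLIntegral_mono' measurableSet_Ioo hinner).trans ?_
  rw [setLIntegral_Ioo_ofReal hℓ (by fun_prop) fun s _ =>
      add_nonneg (mul_nonneg (hp0 s) hQ0) (mul_nonneg (hp'0 s) hQ'0),
    intervalIntegral.integral_add ((hp.mul_const Q).intervalIntegrable _ _)
      ((hp'.mul_const Q').intervalIntegrable _ _),
    intervalIntegral.integral_mul_const, intervalIntegral.integral_mul_const]

/-- A radial cutoff: `0` for `s ≤ r / 2` and `1` for `s ≥ r`. -/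
noncomputable def radialCutoff (r s : ℝ) : ℝ := Real.smoothTransition (2 * s / r - 1)

section RadialCutoff

variable {r : ℝ}

lemma contDiff_radialCutoff : ContDiff ℝ 1 (radialCutoff r) :=
  Real.smoothTransition.contDiff.comp (by fun_prop)

lemma radialCutoff_of_le (hr : 0 < r) {s : ℝ} (hs : s ≤ r / 2) : radialCutoff r s = 0 := by
  apply Real.smoothTransition.zero_of_nonpos
  have : 2 * s / r ≤ 1 := by rw [div_le_one hr]; linarith
  linarith

lemma radialCutoff_of_ge (hr : 0 < r) {s : ℝ} (hs : r ≤ s) : radialCutoff r s = 1 := by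
  apply Real.smoothTransition.one_of_one_le
  have : 2 ≤ 2 * s / r := by rw [le_div_iff₀ hr]; linarith
  linarith

lemma radialCutoff_nonneg (s : ℝ) : 0 ≤ radialCutoff r s := Real.smoothTransition.nonneg _

lemma radialCutoff_le_one (s : ℝ) : radialCutoff r s ≤ 1 := Real.smoothTransition.le_one _

lemma deriv_radialCutoff_nonneg (hr : 0 < r) (s : ℝ) : 0 ≤ deriv (radialCutoff r) s := by
  refine Monotone.deriv_nonneg fun x y hxy => Real.smoothTransition.monotone ?_
  gcongr

lemma mul_deriv_radialCutoff_le (hr : 0 < r) (s : ℝ) :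
    s * deriv (radialCutoff r) s ≤ r * deriv (radialCutoff r) s := by
  rcases le_or_gt s r with h | h
  · exact mul_le_mul_of_nonneg_right h (deriv_radialCutoff_nonneg hr s)
  · have hev : radialCutoff r =ᶠ[𝓝 s] fun _ => 1 := by
      filter_upwards [lt_mem_nhds h] with y hy using radialCutoff_of_ge hr hy.le
    rw [hev.deriv_eq, deriv_const]
    simp

lemma integral_deriv_radialCutoff_le (hr : 0 < r) (ℓ : ℝ) :
    ∫ s in 0..ℓ, deriv (radialCutoff r) s ≤ 1 := by
  rw [intervalIntegral.integral_deriv_eq_sub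
    (fun x _ => contDiff_radialCutoff.differentiable one_ne_zero x)
    (contDiff_radialCutoff.continuous_deriv_one.intervalIntegrable _ _),
    radialCutoff_of_le hr (s := 0) (by linarith)]
  linarith [radialCutoff_le_one (r := r) ℓ]

lemma integral_mul_deriv_radialCutoff_le (hr : 0 < r) (ℓ : ℝ) :
    ∫ s in 0..ℓ, radialCutoff r s * deriv (radialCutoff r) s ≤ 1 / 2 := by
  have hd : ∀ x ∈ Set.uIcc 0 ℓ, HasDerivAt (fun s => radialCutoff r s ^ 2 / 2)
      (radialCutoff r x * deriv (radialCutoff r) x) x := fun x _ => by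
    have := (((contDiff_radialCutoff (r := r)).differentiable one_ne_zero x).hasDerivAt.fun_pow
      2).div_const 2
    refine this.congr_deriv ?_
    norm_num
    ring
  rw [intervalIntegral.integral_eq_sub_of_hasDerivAt hd
    ((contDiff_radialCutoff.continuous.mul
      contDiff_radialCutoff.continuous_deriv_one).intervalIntegrable _ _),
    radialCutoff_of_le hr (s := 0) (by linarith)]
  have h1 := radialCutoff_le_one (r := r) ℓ
  have h2 := radialCutoff_nonneg (r := r) ℓ
  nlinarith

end RadialCutoff

section RecoveryEstimates

variable {Γ : ℝ → Plane} {r ℓ : ℝ}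

lemma contDiff_polarMap_radialCutoff (hΓ : Function.Periodic Γ (2 * Real.pi))
    (hΓc : ContDiff ℝ 1 Γ) (hr : 0 < r) : ContDiff ℝ 1 (polarMap (radialCutoff r) Γ) :=
  contDiff_polarMap hΓ hΓc contDiff_radialCutoff (half_pos hr) fun _ hs => radialCutoff_of_le hr hs

/-- The radial derivative contributes at most `2πr`, since it lives on the disk of radius `r`. -/
lemma lintegral_gradNorm_polarMap_le (hΓ : Function.Periodic Γ (2 * Real.pi))
    (hΓc : ContDiff ℝ 1 Γ) (hΓ1 : ∀ t, ‖Γ t‖ ≤ 1) (hr : 0 < r) (hℓ : 0 ≤ ℓ) (a : ℝ) :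
    ∫⁻ x in Metric.ball 0 ℓ, ENNReal.ofReal (gradNorm (polarMap (radialCutoff r) Γ) x) ≤
      ENNReal.ofReal (2 * Real.pi * r + ℓ * ∫ t in a..(a + 2 * Real.pi), ‖deriv Γ t‖) := by
  have hv := contDiff_polarMap_radialCutoff hΓ hΓc hr
  have hg := contDiff_radialCutoff (r := r)
  refine (setLIntegral_ball_le_of_polar (measurable_gradNorm _) hℓ
    (p := fun s => r * deriv (radialCutoff r) s) (q := fun _ => 1) (p' := fun _ => 1)
    (q' := fun t => ‖deriv Γ t‖) (hg.continuous_deriv_one.const_mul r) continuous_const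
    continuous_const hΓc.continuous_deriv_one.norm
    (fun s => mul_nonneg hr.le (deriv_radialCutoff_nonneg hr s)) (fun _ => zero_le_one)
    (fun _ => zero_le_one) (fun _ => norm_nonneg _) a ?_).trans (ENNReal.ofReal_le_ofReal ?_)
  · intro s hs t
    refine (gradNorm_le_polar _ _ hs.1.le t).trans ?_
    change s * ‖radialDeriv (polarMap (radialCutoff r) Γ) s t‖ +
      ‖angularDeriv (polarMap (radialCutoff r) Γ) s t‖ ≤ _
    rw [radialDeriv_polarMap hΓ hg (hv.differentiable one_ne_zero) hs.1,
      angularDeriv_polarMap hΓ hΓc (hv.differentiable one_ne_zero) hs.1, norm_smul, norm_smul,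
      Real.norm_eq_abs, Real.norm_eq_abs, abs_of_nonneg (deriv_radialCutoff_nonneg hr s),
      abs_of_nonneg (radialCutoff_nonneg s), mul_one, one_mul, ← mul_assoc]
    refine add_le_add ?_ (mul_le_of_le_one_left (norm_nonneg _) (radialCutoff_le_one s))
    refine (mul_le_of_le_one_right ?_ (hΓ1 t)).trans (mul_deriv_radialCutoff_le hr s)
    exact mul_nonneg hs.1.le (deriv_radialCutoff_nonneg hr s)
  · have h1 := integral_deriv_radialCutoff_le hr ℓ
    rw [intervalIntegral.integral_const_mul, intervalIntegral.integral_const,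
      intervalIntegral.integral_const]
    simp only [smul_eq_mul, mul_one, sub_zero, add_sub_cancel_left]
    have : r * (∫ s in 0..ℓ, deriv (radialCutoff r) s) * (2 * Real.pi) ≤ r * 1 * (2 * Real.pi) := by
      have := Real.pi_pos
      gcongr
    linarith

/-- The Jacobian integral separates into `∫ ρ ρ' ≤ 1 / 2` and the swept area of the curve. -/
lemma lintegral_abs_jacobianDet_polarMap_le (hΓ : Function.Periodic Γ (2 * Real.pi))
    (hΓc : ContDiff ℝ 1 Γ) (hr : 0 < r) (hℓ : 0 ≤ ℓ) (a : ℝ) :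
    ∫⁻ x in Metric.ball 0 ℓ, ENNReal.ofReal |jacobianDet (polarMap (radialCutoff r) Γ) x| ≤
      ENNReal.ofReal (1 / 2 * ∫ t in a..(a + 2 * Real.pi), |cross (Γ t) (deriv Γ t)|) := by
  have hv := contDiff_polarMap_radialCutoff hΓ hΓc hr
  have hg := contDiff_radialCutoff (r := r)
  have hpi := Real.pi_pos
  refine (setLIntegral_ball_le_of_polar (f := fun x =>
      |jacobianDet (polarMap (radialCutoff r) Γ) x|)
    (continuous_abs.measurable.comp (measurable_jacobianDet _)) hℓ
    (p := fun s => radialCutoff r s * deriv (radialCutoff r) s)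
    (q := fun t => |cross (Γ t) (deriv Γ t)|) (p' := fun _ => 0)
    (q' := fun t => 0) (hg.continuous.mul hg.continuous_deriv_one)
    (continuous_cross hΓc.continuous hΓc.continuous_deriv_one).abs
    continuous_const continuous_const
    (fun s => mul_nonneg (radialCutoff_nonneg s) (deriv_radialCutoff_nonneg hr s))
    (fun _ => abs_nonneg _) (fun _ => le_rfl) (fun _ => le_rfl) a ?_).trans
    (ENNReal.ofReal_le_ofReal ?_)
  · intro s hs t
    have h1 := cross_polar_eq (polarMap (radialCutoff r) Γ) (polarPoint s t) s t
    change cross (radialDeriv (polarMap (radialCutoff r) Γ) s t)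
      (angularDeriv (polarMap (radialCutoff r) Γ) s t) = _ at h1
    rw [radialDeriv_polarMap hΓ hg (hv.differentiable one_ne_zero) hs.1,
      angularDeriv_polarMap hΓ hΓc (hv.differentiable one_ne_zero) hs.1] at h1
    have h2 : s * |jacobianDet (polarMap (radialCutoff r) Γ) (polarPoint s t)| =
        |s * jacobianDet (polarMap (radialCutoff r) Γ) (polarPoint s t)| := by
      rw [abs_mul, abs_of_pos hs.1]
    have h3 : cross (deriv (radialCutoff r) s • Γ t) (radialCutoff r s • deriv Γ t) =
        radialCutoff r s * deriv (radialCutoff r) s * cross (Γ t) (deriv Γ t) := by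
      simp only [cross, PiLp.smul_apply, smul_eq_mul]; ring
    rw [h2, ← h1, h3, abs_mul, abs_of_nonneg
      (mul_nonneg (radialCutoff_nonneg s) (deriv_radialCutoff_nonneg hr s))]
    simp
  · rw [intervalIntegral.integral_zero, zero_mul, add_zero]
    refine mul_le_mul_of_nonneg_right (integral_mul_deriv_radialCutoff_le hr ℓ) ?_
    exact intervalIntegral.integral_nonneg (by linarith) fun t _ => abs_nonneg _

/-- The graph area is split by `√(1 + |∇v|² + (det ∇v)²) ≤ 1 + |∇v| + |det ∇v|`. -/
lemma graphArea_polarMap_le (hΓ : Function.Periodic Γ (2 * Real.pi))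
    (hΓc : ContDiff ℝ 1 Γ) (hΓ1 : ∀ t, ‖Γ t‖ ≤ 1) (hr : 0 < r) (hℓ : 0 ≤ ℓ) (a : ℝ) :
    graphArea (polarMap (radialCutoff r) Γ) (Metric.ball 0 ℓ) ≤
      volume (Metric.ball (0 : Plane) ℓ) +
      ENNReal.ofReal (2 * Real.pi * r + ℓ * ∫ t in a..(a + 2 * Real.pi), ‖deriv Γ t‖) +
      ENNReal.ofReal (1 / 2 * ∫ t in a..(a + 2 * Real.pi), |cross (Γ t) (deriv Γ t)|) := by
  set v := polarMap (radialCutoff r) Γ with hv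
  calc graphArea v (Metric.ball 0 ℓ)
      ≤ ∫⁻ x in Metric.ball 0 ℓ, (1 + ENNReal.ofReal (gradNorm v x) +
          ENNReal.ofReal |jacobianDet v x|) := by
        rw [graphArea_eq]
        refine lintegral_mono fun x => ?_
        rw [← ENNReal.ofReal_one, ← ENNReal.ofReal_add zero_le_one (gradNorm_nonneg v x),
          ← ENNReal.ofReal_add (add_nonneg zero_le_one (gradNorm_nonneg v x)) (abs_nonneg _)]
        exact ENNReal.ofReal_le_ofReal (areaDensity_le v x)
    _ = volume (Metric.ball (0 : Plane) ℓ) +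
          (∫⁻ x in Metric.ball 0 ℓ, ENNReal.ofReal (gradNorm v x)) +
          ∫⁻ x in Metric.ball 0 ℓ, ENNReal.ofReal |jacobianDet v x| := by
        rw [lintegral_add_left ((measurable_gradNorm v).ennreal_ofReal.const_add 1),
          lintegral_add_left measurable_const, setLIntegral_one]
    _ ≤ _ := by
        gcongr
        · exact lintegral_gradNorm_polarMap_le hΓ hΓc hΓ1 hr hℓ a
        · exact lintegral_abs_jacobianDet_polarMap_le hΓ hΓc hr hℓ a

end RecoveryEstimates

/-! ### The recovery sequence -/

/-- The data of a junction map in a form adapted to polar coordinates: `u` takes the value `b m` on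
the sector of angles between `θ + 2πm/n` and `θ + 2π(m+1)/n`, where `b` is an `n`-periodic sequence
in the unit disk whose consecutive points have distance `L` and cross product `κ`. -/
structure IsJunction (n : ℕ) (θ ℓ : ℝ) (b : ℤ → Plane) (L κ : ℝ) (u : Plane → Plane) : Prop where
  n_pos : 0 < n
  radius_pos : 0 < ℓ
  length_pos : 0 < L
  periodic : ∀ m, b (m + n) = b m
  norm_le : ∀ m, ‖b m‖ ≤ 1
  norm_sub : ∀ m, ‖b (m + 1) - b m‖ = L
  cross_eq : ∀ m, cross (b m) (b (m + 1)) = κ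
  apply_polarPoint : ∀ (m : ℤ) (r t : ℝ), 0 < r → r < ℓ → θ + 2 * Real.pi / n * m < t →
    t < θ + 2 * Real.pi / n * (m + 1) → u (polarPoint r t) = b m

/-- The profile on circles of the recovery sequence: it rests at the value of `u` in the middle of
each sector and crosses over, along a segment, in thin neighbourhoods of the interfaces. -/
noncomputable def recoveryCurve (n : ℕ) (θ δ : ℝ) (b : ℤ → Plane) : ℝ → Plane :=
  scaledCurve δ b (2 * Real.pi / n) (θ / (2 * Real.pi / n) + 1 / 2)

/-- The recovery sequence. On the small disk, where the radial cutoff acts, the map sweeps the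
polygon. The scale is `1 / (k + 2)` rather than `1 / (k + 1)`, so that it is less than `1`. -/
noncomputable def recoveryMap (n : ℕ) (θ : ℝ) (b : ℤ → Plane) (k : ℕ) : Plane → Plane :=
  polarMap (radialCutoff (1 / (k + 2))) (recoveryCurve n θ (1 / (k + 2)) b)

namespace IsJunction

variable {n : ℕ} {θ ℓ : ℝ} {b : ℤ → Plane} {L κ : ℝ} {u : Plane → Plane}

lemma angle_pos (h : IsJunction n θ ℓ b L κ u) : 0 < 2 * Real.pi / n := by
  have := h.n_pos
  have := Real.pi_pos
  positivity

lemma angle_mul (h : IsJunction n θ ℓ b L κ u) : 2 * Real.pi / n * n = 2 * Real.pi :=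
  div_mul_cancel₀ _ (Nat.cast_ne_zero.2 h.n_pos.ne')

/-- An angle that is not that of an interface lies in the interior of a sector. -/
lemma exists_sector (h : IsJunction n θ ℓ b L κ u) {t : ℝ}
    (ht : t ∉ Set.range fun m : ℤ => θ + 2 * Real.pi / n * m) :
    ∃ m : ℤ, θ + 2 * Real.pi / n * m < t ∧ t < θ + 2 * Real.pi / n * (m + 1) := by
  have hω := h.angle_pos
  set ω := 2 * Real.pi / n
  refine ⟨⌊(t - θ) / ω⌋, lt_of_le_of_ne ?_ fun he => ht ⟨_, he⟩, ?_⟩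
  · have := Int.floor_le ((t - θ) / ω)
    rw [le_div_iff₀ hω] at this
    linarith
  · have := Int.lt_floor_add_one ((t - θ) / ω)
    rw [div_lt_iff₀ hω] at this
    linarith

lemma recoveryCurve_periodic (h : IsJunction n θ ℓ b L κ u) (δ : ℝ) :
    Function.Periodic (recoveryCurve n θ δ b) (2 * Real.pi) :=
  scaledCurve_periodic h.angle_pos h.angle_mul h.periodic _

lemma recoveryStep_mem (k : ℕ) : (0 : ℝ) < 1 / (k + 2) ∧ (1 : ℝ) / (k + 2) < 1 := by
  refine ⟨by positivity, ?_⟩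
  rw [div_lt_one (by positivity)]
  have : (0 : ℝ) ≤ k := k.cast_nonneg
  linarith

lemma contDiff_recoveryMap (h : IsJunction n θ ℓ b L κ u) (k : ℕ) :
    ContDiff ℝ 1 (recoveryMap n θ b k) :=
  contDiff_polarMap_radialCutoff (h.recoveryCurve_periodic _)
    (contDiff_scaledCurve (recoveryStep_mem k).1 (recoveryStep_mem k).2 _) (recoveryStep_mem k).1

lemma norm_recoveryMap_le (h : IsJunction n θ ℓ b L κ u) (k : ℕ) (x : Plane) :
    ‖recoveryMap n θ b k x‖ ≤ 1 := by
  rw [recoveryMap, polarMap, norm_smul, Real.norm_eq_abs, abs_of_nonneg (radialCutoff_nonneg _)]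
  exact mul_le_one₀ (radialCutoff_le_one _) (norm_nonneg _) (norm_interpCurve_le h.norm_le _)

lemma tendsto_recoveryMap (h : IsJunction n θ ℓ b L κ u) :
    ∀ᵐ x ∂(volume.restrict (Metric.ball (0 : Plane) ℓ)),
      Tendsto (fun k => recoveryMap n θ b k x) atTop (𝓝 (u x)) := by
  refine ae_ball_of_forall_angle
    (Set.countable_range fun m : ℤ => θ + 2 * Real.pi / n * m) fun r hr hrℓ t ht => ?_
  obtain ⟨m, hm1, hm2⟩ := h.exists_sector ht
  rw [h.apply_polarPoint m r t hr hrℓ hm1 hm2]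
  have hω := h.angle_pos
  have hlim : Tendsto (fun k : ℕ => (1 : ℝ) / (k + 2)) atTop (𝓝 0) := by
    have := (tendsto_one_div_add_atTop_nhds_zero_nat (𝕜 := ℝ)).comp (tendsto_add_atTop_nat 1)
    refine this.congr fun k => ?_
    simp only [Function.comp]
    push_cast
    ring
  have hx : |t / (2 * Real.pi / n) - (θ / (2 * Real.pi / n) + 1 / 2) - m| < 1 / 2 := by
    have h1 : (m : ℝ) < (t - θ) / (2 * Real.pi / n) := by rw [lt_div_iff₀ hω]; linarith
    have h2 : (t - θ) / (2 * Real.pi / n) < m + 1 := by rw [div_lt_iff₀ hω]; linarith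
    rw [sub_div] at h1 h2
    rw [abs_lt]
    constructor <;> linarith
  have hlim2 : Tendsto (fun k : ℕ => (1 - (1 : ℝ) / (k + 2)) / 2) atTop (𝓝 (1 / 2)) := by
    simpa using ((tendsto_const_nhds (x := (1 : ℝ))).sub hlim).div_const 2
  refine tendsto_const_nhds.congr' ?_
  filter_upwards [hlim.eventually (gt_mem_nhds hr), hlim2.eventually (lt_mem_nhds hx)] with k h1 h2
  rw [recoveryMap, polarMap_polarPoint (h.recoveryCurve_periodic _) hr,
    radialCutoff_of_ge (recoveryStep_mem k).1 h1.le, one_smul]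
  exact (scaledCurve_of_near (recoveryStep_mem k).1 (recoveryStep_mem k).2 _ h2).symm

lemma aestronglyMeasurable (h : IsJunction n θ ℓ b L κ u) :
    AEStronglyMeasurable u (volume.restrict (Metric.ball 0 ℓ)) :=
  aestronglyMeasurable_of_tendsto_ae atTop
    (fun k => (h.contDiff_recoveryMap k).continuous.aestronglyMeasurable) h.tendsto_recoveryMap

lemma norm_le_one (h : IsJunction n θ ℓ b L κ u) :
    ∀ᵐ x ∂(volume.restrict (Metric.ball (0 : Plane) ℓ)), ‖u x‖ ≤ 1 := by
  filter_upwards [h.tendsto_recoveryMap] with x hx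
  exact le_of_tendsto hx.norm (Eventually.of_forall fun k => h.norm_recoveryMap_le k x)

lemma isFiniteMeasure_ball (ℓ : ℝ) :
    IsFiniteMeasure ((volume : Measure Plane).restrict (Metric.ball 0 ℓ)) :=
  ⟨by rw [Measure.restrict_apply_univ]; exact measure_ball_lt_top⟩

lemma integrableOn (h : IsJunction n θ ℓ b L κ u) : IntegrableOn u (Metric.ball 0 ℓ) :=
  have := isFiniteMeasure_ball ℓ
  Integrable.of_bound h.aestronglyMeasurable 1 h.norm_le_one

lemma integrableOn_recoveryMap (h : IsJunction n θ ℓ b L κ u) (k : ℕ) :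
    IntegrableOn (recoveryMap n θ b k) (Metric.ball 0 ℓ) :=
  have := isFiniteMeasure_ball ℓ
  Integrable.of_bound (h.contDiff_recoveryMap k).continuous.aestronglyMeasurable 1
    (ae_of_all _ (h.norm_recoveryMap_le k))

lemma tendsto_eLpNorm_recoveryMap (h : IsJunction n θ ℓ b L κ u) :
    Tendsto (fun k => eLpNorm (recoveryMap n θ b k - u) 1 (volume.restrict (Metric.ball 0 ℓ)))
      atTop (𝓝 0) := by
  have := isFiniteMeasure_ball ℓ
  have h1 := tendsto_lintegral_norm_of_dominated_convergence
    (F := fun k => recoveryMap n θ b k) (bound := fun _ => 1) (f := u)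
    (μ := volume.restrict (Metric.ball 0 ℓ))
    (fun k => (h.contDiff_recoveryMap k).continuous.aestronglyMeasurable)
    (integrable_const (1 : ℝ)).2 (fun k => ae_of_all _ (h.norm_recoveryMap_le k))
    h.tendsto_recoveryMap
  simpa only [eLpNorm_one_eq_lintegral_enorm, ofReal_norm, Pi.sub_apply] using h1

lemma integral_norm_deriv_recoveryCurve (h : IsJunction n θ ℓ b L κ u) {δ : ℝ} (hδ : 0 < δ)
    (hδ1 : δ < 1) :
    ∫ t in (2 * Real.pi / n * (θ / (2 * Real.pi / n) + 1 / 2))..(2 * Real.pi / n *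
      (θ / (2 * Real.pi / n) + 1 / 2) + 2 * Real.pi), ‖deriv (recoveryCurve n θ δ b) t‖ =
      n * L := by
  refine (integral_norm_deriv_scaledCurve hδ hδ1 h.angle_pos h.angle_mul _).trans ?_
  simp [h.norm_sub]

lemma integral_abs_cross_recoveryCurve (h : IsJunction n θ ℓ b L κ u) {δ : ℝ} (hδ : 0 < δ)
    (hδ1 : δ < 1) :
    ∫ t in (2 * Real.pi / n * (θ / (2 * Real.pi / n) + 1 / 2))..(2 * Real.pi / n *
      (θ / (2 * Real.pi / n) + 1 / 2) + 2 * Real.pi),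
      |cross (recoveryCurve n θ δ b t) (deriv (recoveryCurve n θ δ b) t)| = n * |κ| := by
  refine (integral_abs_cross_scaledCurve hδ hδ1 h.angle_pos h.angle_mul _).trans ?_
  simp [h.cross_eq]

lemma tendsto_bound (A ℓ : ℝ) :
    Tendsto (fun k : ℕ => ENNReal.ofReal (2 * Real.pi * (1 / (k + 2)) + ℓ * A)) atTop
      (𝓝 (ENNReal.ofReal (ℓ * A))) := by
  have hlim : Tendsto (fun k : ℕ => (1 : ℝ) / (k + 2)) atTop (𝓝 0) := by
    have := (tendsto_one_div_add_atTop_nhds_zero_nat (𝕜 := ℝ)).comp (tendsto_add_atTop_nat 1)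
    refine this.congr fun k => ?_
    simp only [Function.comp]
    push_cast
    ring
  refine ENNReal.tendsto_ofReal ?_
  simpa using (hlim.const_mul (2 * Real.pi)).add_const (ℓ * A)

lemma totalVariation_recoveryMap_le (h : IsJunction n θ ℓ b L κ u) (k : ℕ) :
    totalVariation (recoveryMap n θ b k) (Metric.ball 0 ℓ) ≤
      ENNReal.ofReal (2 * Real.pi * (1 / (k + 2)) + ℓ * (n * L)) := by
  refine (totalVariation_le_lintegral_gradNorm Metric.isOpen_ball
    (h.contDiff_recoveryMap k).contDiffOn).trans ?_
  refine (lintegral_gradNorm_polarMap_le (h.recoveryCurve_periodic _)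
    (contDiff_scaledCurve (recoveryStep_mem k).1 (recoveryStep_mem k).2 _)
    (norm_interpCurve_le h.norm_le <| · / _ - _) (recoveryStep_mem k).1 h.radius_pos.le
    (2 * Real.pi / n * (θ / (2 * Real.pi / n) + 1 / 2))).trans ?_
  rw [h.integral_norm_deriv_recoveryCurve (recoveryStep_mem k).1 (recoveryStep_mem k).2]

lemma totalVariation_le (h : IsJunction n θ ℓ b L κ u) :
    totalVariation u (Metric.ball 0 ℓ) ≤ ENNReal.ofReal (ℓ * (n * L)) := by
  refine (totalVariation_le_liminf h.integrableOn_recoveryMap h.integrableOn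
    h.tendsto_eLpNorm_recoveryMap).trans ?_
  rw [← (tendsto_bound (n * L) ℓ).liminf_eq]
  exact liminf_le_liminf (Eventually.of_forall h.totalVariation_recoveryMap_le)

lemma strictBVConverges_recoveryMap (h : IsJunction n θ ℓ b L κ u)
    (hTV : totalVariation u (Metric.ball 0 ℓ) = ENNReal.ofReal (ℓ * (n * L))) :
    StrictBVConverges (recoveryMap n θ b) u (Metric.ball 0 ℓ) where
  memBV_seq k := ⟨h.integrableOn_recoveryMap k,
    (h.totalVariation_recoveryMap_le k).trans_lt ENNReal.ofReal_lt_top⟩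
  memBV_limit := ⟨h.integrableOn, hTV ▸ ENNReal.ofReal_lt_top⟩
  tendsto_L1 := h.tendsto_eLpNorm_recoveryMap
  tendsto_variation := by
    refine tendsto_of_le_liminf_of_limsup_le (totalVariation_le_liminf h.integrableOn_recoveryMap
      h.integrableOn h.tendsto_eLpNorm_recoveryMap) ?_
    rw [hTV, ← (tendsto_bound (n * L) ℓ).limsup_eq]
    exact limsup_le_limsup (Eventually.of_forall h.totalVariation_recoveryMap_le)

/-- The upper bound for the relaxed area, from the recovery sequence. -/
lemma relaxedAreaBV_le (h : IsJunction n θ ℓ b L κ u)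
    (hTV : totalVariation u (Metric.ball 0 ℓ) = ENNReal.ofReal (ℓ * (n * L))) :
    relaxedAreaBV u (Metric.ball 0 ℓ) ≤ volume (Metric.ball (0 : Plane) ℓ) +
      ENNReal.ofReal (ℓ * (n * L)) + ENNReal.ofReal (1 / 2 * (n * |κ|)) := by
  refine (iInf_le_of_le (recoveryMap n θ b) (iInf₂_le
    (fun k => (h.contDiff_recoveryMap k).contDiffOn)
    (h.strictBVConverges_recoveryMap hTV))).trans ?_
  have hlim := ((tendsto_bound (n * L) ℓ).const_add (volume (Metric.ball (0 : Plane) ℓ))).add_const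
    (ENNReal.ofReal (1 / 2 * (n * |κ|)))
  rw [← hlim.liminf_eq]
  refine liminf_le_liminf (Eventually.of_forall fun k => ?_)
  refine (graphArea_polarMap_le (h.recoveryCurve_periodic _)
    (contDiff_scaledCurve (recoveryStep_mem k).1 (recoveryStep_mem k).2 _)
    (norm_interpCurve_le h.norm_le <| · / _ - _) (recoveryStep_mem k).1 h.radius_pos.le
    (2 * Real.pi / n * (θ / (2 * Real.pi / n) + 1 / 2))).trans ?_
  rw [h.integral_norm_deriv_recoveryCurve (recoveryStep_mem k).1 (recoveryStep_mem k).2,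
    h.integral_abs_cross_recoveryCurve (recoveryStep_mem k).1 (recoveryStep_mem k).2]

end IsJunction

/-! ### The total variation of a junction map from below -/

/-- The rotation by a quarter turn, as a linear map. -/
noncomputable def quarterTurn : Plane →L[ℝ] Plane :=
  LinearMap.toContinuousLinearMap
    { toFun := fun x => !₂[-(x 1), x 0]
      map_add' := fun x y => by ext i; fin_cases i <;> simp [add_comm]
      map_smul' := fun c x => by ext i; fin_cases i <;> simp }

@[simp] lemma quarterTurn_zero_coord (x : Plane) : quarterTurn x 0 = -(x 1) := rfl

@[simp] lemma quarterTurn_one_coord (x : Plane) : quarterTurn x 1 = x 0 := rfl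

lemma norm_quarterTurn (x : Plane) : ‖quarterTurn x‖ = ‖x‖ := by
  rw [← sq_eq_sq₀ (norm_nonneg _) (norm_nonneg _), norm_sq_plane, norm_sq_plane]
  simp [add_comm]

lemma quarterTurn_polarPoint (s t : ℝ) :
    quarterTurn (polarPoint s t) = polarPoint s (t + Real.pi / 2) := by
  ext i
  fin_cases i
  · simp [Real.cos_add_pi_div_two]
  · simp [Real.sin_add_pi_div_two]

/-- The field of quarter turns is divergence free, so the divergence of a multiple of it is an
angular derivative. -/
lemma divergence_smul_quarterTurn {f : Plane → Plane} {x : Plane} (hf : DifferentiableAt ℝ f x)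
    (i : Fin 2) :
    divergence (fun y => f y i • quarterTurn y) x = (fderiv ℝ f x (quarterTurn x)) i := by
  have hfi : DifferentiableAt ℝ (fun y => f y i) x :=
    (EuclideanSpace.proj i : Plane →L[ℝ] ℝ).differentiableAt.comp x hf
  have hψ : DifferentiableAt ℝ (fun y => f y i • quarterTurn y) x :=
    hfi.smul quarterTurn.differentiableAt
  have h0 : HasFDerivAt (fun y => (f y i • quarterTurn y) 0)
      (f x i • (-(EuclideanSpace.proj 1 : Plane →L[ℝ] ℝ)) +
        (-(x 1)) • fderiv ℝ (fun y => f y i) x) x :=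
    hfi.hasFDerivAt.mul (EuclideanSpace.proj 1 : Plane →L[ℝ] ℝ).hasFDerivAt.neg
  have h1 : HasFDerivAt (fun y => (f y i • quarterTurn y) 1)
      (f x i • (EuclideanSpace.proj 0 : Plane →L[ℝ] ℝ) +
        (x 0) • fderiv ℝ (fun y => f y i) x) x :=
    hfi.hasFDerivAt.mul (EuclideanSpace.proj 0 : Plane →L[ℝ] ℝ).hasFDerivAt
  rw [divergence, Fin.sum_univ_two, partialD_eq_fderiv_coord hψ, partialD_eq_fderiv_coord hψ,
    h0.fderiv, h1.fderiv, fderiv_apply_coord, partialD_eq_fderiv_coord hf,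
    partialD_eq_fderiv_coord hf]
  simp

/-- A cutoff equal to `1` on `[r, ℓ - r]` and to `0` outside `[r / 2, ℓ - r / 2]`. -/
noncomputable def annularCutoff (r ℓ s : ℝ) : ℝ := radialCutoff r s * radialCutoff r (ℓ - s)

section AnnularCutoff

variable {r ℓ : ℝ}

lemma contDiff_annularCutoff : ContDiff ℝ 1 (annularCutoff r ℓ) :=
  contDiff_radialCutoff.mul (contDiff_radialCutoff.comp (contDiff_const.sub contDiff_id))

lemma annularCutoff_nonneg (s : ℝ) : 0 ≤ annularCutoff r ℓ s :=
  mul_nonneg (radialCutoff_nonneg _) (radialCutoff_nonneg _)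

lemma annularCutoff_le_one (s : ℝ) : annularCutoff r ℓ s ≤ 1 :=
  mul_le_one₀ (radialCutoff_le_one _) (radialCutoff_nonneg _) (radialCutoff_le_one _)

lemma annularCutoff_of_le (hr : 0 < r) {s : ℝ} (hs : s ≤ r / 2) : annularCutoff r ℓ s = 0 := by
  rw [annularCutoff, radialCutoff_of_le hr hs, zero_mul]

lemma annularCutoff_of_ge (hr : 0 < r) {s : ℝ} (hs : ℓ - r / 2 ≤ s) :
    annularCutoff r ℓ s = 0 := by
  rw [annularCutoff, radialCutoff_of_le hr (s := ℓ - s) (by linarith), mul_zero]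

lemma le_integral_annularCutoff (hr : 0 < r) (hrℓ : r ≤ ℓ - r) :
    ℓ - 2 * r ≤ ∫ s in 0..ℓ, annularCutoff r ℓ s := by
  have h1 : ∫ s in r..(ℓ - r), annularCutoff r ℓ s = ℓ - 2 * r := by
    have : ∫ s in r..(ℓ - r), annularCutoff r ℓ s = ∫ s in r..(ℓ - r), (1 : ℝ) := by
      refine intervalIntegral.integral_congr fun s hs => ?_
      rw [Set.uIcc_of_le hrℓ] at hs
      rw [annularCutoff, radialCutoff_of_ge hr hs.1, radialCutoff_of_ge hr (by linarith [hs.2]),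
        one_mul]
    rw [this, intervalIntegral.integral_const, smul_eq_mul]
    ring
  rw [← h1]
  refine intervalIntegral.integral_mono_interval hr.le hrℓ (by linarith)
    (ae_of_all _ annularCutoff_nonneg)
    (contDiff_annularCutoff.continuous.intervalIntegrable _ _)

lemma contDiff_annularCutoff_div (hr : 0 < r) : ContDiff ℝ 1 fun s => annularCutoff r ℓ s / s := by
  rw [contDiff_iff_contDiffAt]
  intro s
  rcases lt_or_ge s (r / 2) with h | h
  · have hev : (fun s => annularCutoff r ℓ s / s) =ᶠ[𝓝 s] fun _ => 0 := by
      filter_upwards [gt_mem_nhds h] with y hy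
      rw [annularCutoff_of_le hr hy.le, zero_div]
    exact contDiffAt_const.congr_of_eventuallyEq hev
  · exact contDiff_annularCutoff.contDiffAt.div contDiffAt_id (by simp; linarith)

end AnnularCutoff

/-- The test field `x ↦ (g(|x|) / |x|) H_i(arg x) x^⊥`, whose direction is angular, with the cutoff
`g = annularCutoff r ℓ`. -/
noncomputable def angularField (r ℓ : ℝ) (H : ℝ → Plane) (i : Fin 2) (x : Plane) : Plane :=
  polarMap (fun s => annularCutoff r ℓ s / s) H x i • quarterTurn x

section AngularField

variable {r ℓ : ℝ} {H : ℝ → Plane}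

lemma contDiff_polarMap_annularCutoff (hr : 0 < r) (hH : Function.Periodic H (2 * Real.pi))
    (hHc : ContDiff ℝ 1 H) : ContDiff ℝ 1 (polarMap (fun s => annularCutoff r ℓ s / s) H) :=
  contDiff_polarMap hH hHc (contDiff_annularCutoff_div hr) (half_pos hr) fun s hs => by
    rw [annularCutoff_of_le hr hs, zero_div]

lemma isVariationTest_angularField (hr : 0 < r) (hH : Function.Periodic H (2 * Real.pi))
    (hHc : ContDiff ℝ 1 H) (hH1 : ∀ t, ‖H t‖ ≤ 1) :
    IsVariationTest (Metric.ball 0 ℓ) (angularField r ℓ H) := by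
  have hsupp : ∀ i, tsupport (angularField r ℓ H i) ⊆ Metric.closedBall 0 (ℓ - r / 2) := by
    intro i
    refine closure_minimal (fun x hx => ?_) Metric.isClosed_closedBall
    by_contra h
    rw [mem_closedBall_zero_iff, not_le] at h
    refine hx ?_
    rw [angularField, polarMap, annularCutoff_of_ge hr h.le]
    simp
  refine ⟨fun i => ?_, fun i => ?_, fun i => ?_, fun x => ?_⟩
  · exact (contDiff_coord (contDiff_polarMap_annularCutoff hr hH hHc) i).smul quarterTurn.contDiff
  · exact (isCompact_closedBall (0 : Plane) _).of_isClosed_subset (isClosed_tsupport _) (hsupp i)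
  · exact (hsupp i).trans (Metric.closedBall_subset_ball (by linarith))
  · have h1 : ∑ i, ‖angularField r ℓ H i x‖ ^ 2 =
        (‖polarMap (fun s => annularCutoff r ℓ s / s) H x‖ * ‖x‖) ^ 2 := by
      simp only [angularField, norm_smul, norm_quarterTurn, mul_pow]
      rw [← Finset.sum_mul, ← EuclideanSpace.norm_sq_eq]
    rw [h1]
    refine pow_le_one₀ (by positivity) ?_
    rw [polarMap, norm_smul, norm_div, norm_norm]
    generalize (exists_polarPoint x 0).choose = t
    rcases eq_or_ne ‖x‖ 0 with h0 | h0
    · rw [h0, mul_zero]; exact zero_le_one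
    · have h2 : ‖annularCutoff r ℓ ‖x‖‖ ≤ 1 := by
        rw [Real.norm_eq_abs, abs_of_nonneg (annularCutoff_nonneg _)]
        exact annularCutoff_le_one _
      calc _ = ‖annularCutoff r ℓ ‖x‖‖ * ‖H t‖ := by field_simp
        _ ≤ 1 := mul_le_one₀ h2 (norm_nonneg _) (hH1 _)

lemma divergence_angularField (hr : 0 < r) (hH : Function.Periodic H (2 * Real.pi))
    (hHc : ContDiff ℝ 1 H) {s : ℝ} (hs : 0 < s) (t : ℝ) (i : Fin 2) :
    divergence (angularField r ℓ H i) (polarPoint s t) =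
      annularCutoff r ℓ s / s * deriv H t i := by
  have hd := (contDiff_polarMap_annularCutoff (ℓ := ℓ) hr hH hHc).differentiable one_ne_zero
  have h1 := divergence_smul_quarterTurn (hd (polarPoint s t)) i
  rw [quarterTurn_polarPoint] at h1
  change _ = (angularDeriv (polarMap (fun s => annularCutoff r ℓ s / s) H) s t) i at h1
  rw [angularDeriv_polarMap hH hHc hd hs] at h1
  exact h1

end AngularField

namespace IsJunction

variable {n : ℕ} {θ ℓ : ℝ} {b : ℤ → Plane} {L κ : ℝ} {u : Plane → Plane}

/-- Summation by parts: pairing `u` with the derivative of a profile `H` over a circle gives the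
pairing of the jumps with the values of `H` at the interfaces. -/
lemma integral_inner_step (h : IsJunction n θ ℓ b L κ u) {H : ℝ → Plane} (hHc : ContDiff ℝ 1 H)
    (hHm : ∀ m : ℤ, H (θ + 2 * Real.pi / n * m) = -(L⁻¹ • (b m - b (m - 1)))) :
    ∫ t in Set.Ioo θ (θ + 2 * Real.pi),
      inner ℝ (b ⌊(t - θ) / (2 * Real.pi / n)⌋) (deriv H t) = n * L := by
  have hω := h.angle_pos
  have hωn := h.angle_mul
  set ω := 2 * Real.pi / n with hωdef
  have hpi := Real.two_pi_pos
  set q : ℝ → ℝ := fun t => inner ℝ (b ⌊(t - θ) / ω⌋) (deriv H t) with hq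
  have hstep : ∀ m : ℕ, Set.EqOn q (fun t => inner ℝ (b m) (deriv H t))
      (Set.Ioo (θ + ω * m) (θ + ω * (m + 1 : ℕ))) := by
    intro m t ht
    have hfl : ⌊(t - θ) / ω⌋ = m := by
      rw [Int.floor_eq_iff]
      constructor
      · rw [le_div_iff₀ hω]; push_cast; linarith [ht.1]
      · rw [div_lt_iff₀ hω]; have := ht.2; push_cast at this ⊢; linarith
    simp only [hq, hfl]
  have hle : ∀ m : ℕ, θ + ω * m ≤ θ + ω * (m + 1 : ℕ) := fun m => by push_cast; linarith
  have hcont : ∀ m : ℕ, Continuous fun t => inner ℝ (b m) (deriv H t) := fun m =>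
    continuous_const.inner hHc.continuous_deriv_one
  have hint : ∀ m : ℕ, IntervalIntegrable q volume (θ + ω * m) (θ + ω * (m + 1 : ℕ)) := by
    intro m
    rw [intervalIntegrable_iff_integrableOn_Ioo_of_le (hle m)]
    refine IntegrableOn.congr_fun ?_ (hstep m).symm measurableSet_Ioo
    exact ((hcont m).integrableOn_Icc).mono_set Set.Ioo_subset_Icc_self
  have hval : ∀ m : ℕ, ∫ t in (θ + ω * m)..(θ + ω * (m + 1 : ℕ)), q t =
      inner ℝ (b m) (H (θ + ω * ((m + 1 : ℕ) : ℤ))) - inner ℝ (b m) (H (θ + ω * (m : ℤ))) := by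
    intro m
    rw [intervalIntegral.integral_of_le (hle m), integral_Ioc_eq_integral_Ioo,
      setIntegral_congr_fun measurableSet_Ioo (hstep m), ← integral_Ioc_eq_integral_Ioo,
      ← intervalIntegral.integral_of_le (hle m)]
    have hd : ∀ t ∈ Set.uIcc (θ + ω * m) (θ + ω * (m + 1 : ℕ)),
        HasDerivAt (fun t => inner ℝ (b m) (H t)) (inner ℝ (b m) (deriv H t)) t := fun t _ => by
      have := (innerSL ℝ (b m)).hasFDerivAt.comp_hasDerivAt t
        (hHc.differentiable one_ne_zero t).hasDerivAt
      exact this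
    rw [intervalIntegral.integral_eq_sub_of_hasDerivAt hd ((hcont m).intervalIntegrable _ _)]
    push_cast
    rfl
  have hsum := intervalIntegral.sum_integral_adjacent_intervals (μ := volume) (f := q)
    (a := fun m : ℕ => θ + ω * m) (n := n) fun m _ => hint m
  simp only [Nat.cast_zero, mul_zero, add_zero, hωn] at hsum
  rw [← integral_Ioc_eq_integral_Ioo, ← intervalIntegral.integral_of_le (by linarith), ← hsum,
    Finset.sum_congr rfl fun m _ => hval m]
  simp only [hHm]
  set A : ℕ → ℝ := fun m => inner ℝ (b (m - 1)) (-(L⁻¹ • (b m - b (m - 1)))) with hA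
  have hshift : ∑ m ∈ Finset.range n, A (m + 1) = ∑ m ∈ Finset.range n, A m := by
    have h1 := Finset.sum_range_succ A n
    have h2 := Finset.sum_range_succ' A n
    have h3 : A n = A 0 := by
      have e1 : b (n : ℤ) = b 0 := by simpa using h.periodic 0
      have e2 : b ((n : ℤ) - 1) = b (-1) := by
        have := h.periodic (-1)
        rwa [neg_add_eq_sub] at this
      simp only [hA, e1, e2, Nat.cast_zero, zero_sub]
    linarith
  have hterm : ∀ m : ℕ,
      inner ℝ (b m) (-(L⁻¹ • (b ((m + 1 : ℕ) : ℤ) - b (((m + 1 : ℕ) : ℤ) - 1)))) -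
      inner ℝ (b m) (-(L⁻¹ • (b (m : ℤ) - b ((m : ℤ) - 1)))) = A (m + 1) - A m + L := by
    intro m
    have e1 : (((m + 1 : ℕ) : ℤ) - 1) = m := by push_cast; ring
    have hn := h.norm_sub (m - 1)
    rw [sub_add_cancel] at hn
    have hL := h.length_pos
    have e2 : inner ℝ (b (m : ℤ) - b ((m : ℤ) - 1))
        (-(L⁻¹ • (b (m : ℤ) - b ((m : ℤ) - 1)))) = -L := by
      rw [inner_neg_right, real_inner_smul_right, real_inner_self_eq_norm_sq, hn]
      field_simp
    rw [inner_sub_left] at e2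
    simp only [hA, e1]
    linarith
  rw [Finset.sum_congr rfl fun m _ => hterm m, Finset.sum_add_distrib, Finset.sum_sub_distrib,
    hshift]
  simp

lemma sum_integral_divergence_angularField (h : IsJunction n θ ℓ b L κ u) {r : ℝ} (hr : 0 < r)
    {H : ℝ → Plane} (hH : Function.Periodic H (2 * Real.pi)) (hHc : ContDiff ℝ 1 H)
    (hH1 : ∀ t, ‖H t‖ ≤ 1)
    (hHm : ∀ m : ℤ, H (θ + 2 * Real.pi / n * m) = -(L⁻¹ • (b m - b (m - 1)))) :
    ∑ i, ∫ x in Metric.ball 0 ℓ, u x i * divergence (angularField r ℓ H i) x =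
      (∫ s in 0..ℓ, annularCutoff r ℓ s) * (n * L) := by
  have hω := h.angle_pos
  have hφ := isVariationTest_angularField (ℓ := ℓ) hr hH hHc hH1
  have hint : ∀ i, Integrable (fun x => u x i * divergence (angularField r ℓ H i) x)
      (volume.restrict (Metric.ball 0 ℓ)) := by
    intro i
    obtain ⟨C, hC⟩ := exists_bound_divergence (hφ.contDiff i) (hφ.compactSupport i)
    exact ((EuclideanSpace.proj i : Plane →L[ℝ] ℝ).integrable_comp h.integrableOn).mul_bdd
      (continuous_divergence (hφ.contDiff i)).aestronglyMeasurable (ae_of_all _ hC)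
  rw [← integral_finsetSum _ fun i _ => hint i]
  have hmp := measurePreserving_polarPoint ℓ θ
  have hsm := (integrable_finsetSum Finset.univ fun i _ => hint i).aestronglyMeasurable
  rw [← hmp.map_eq] at hsm ⊢
  rw [integral_map hmp.measurable.aemeasurable hsm]
  have hae : ∀ᵐ p ∂(polarMeasure ℓ θ),
      ∑ i, u (polarPoint p.1 p.2) i * divergence (angularField r ℓ H i) (polarPoint p.1 p.2) =
        annularCutoff r ℓ p.1 / p.1 *
          inner ℝ (b ⌊(p.2 - θ) / (2 * Real.pi / n)⌋) (deriv H p.2) := by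
    have h1 : ∀ᵐ p ∂(polarMeasure ℓ θ), p.1 ∈ Set.Ioo 0 ℓ := by
      refine Measure.quasiMeasurePreserving_fst.ae (p := fun s => s ∈ Set.Ioo 0 ℓ) ?_
      exact (withDensity_absolutelyContinuous _ _).ae_le (ae_restrict_mem measurableSet_Ioo)
    have h2 : ∀ᵐ p ∂(polarMeasure ℓ θ),
        p.2 ∉ Set.range fun m : ℤ => θ + 2 * Real.pi / n * m := by
      refine Measure.quasiMeasurePreserving_snd.ae
        (p := fun t => t ∉ Set.range fun m : ℤ => θ + 2 * Real.pi / n * m) ?_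
      exact ae_restrict_of_ae ((Set.countable_range _).ae_notMem _)
    filter_upwards [h1, h2] with p hp1 hp2
    obtain ⟨m, hm1, hm2⟩ := h.exists_sector hp2
    have hfl : ⌊(p.2 - θ) / (2 * Real.pi / n)⌋ = m := by
      rw [Int.floor_eq_iff]
      constructor
      · rw [le_div_iff₀ hω]; linarith
      · rw [div_lt_iff₀ hω]; linarith
    rw [hfl, h.apply_polarPoint m _ _ hp1.1 hp1.2 hm1 hm2, PiLp.inner_apply, Finset.mul_sum]
    refine Finset.sum_congr rfl fun i _ => ?_
    rw [divergence_angularField hr hH hHc hp1.1]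
    simp only [RCLike.inner_apply, conj_trivial]
    ring
  rw [integral_congr_ae hae, polarMeasure,
    integral_prod_mul (fun s => annularCutoff r ℓ s / s)
      (fun t => inner ℝ (b ⌊(t - θ) / (2 * Real.pi / n)⌋) (deriv H t)),
    h.integral_inner_step hHc hHm]
  congr 1
  rw [integral_withDensity_eq_integral_toReal_smul (by fun_prop)
    (ae_of_all _ fun _ => ENNReal.ofReal_lt_top), intervalIntegral.integral_of_le h.radius_pos.le,
    integral_Ioc_eq_integral_Ioo]
  refine setIntegral_congr_fun measurableSet_Ioo fun s hs => ?_
  rw [ENNReal.toReal_ofReal hs.1.le, smul_eq_mul, mul_div_cancel₀ _ hs.1.ne']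

/-- The total variation of a junction map. In the lower bound, the profile `H` of the test field takes
the opposite of the normalized jump of `u` as its value at each interface. -/
lemma totalVariation_eq (h : IsJunction n θ ℓ b L κ u) :
    totalVariation u (Metric.ball 0 ℓ) = ENNReal.ofReal (ℓ * (n * L)) := by
  refine le_antisymm h.totalVariation_le ?_
  have hω := h.angle_pos
  have hL := h.length_pos
  have hℓ := h.radius_pos
  set β : ℤ → Plane := fun m => -(L⁻¹ • (b m - b (m - 1))) with hβ
  have hβ1 : ∀ m, ‖β m‖ ≤ 1 := by
    intro m
    have hn := h.norm_sub (m - 1)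
    rw [sub_add_cancel] at hn
    rw [hβ]
    simp only [norm_neg, norm_smul, norm_inv, Real.norm_eq_abs, abs_of_pos hL, hn]
    rw [inv_mul_cancel₀ hL.ne']
  have hβp : ∀ m, β (m + n) = β m := by
    intro m
    have e : m + n - 1 = m - 1 + n := by ring
    simp only [hβ, h.periodic, e]
  set H := scaledCurve (1 / 2) β (2 * Real.pi / n) (θ / (2 * Real.pi / n)) with hHdef
  have hδ : (0 : ℝ) < 1 / 2 := by norm_num
  have hδ1 : (1 / 2 : ℝ) < 1 := by norm_num
  have hHm : ∀ m : ℤ, H (θ + 2 * Real.pi / n * m) = -(L⁻¹ • (b m - b (m - 1))) := by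
    intro m
    refine scaledCurve_of_near hδ hδ1 _ (m := m) ?_
    have : (θ + 2 * Real.pi / n * m) / (2 * Real.pi / n) - θ / (2 * Real.pi / n) - m = 0 := by
      rw [add_div, mul_div_cancel_left₀ _ hω.ne']; ring
    rw [this]
    norm_num
  have hH : Function.Periodic H (2 * Real.pi) := scaledCurve_periodic hω h.angle_mul hβp _
  have hHc : ContDiff ℝ 1 H := contDiff_scaledCurve hδ hδ1 _
  have hH1 : ∀ t, ‖H t‖ ≤ 1 := fun t => norm_interpCurve_le hβ1 _
  have hstep : ∀ r : ℝ, 0 < r → r < ℓ / 2 → ENNReal.ofReal ((ℓ - 2 * r) * (n * L)) ≤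
      totalVariation u (Metric.ball 0 ℓ) := by
    intro r hr hrℓ
    refine le_trans (ENNReal.ofReal_le_ofReal ?_) (le_iSup₂ (f := fun (φ : Fin 2 → Plane → Plane)
      (_ : IsVariationTest (Metric.ball 0 ℓ) φ) =>
      ENNReal.ofReal (∑ i, ∫ x in Metric.ball 0 ℓ, u x i * divergence (φ i) x)) _
      (isVariationTest_angularField hr hH hHc hH1))
    rw [h.sum_integral_divergence_angularField hr hH hHc hH1 hHm]
    exact mul_le_mul_of_nonneg_right (le_integral_annularCutoff hr (by linarith)) (by positivity)
  have hlim : Tendsto (fun r : ℝ => ENNReal.ofReal ((ℓ - 2 * r) * (n * L))) (𝓝[>] 0)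
      (𝓝 (ENNReal.ofReal (ℓ * (n * L)))) := by
    refine ENNReal.tendsto_ofReal (tendsto_nhdsWithin_of_tendsto_nhds ?_)
    have : Continuous fun r : ℝ => (ℓ - 2 * r) * (n * L) := by fun_prop
    simpa using this.tendsto 0
  refine le_of_tendsto hlim ?_
  filter_upwards [Ioo_mem_nhdsGT (half_pos hℓ)] with r hr using hstep r hr.1 hr.2

end IsJunction

/-! ### Curves of nearly minimal length -/

lemma planar_cross_self (x : Plane) : cross x x = 0 := by simp only [cross]; ring

/-- The area of a triangle with base `D` and two other sides of total length at most `Λ`: Heron's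
formula. -/
lemma four_mul_cross_sq_le {D z : Plane} {Λ : ℝ} (h : ‖z‖ + ‖D - z‖ ≤ Λ) :
    4 * cross D z ^ 2 ≤ ‖D‖ ^ 2 * (Λ ^ 2 - ‖D‖ ^ 2) := by
  have heron : 4 * cross D z ^ 2 =
      ((‖z‖ + ‖D - z‖) ^ 2 - ‖D‖ ^ 2) * (‖D‖ ^ 2 - (‖z‖ - ‖D - z‖) ^ 2) := by
    have e : ((‖z‖ + ‖D - z‖) ^ 2 - ‖D‖ ^ 2) * (‖D‖ ^ 2 - (‖z‖ - ‖D - z‖) ^ 2) =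
        2 * ‖z‖ ^ 2 * ‖D - z‖ ^ 2 + 2 * ‖D‖ ^ 2 * ‖z‖ ^ 2 + 2 * ‖D‖ ^ 2 * ‖D - z‖ ^ 2 -
          (‖z‖ ^ 2) ^ 2 - (‖D - z‖ ^ 2) ^ 2 - (‖D‖ ^ 2) ^ 2 := by ring
    rw [e, norm_sq_plane, norm_sq_plane, norm_sq_plane]
    simp only [cross, PiLp.sub_apply]
    ring
  have h1 : ‖D‖ ≤ ‖z‖ + ‖D - z‖ := by
    calc ‖D‖ = ‖z + (D - z)‖ := by rw [add_sub_cancel]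
      _ ≤ _ := norm_add_le _ _
  have h2 : (‖z‖ + ‖D - z‖) ^ 2 ≤ Λ ^ 2 := by gcongr
  have h3 : ‖D‖ ^ 2 ≤ (‖z‖ + ‖D - z‖) ^ 2 := by gcongr
  rw [heron]
  nlinarith [sq_nonneg (‖z‖ - ‖D - z‖), sq_nonneg ‖D‖]

section Arc

variable {w w' : ℝ → Plane} {a b : ℝ}

lemma norm_sub_le_integral_norm (hab : a ≤ b) (hw : ∀ t, HasDerivAt w (w' t) t)
    (hw' : Continuous w') : ‖w b - w a‖ ≤ ∫ t in a..b, ‖w' t‖ := by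
  rw [← intervalIntegral.integral_eq_sub_of_hasDerivAt (fun t _ => hw t)
    (hw'.intervalIntegrable _ _)]
  exact intervalIntegral.norm_integral_le_integral_norm hab

lemma hasDerivAt_coord {t : ℝ} (hw : HasDerivAt w (w' t) t) (i : Fin 2) :
    HasDerivAt (fun t => w t i) (w' t i) t :=
  (EuclideanSpace.proj i : Plane →L[ℝ] ℝ).hasFDerivAt.comp_hasDerivAt t hw

lemma continuous_coord (hw' : Continuous w') (i : Fin 2) : Continuous fun t => w' t i :=
  (EuclideanSpace.proj i : Plane →L[ℝ] ℝ).continuous.comp hw'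

/-- The area swept by a curve of length at most `Λ` differs little from that of the segment joining
its endpoints `p` and `q` if `Λ` is close to `|q - p|`: in the frame of `q - p`, integration by parts
leaves only the component of the curve orthogonal to the segment. -/
lemma abs_integral_cross_sub_le (hab : a ≤ b) (hw : ∀ t, HasDerivAt w (w' t) t)
    (hw' : Continuous w') (hne : w a ≠ w b) {Λ : ℝ} (hΛ : ∫ t in a..b, ‖w' t‖ ≤ Λ) :
    |(∫ t in a..b, cross (w t) (w' t)) - cross (w a) (w b)| ≤
      Λ * √(Λ ^ 2 - ‖w b - w a‖ ^ 2) := by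
  set p := w a with hp
  set D := w b - w a with hD
  have hD0 : 0 < ‖D‖ := norm_pos_iff.2 (sub_ne_zero.2 hne.symm)
  set R := √(Λ ^ 2 - ‖D‖ ^ 2) with hR
  have hwc : Continuous w := continuous_iff_continuousAt.2 fun t => (hw t).continuousAt
  have hii : ∀ c d, IntervalIntegrable (fun t => ‖w' t‖) volume c d := fun c d =>
    hw'.norm.intervalIntegrable _ _
  have hΛ0 : 0 ≤ Λ := le_trans (intervalIntegral.integral_nonneg hab fun _ _ => norm_nonneg _) hΛ
  let f : ℝ → ℝ := fun t => (w t 0 - p 0) * D 0 + (w t 1 - p 1) * D 1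
  let g : ℝ → ℝ := fun t => D 0 * (w t 1 - p 1) - D 1 * (w t 0 - p 0)
  let f' : ℝ → ℝ := fun t => w' t 0 * D 0 + w' t 1 * D 1
  let g' : ℝ → ℝ := fun t => D 0 * w' t 1 - D 1 * w' t 0
  have hf : ∀ t, HasDerivAt f (f' t) t := fun t =>
    (((hasDerivAt_coord (hw t) 0).sub_const _).mul_const _).add
      (((hasDerivAt_coord (hw t) 1).sub_const _).mul_const _)
  have hg : ∀ t, HasDerivAt g (g' t) t := fun t =>
    (((hasDerivAt_coord (hw t) 1).sub_const _).const_mul _).sub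
      (((hasDerivAt_coord (hw t) 0).sub_const _).const_mul _)
  have hc0 := continuous_coord hw' 0
  have hc1 := continuous_coord hw' 1
  have hf'c : Continuous f' := (hc0.mul_const _).add (hc1.mul_const _)
  have hg'c : Continuous g' := (hc1.const_mul _).sub (hc0.const_mul _)
  have hfc : Continuous f := continuous_iff_continuousAt.2 fun t => (hf t).continuousAt
  have hgc : Continuous g := continuous_iff_continuousAt.2 fun t => (hg t).continuousAt
  -- integration by parts; `g` vanishes at both ends of the arc
  have hparts : ∫ t in a..b, (f' t * g t + f t * g' t) = 0 := by
    rw [intervalIntegral.integral_eq_sub_of_hasDerivAt (f := fun t => f t * g t)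
      (fun t _ => (hf t).mul (hg t))
      (((hf'c.mul hgc).add (hfc.mul hg'c)).intervalIntegrable _ _)]
    have h1 : g a = 0 := by simp [g, hp]
    have h2 : g b = 0 := by
      simp only [g, hD, hp, PiLp.sub_apply]; ring
    rw [h1, h2]; ring
  have hkey : ‖D‖ ^ 2 * ((∫ t in a..b, cross (w t) (w' t)) - cross (w a) (w b)) =
      ∫ t in a..b, -2 * (g t * f' t) := by
    have e1 : cross (w a) (w b) = ∫ t in a..b, cross p (w' t) := by
      have hd : ∀ t ∈ Set.uIcc a b, HasDerivAt (fun t => cross p (w t)) (cross p (w' t)) t :=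
        fun t _ => ((hasDerivAt_coord (hw t) 1).const_mul _).sub
          ((hasDerivAt_coord (hw t) 0).const_mul _)
      rw [intervalIntegral.integral_eq_sub_of_hasDerivAt hd
        ((continuous_cross continuous_const hw').intervalIntegrable _ _), hp, planar_cross_self, sub_zero]
    rw [e1, ← intervalIntegral.integral_sub ((continuous_cross hwc hw').intervalIntegrable _ _)
      ((continuous_cross continuous_const hw').intervalIntegrable _ _),
      ← intervalIntegral.integral_const_mul]
    rw [← sub_zero (∫ t in a..b, ‖D‖ ^ 2 * (cross (w t) (w' t) - cross p (w' t))), ← hparts,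
      ← intervalIntegral.integral_sub]
    · refine intervalIntegral.integral_congr fun t _ => ?_
      simp only [f, g, f', g', cross, norm_sq_plane]
      ring
    · exact (((continuous_cross hwc hw').sub (continuous_cross continuous_const hw')).const_mul
        _).intervalIntegrable _ _
    · exact ((hf'c.mul hgc).add (hfc.mul hg'c)).intervalIntegrable _ _
  have hgbound : ∀ t ∈ Set.Icc a b, 2 * |g t| ≤ ‖D‖ * R := by
    intro t ht
    have h1 : ‖w t - p‖ + ‖D - (w t - p)‖ ≤ Λ := by
      have e1 := norm_sub_le_integral_norm ht.1 hw hw'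
      have e2 := norm_sub_le_integral_norm ht.2 hw hw'
      have e3 : D - (w t - p) = w b - w t := by rw [hD, hp]; abel
      rw [e3]
      have e4 := intervalIntegral.integral_add_adjacent_intervals (hii a t) (hii t b)
      linarith
    have h2 := four_mul_cross_sq_le h1
    have h3 : cross D (w t - p) = g t := by simp only [cross, g, PiLp.sub_apply]
    rw [h3] at h2
    have h4 : ‖D‖ * R = √(‖D‖ ^ 2 * (Λ ^ 2 - ‖D‖ ^ 2)) := by
      rw [Real.sqrt_mul (sq_nonneg _), Real.sqrt_sq hD0.le]
    rw [h4]
    apply Real.le_sqrt_of_sq_le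
    rw [mul_pow, sq_abs]
    linarith
  have hf'bound : ∀ t, |f' t| ≤ ‖D‖ * ‖w' t‖ := by
    intro t
    apply abs_le_of_sq_le_sq _ (by positivity)
    rw [mul_pow, norm_sq_plane, norm_sq_plane]
    simp only [f']
    nlinarith [sq_nonneg (w' t 0 * D 1 - w' t 1 * D 0)]
  have hfin : ‖D‖ ^ 2 * |(∫ t in a..b, cross (w t) (w' t)) - cross (w a) (w b)| ≤
      ‖D‖ ^ 2 * (Λ * R) := by
    rw [← abs_of_nonneg (sq_nonneg ‖D‖), ← abs_mul, hkey, abs_of_nonneg (sq_nonneg ‖D‖)]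
    refine (intervalIntegral.abs_integral_le_integral_abs hab).trans ?_
    have hle : ∫ t in a..b, |-2 * (g t * f' t)| ≤ ∫ t in a..b, ‖D‖ ^ 2 * R * ‖w' t‖ := by
      refine intervalIntegral.integral_mono_on hab
        (((hgc.mul hf'c).const_mul _).abs.intervalIntegrable _ _)
        ((hw'.norm.const_mul _).intervalIntegrable _ _) fun t ht => ?_
      rw [abs_mul, abs_mul, abs_neg, abs_two, ← mul_assoc]
      calc 2 * |g t| * |f' t| ≤ (‖D‖ * R) * (‖D‖ * ‖w' t‖) :=
            mul_le_mul (hgbound t ht) (hf'bound t) (abs_nonneg _)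
              (mul_nonneg hD0.le (Real.sqrt_nonneg _))
        _ = _ := by ring
    refine hle.trans ?_
    rw [intervalIntegral.integral_const_mul]
    have : ‖D‖ ^ 2 * R * ∫ t in a..b, ‖w' t‖ ≤ ‖D‖ ^ 2 * R * Λ :=
      mul_le_mul_of_nonneg_left hΛ (mul_nonneg (sq_nonneg _) (Real.sqrt_nonneg _))
    linarith
  exact le_of_mul_le_mul_left hfin (by positivity)

end Arc

/-- Curves whose endpoints converge to `p ≠ q` and whose lengths converge to `|q - p|` sweep, in the
limit, the area swept by the segment from `p` to `q`. -/
lemma tendsto_integral_cross_arc {w w' : ℕ → ℝ → Plane} {a b : ℝ} (hab : a ≤ b)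
    (hw : ∀ k t, HasDerivAt (w k) (w' k t) t) (hw' : ∀ k, Continuous (w' k)) {p q : Plane}
    (hpq : p ≠ q) (ha : Tendsto (fun k => w k a) atTop (𝓝 p))
    (hb : Tendsto (fun k => w k b) atTop (𝓝 q))
    (hlen : Tendsto (fun k => ∫ t in a..b, ‖w' k t‖) atTop (𝓝 ‖q - p‖)) :
    Tendsto (fun k => ∫ t in a..b, cross (w k t) (w' k t)) atTop (𝓝 (cross p q)) := by
  have hne : ∀ᶠ k in atTop, w k a ≠ w k b := by
    have h1 := (hb.sub ha).norm
    have h2 : 0 < ‖q - p‖ := norm_pos_iff.2 (sub_ne_zero.2 hpq.symm)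
    filter_upwards [h1.eventually (lt_mem_nhds h2)] with k hk he
    rw [he, sub_self, norm_zero] at hk
    exact lt_irrefl _ hk
  have hcross : Tendsto (fun k => cross (w k a) (w k b)) atTop (𝓝 (cross p q)) := by
    have hp : ∀ i, Continuous fun x : Plane => x i := fun i =>
      (EuclideanSpace.proj i : Plane →L[ℝ] ℝ).continuous
    exact ((((hp 0).tendsto p).comp ha).mul (((hp 1).tendsto q).comp hb)).sub
      ((((hp 1).tendsto p).comp ha).mul (((hp 0).tendsto q).comp hb))
  have herr : Tendsto (fun k => (∫ t in a..b, ‖w' k t‖) *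
      √((∫ t in a..b, ‖w' k t‖) ^ 2 - ‖w k b - w k a‖ ^ 2)) atTop (𝓝 0) := by
    have h1 := hlen.mul (((hlen.pow 2).sub ((hb.sub ha).norm.pow 2)).sqrt)
    simpa using h1
  have hdiff : Tendsto (fun k => (∫ t in a..b, cross (w k t) (w' k t)) - cross (w k a) (w k b))
      atTop (𝓝 0) := by
    refine squeeze_zero_norm' ?_ herr
    filter_upwards [hne] with k hk
    exact abs_integral_cross_sub_le hab (hw k) (hw' k) hk le_rfl
  simpa using hdiff.add hcross

/-- Curves through points converging to the vertices of a polygon, with lengths converging to its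
perimeter, sweep in the limit the area swept by the polygon. -/
lemma tendsto_integral_cross_polygon {w w' : ℕ → ℝ → Plane} {τ : ℕ → ℝ} (hτ : Monotone τ)
    (hw : ∀ k t, HasDerivAt (w k) (w' k t) t) (hw' : ∀ k, Continuous (w' k)) {c : ℕ → Plane}
    (hc : ∀ j, c j ≠ c (j + 1)) (hconv : ∀ j, Tendsto (fun k => w k (τ j)) atTop (𝓝 (c j))) {n : ℕ}
    (hlen : Tendsto (fun k => ∫ t in (τ 0)..(τ n), ‖w' k t‖) atTop
      (𝓝 (∑ j ∈ Finset.range n, ‖c (j + 1) - c j‖))) :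
    Tendsto (fun k => ∫ t in (τ 0)..(τ n), cross (w k t) (w' k t)) atTop
      (𝓝 (∑ j ∈ Finset.range n, cross (c j) (c (j + 1)))) := by
  have hwc : ∀ k, Continuous (w k) := fun k =>
    continuous_iff_continuousAt.2 fun t => (hw k t).continuousAt
  have hsplit : ∀ k, ∑ j ∈ Finset.range n, ∫ t in (τ j)..(τ (j + 1)), cross (w k t) (w' k t) =
      ∫ t in (τ 0)..(τ n), cross (w k t) (w' k t) := fun k =>
    intervalIntegral.sum_integral_adjacent_intervals fun j _ =>
      (continuous_cross (hwc k) (hw' k)).intervalIntegrable _ _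
  have hsplit' : ∀ k, ∑ j ∈ Finset.range n, ∫ t in (τ j)..(τ (j + 1)), ‖w' k t‖ =
      ∫ t in (τ 0)..(τ n), ‖w' k t‖ := fun k =>
    intervalIntegral.sum_integral_adjacent_intervals fun j _ =>
      (hw' k).norm.intervalIntegrable _ _
  simp only [← hsplit]
  simp only [← hsplit'] at hlen
  refine tendsto_finsetSum _ fun j hj => ?_
  have hchord : ∀ j, Tendsto (fun k => ‖w k (τ (j + 1)) - w k (τ j)‖) atTop
      (𝓝 ‖c (j + 1) - c j‖) := fun j => ((hconv (j + 1)).sub (hconv j)).norm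
  have hexc : Tendsto (fun k => ∑ j ∈ Finset.range n, ((∫ t in (τ j)..(τ (j + 1)), ‖w' k t‖) -
      ‖w k (τ (j + 1)) - w k (τ j)‖)) atTop (𝓝 0) := by
    simp only [Finset.sum_sub_distrib]
    simpa using hlen.sub (tendsto_finsetSum (Finset.range n) fun j _ => hchord j)
  have hnn : ∀ k j, 0 ≤ (∫ t in (τ j)..(τ (j + 1)), ‖w' k t‖) -
      ‖w k (τ (j + 1)) - w k (τ j)‖ := fun k j =>
    sub_nonneg.2 (norm_sub_le_integral_norm (hτ j.le_succ) (hw k) (hw' k))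
  refine tendsto_integral_cross_arc (hτ j.le_succ) hw hw' (hc j) (hconv j) (hconv (j + 1)) ?_
  have h0 : Tendsto (fun k => (∫ t in (τ j)..(τ (j + 1)), ‖w' k t‖) -
      ‖w k (τ (j + 1)) - w k (τ j)‖) atTop (𝓝 0) :=
    squeeze_zero (fun k => hnn k j)
      (fun k => Finset.single_le_sum (f := fun j => (∫ t in (τ j)..(τ (j + 1)), ‖w' k t‖) -
        ‖w k (τ (j + 1)) - w k (τ j)‖) (fun i _ => hnn k i) hj) hexc
  simpa using h0.add (hchord j)

/-! ### Area swept by circles and the Jacobian -/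

section Green

variable {v : Plane → Plane} {ℓ : ℝ}

/-- Twice the signed area swept by the image under `v` of the circle of radius `s`. -/
noncomputable def circleCross (v : Plane → Plane) (a s : ℝ) : ℝ :=
  ∫ t in a..(a + 2 * Real.pi), cross (v (polarPoint s t)) (angularDeriv v s t)

lemma continuous_comp_polarPoint (hv : ContDiffOn ℝ 1 v (Metric.ball 0 ℓ)) {s : ℝ} (hs : |s| < ℓ) :
    Continuous fun t => v (polarPoint s t) :=
  continuous_iff_continuousAt.2 fun t =>
    (hasDerivAt_angle (hv.differentiableOn one_ne_zero) hs t).continuousAt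

/-- Integration by parts on circles turns the increment of the swept area into an integral that
contains increments of `v`, but no increments of its derivatives. -/
lemma circleCross_sub (hv : ContDiffOn ℝ 1 v (Metric.ball 0 ℓ)) (a : ℝ) {s s₀ : ℝ} (hs : |s| < ℓ)
    (hs₀ : |s₀| < ℓ) :
    circleCross v a s - circleCross v a s₀ = ∫ t in a..(a + 2 * Real.pi),
      cross (v (polarPoint s t) - v (polarPoint s₀ t)) (angularDeriv v s t + angularDeriv v s₀ t) := by
  have hc := continuous_comp_polarPoint hv hs
  have hc₀ := continuous_comp_polarPoint hv hs₀
  have hd := continuous_angularDeriv hv hs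
  have hd₀ := continuous_angularDeriv hv hs₀
  have hper : ∫ t in a..(a + 2 * Real.pi), (cross (v (polarPoint s₀ t)) (angularDeriv v s t) +
      cross (angularDeriv v s₀ t) (v (polarPoint s t))) = 0 := by
    have hder : ∀ t ∈ Set.uIcc a (a + 2 * Real.pi), HasDerivAt
        (fun t => cross (v (polarPoint s₀ t)) (v (polarPoint s t)))
        (cross (v (polarPoint s₀ t)) (angularDeriv v s t) +
          cross (angularDeriv v s₀ t) (v (polarPoint s t))) t := by
      intro t _
      have h1 := hasDerivAt_angle (hv.differentiableOn one_ne_zero) hs t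
      have h0 := hasDerivAt_angle (hv.differentiableOn one_ne_zero) hs₀ t
      have := ((hasDerivAt_coord (w' := angularDeriv v s₀) h0 0).mul
        (hasDerivAt_coord (w' := angularDeriv v s) h1 1)).sub
        ((hasDerivAt_coord (w' := angularDeriv v s₀) h0 1).mul
        (hasDerivAt_coord (w' := angularDeriv v s) h1 0))
      refine this.congr_deriv ?_
      simp only [cross]
      ring
    rw [intervalIntegral.integral_eq_sub_of_hasDerivAt hder
      (((continuous_cross hc₀ hd).add (continuous_cross hd₀ hc)).intervalIntegrable _ _)]
    simp only [polarPoint_add_two_pi, sub_self]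
  have i1 : IntervalIntegrable (fun t => cross (v (polarPoint s t)) (angularDeriv v s t)) volume a
      (a + 2 * Real.pi) := (continuous_cross hc hd).intervalIntegrable _ _
  have i2 : IntervalIntegrable (fun t => cross (v (polarPoint s₀ t)) (angularDeriv v s₀ t)) volume a
      (a + 2 * Real.pi) := (continuous_cross hc₀ hd₀).intervalIntegrable _ _
  have i3 : IntervalIntegrable (fun t => cross (v (polarPoint s₀ t)) (angularDeriv v s t) +
      cross (angularDeriv v s₀ t) (v (polarPoint s t))) volume a (a + 2 * Real.pi) :=
    ((continuous_cross hc₀ hd).add (continuous_cross hd₀ hc)).intervalIntegrable _ _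
  rw [circleCross, circleCross, ← intervalIntegral.integral_sub i1 i2,
    ← sub_zero (∫ t in a..(a + 2 * Real.pi), _), ← hper,
    ← intervalIntegral.integral_sub (i1.sub i2) i3]
  refine intervalIntegral.integral_congr fun t _ => ?_
  simp only [cross, PiLp.add_apply, PiLp.sub_apply]
  ring

lemma norm_sub_le_of_radialDeriv_le (hv : ContDiffOn ℝ 1 v (Metric.ball 0 ℓ)) {ρ M t : ℝ}
    (hρ : ρ < ℓ) (hM : ∀ s, |s| ≤ ρ → ‖radialDeriv v s t‖ ≤ M) {s s₀ : ℝ} (hs : |s| ≤ ρ)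
    (hs₀ : |s₀| ≤ ρ) : ‖v (polarPoint s t) - v (polarPoint s₀ t)‖ ≤ M * ‖s - s₀‖ := by
  have hder : ∀ s ∈ Set.Icc (-ρ) ρ, HasDerivWithinAt (fun s => v (polarPoint s t))
      (radialDeriv v s t) (Set.Icc (-ρ) ρ) s := fun s hs =>
    (hasDerivAt_radius (hv.differentiableOn one_ne_zero)
      ((abs_le.2 hs).trans_lt hρ) t).hasDerivWithinAt
  exact (convex_Icc (-ρ) ρ).norm_image_sub_le_of_norm_hasDerivWithin_le hder
    (fun s hs => hM s (abs_le.2 hs)) (abs_le.1 hs₀) (abs_le.1 hs)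

/-- The second derivatives of `v`, which need not exist, do not enter: the difference quotients are
those of `circleCross_sub`. -/
lemma hasDerivAt_circleCross (hv : ContDiffOn ℝ 1 v (Metric.ball 0 ℓ)) (a : ℝ) {s₀ : ℝ}
    (hs₀ : |s₀| < ℓ) :
    HasDerivAt (circleCross v a) (∫ t in a..(a + 2 * Real.pi),
      cross (radialDeriv v s₀ t) (angularDeriv v s₀ t + angularDeriv v s₀ t)) s₀ := by
  obtain ⟨ρ, hρ₀, hρ⟩ := exists_between hs₀
  have hK : IsCompact (Set.Icc (-ρ) ρ ×ˢ Set.Icc a (a + 2 * Real.pi)) :=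
    isCompact_Icc.prod isCompact_Icc
  have hKs : Set.Icc (-ρ) ρ ×ˢ Set.Icc a (a + 2 * Real.pi) ⊆ {p : ℝ × ℝ | |p.1| < ℓ} :=
    fun p hp => (abs_le.2 hp.1).trans_lt hρ
  obtain ⟨M, hM⟩ := hK.exists_bound_of_continuousOn ((continuousOn_radialDeriv hv).mono hKs)
  obtain ⟨N, hN⟩ := hK.exists_bound_of_continuousOn ((continuousOn_angularDeriv hv).mono hKs)
  have hpi := Real.two_pi_pos
  have hnhds : ∀ᶠ s in 𝓝[≠] s₀, |s| < ρ ∧ s ≠ s₀ := by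
    have h1 : ∀ᶠ s in 𝓝[≠] s₀, |s| < ρ :=
      nhdsWithin_le_nhds ((continuous_abs.tendsto s₀).eventually (gt_mem_nhds hρ₀))
    exact h1.and eventually_mem_nhdsWithin
  rw [hasDerivAt_iff_tendsto_slope]
  have hslope : (fun s => ∫ t in a..(a + 2 * Real.pi),
      cross ((s - s₀)⁻¹ • (v (polarPoint s t) - v (polarPoint s₀ t)))
        (angularDeriv v s t + angularDeriv v s₀ t)) =ᶠ[𝓝[≠] s₀] slope (circleCross v a) s₀ := by
    filter_upwards [hnhds] with s hs
    rw [slope_def_field, circleCross_sub hv a (hs.1.trans hρ) hs₀, div_eq_inv_mul,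
      ← intervalIntegral.integral_const_mul]
    refine intervalIntegral.integral_congr fun t _ => ?_
    simp only [cross, PiLp.smul_apply, smul_eq_mul]
    ring
  refine Tendsto.congr' hslope ?_
  refine intervalIntegral.tendsto_integral_filter_of_dominated_convergence
    (fun _ => M * (N + N)) ?_ ?_ (intervalIntegrable_const) ?_
  · filter_upwards [hnhds] with s hs
    have hsℓ := hs.1.trans hρ
    have h1 : Continuous fun t => (s - s₀)⁻¹ • (v (polarPoint s t) - v (polarPoint s₀ t)) :=
      ((continuous_comp_polarPoint hv hsℓ).sub (continuous_comp_polarPoint hv hs₀)).const_smul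
        (s - s₀)⁻¹
    exact (continuous_cross h1 ((continuous_angularDeriv hv hsℓ).add
      (continuous_angularDeriv hv hs₀))).aestronglyMeasurable
  · filter_upwards [hnhds] with s hs
    refine ae_of_all _ fun t ht => ?_
    rw [Set.uIoc_of_le (by linarith)] at ht
    have htI := Set.Ioc_subset_Icc_self ht
    have hmem : ∀ s, |s| ≤ ρ → (s, t) ∈ Set.Icc (-ρ) ρ ×ˢ Set.Icc a (a + 2 * Real.pi) :=
      fun s hs => ⟨abs_le.1 hs, htI⟩
    have hM' : ∀ s, |s| ≤ ρ → ‖radialDeriv v s t‖ ≤ M := fun s hs => hM (s, t) (hmem s hs)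
    have hN' : ∀ s, |s| ≤ ρ → ‖angularDeriv v s t‖ ≤ N := fun s hs => hN (s, t) (hmem s hs)
    have hM0 : 0 ≤ M := (norm_nonneg _).trans (hM' s₀ hρ₀.le)
    have b1 : ‖(s - s₀)⁻¹ • (v (polarPoint s t) - v (polarPoint s₀ t))‖ ≤ M := by
      rw [norm_smul, norm_inv, inv_mul_le_iff₀ (norm_pos_iff.2 (sub_ne_zero.2 hs.2)), mul_comm]
      exact norm_sub_le_of_radialDeriv_le hv hρ hM' hs.1.le hρ₀.le
    have b2 : ‖angularDeriv v s t + angularDeriv v s₀ t‖ ≤ N + N :=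
      (norm_add_le _ _).trans (add_le_add (hN' s hs.1.le) (hN' s₀ hρ₀.le))
    exact (abs_cross_le _ _).trans (mul_le_mul b1 b2 (norm_nonneg _) hM0)
  · refine ae_of_all _ fun t _ => ?_
    have h1 : Tendsto (fun s => (s - s₀)⁻¹ • (v (polarPoint s t) - v (polarPoint s₀ t)))
        (𝓝[≠] s₀) (𝓝 (radialDeriv v s₀ t)) :=
      hasDerivAt_iff_tendsto_slope.1
        (hasDerivAt_radius (hv.differentiableOn one_ne_zero) hs₀ t)
    have h2 : Tendsto (fun s => angularDeriv v s t + angularDeriv v s₀ t) (𝓝[≠] s₀)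
        (𝓝 (angularDeriv v s₀ t + angularDeriv v s₀ t)) := by
      have hopen : IsOpen {p : ℝ × ℝ | |p.1| < ℓ} :=
        isOpen_lt (continuous_abs.comp continuous_fst) continuous_const
      have hca : ContinuousAt (fun p : ℝ × ℝ => angularDeriv v p.1 p.2) (s₀, t) :=
        (continuousOn_angularDeriv hv).continuousAt (hopen.mem_nhds hs₀)
      have hcs : Tendsto (fun s => angularDeriv v s t) (𝓝 s₀) (𝓝 (angularDeriv v s₀ t)) :=
        hca.tendsto.comp (f := fun s : ℝ => (s, t)) (by
          have : Continuous fun s : ℝ => (s, t) := by fun_prop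
          exact this.tendsto s₀)
      exact (hcs.mono_left nhdsWithin_le_nhds).add_const _
    have hp : ∀ i, Continuous fun x : Plane => x i := fun i =>
      (EuclideanSpace.proj i : Plane →L[ℝ] ℝ).continuous
    exact ((((hp 0).tendsto _).comp h1).mul (((hp 1).tendsto _).comp h2)).sub
      ((((hp 1).tendsto _).comp h1).mul (((hp 0).tendsto _).comp h2))

/-- For a `C¹` map, the area swept by the image of a circle is at most the integral of `|det ∇v|`
over the disk it bounds. -/
lemma ofReal_abs_circleCross_le (hv : ContDiffOn ℝ 1 v (Metric.ball 0 ℓ)) (a : ℝ) {s : ℝ}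
    (hs0 : 0 ≤ s) (hs : s < ℓ) :
    ENNReal.ofReal (|circleCross v a s| / 2) ≤
      ∫⁻ x in Metric.ball 0 s, ENNReal.ofReal |jacobianDet v x| := by
  have hpi := Real.two_pi_pos
  have hlt : ∀ r ∈ Set.Icc 0 s, |r| < ℓ := fun r hr => by
    rw [abs_of_nonneg hr.1]; exact hr.2.trans_lt hs
  -- retraction of the radii onto `[0, s]`, which makes the integrands continuous everywhere
  let c : ℝ → ℝ := fun r => max 0 (min r s)
  have hc : Continuous c := by fun_prop
  have hcm : ∀ r, c r ∈ Set.Icc 0 s := fun r => ⟨le_max_left _ _, max_le hs0 (min_le_right _ _)⟩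
  have hcr : ∀ r ∈ Set.Icc 0 s, c r = r := fun r hr => by
    simp only [c]; rw [min_eq_left hr.2, max_eq_right hr.1]
  have hmaps : ∀ p : ℝ × ℝ, (c p.1, p.2) ∈ {p : ℝ × ℝ | |p.1| < ℓ} := fun p => hlt _ (hcm _)
  have hcp : Continuous fun p : ℝ × ℝ => (c p.1, p.2) := by fun_prop
  have hR : Continuous fun p : ℝ × ℝ => radialDeriv v (c p.1) p.2 := by
    rw [← continuousOn_univ]
    exact (continuousOn_radialDeriv hv).comp hcp.continuousOn fun p _ => hmaps p
  have hA : Continuous fun p : ℝ × ℝ => angularDeriv v (c p.1) p.2 := by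
    rw [← continuousOn_univ]
    exact (continuousOn_angularDeriv hv).comp hcp.continuousOn fun p _ => hmaps p
  have hp : ∀ i, Continuous fun x : Plane => x i := fun i =>
    (EuclideanSpace.proj i : Plane →L[ℝ] ℝ).continuous
  have hX : Continuous fun p : ℝ × ℝ => cross (radialDeriv v (c p.1) p.2)
      (angularDeriv v (c p.1) p.2) :=
    (((hp 0).comp hR).mul ((hp 1).comp hA)).sub (((hp 1).comp hR).mul ((hp 0).comp hA))
  let I : ℝ → ℝ := fun r => ∫ t in a..(a + 2 * Real.pi),
    cross (radialDeriv v (c r) t) (angularDeriv v (c r) t)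
  let J : ℝ → ℝ := fun r => ∫ t in a..(a + 2 * Real.pi),
    |cross (radialDeriv v (c r) t) (angularDeriv v (c r) t)|
  have hI : Continuous I :=
    intervalIntegral.continuous_parametric_intervalIntegral_of_continuous' hX _ _
  have hJ : Continuous J :=
    intervalIntegral.continuous_parametric_intervalIntegral_of_continuous' hX.abs _ _
  have hXr : ∀ r, Continuous fun t => cross (radialDeriv v (c r) t) (angularDeriv v (c r) t) :=
    fun r => hX.comp (f := fun t : ℝ => (r, t)) (by fun_prop)
  have hG0 : circleCross v a 0 = 0 := by
    have : ∀ t, angularDeriv v 0 t = 0 := fun t => by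
      have : polarPoint 0 (t + Real.pi / 2) = 0 := by ext i; fin_cases i <;> simp
      rw [angularDeriv, this, map_zero]
    simp [circleCross, this, cross]
  have hftc : circleCross v a s = ∫ r in 0..s, 2 * I r := by
    have hder : ∀ r ∈ Set.uIcc 0 s, HasDerivAt (circleCross v a) (2 * I r) r := ?_
    · rw [intervalIntegral.integral_eq_sub_of_hasDerivAt hder
        ((hI.const_mul 2).intervalIntegrable _ _), hG0, sub_zero]
    intro r hr
    rw [Set.uIcc_of_le hs0] at hr
    refine (hasDerivAt_circleCross hv a (hlt r hr)).congr_deriv ?_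
    simp only [I, hcr r hr]
    rw [← intervalIntegral.integral_const_mul]
    refine intervalIntegral.integral_congr fun t _ => ?_
    simp only [cross, PiLp.add_apply]
    ring
  have hle : |circleCross v a s| / 2 ≤ ∫ r in 0..s, J r := by
    rw [hftc, intervalIntegral.integral_const_mul, abs_mul, abs_two, mul_div_cancel_left₀ _ two_ne_zero]
    refine (intervalIntegral.abs_integral_le_integral_abs hs0).trans ?_
    refine intervalIntegral.integral_mono_on hs0 (hI.abs.intervalIntegrable _ _)
      (hJ.intervalIntegrable _ _) fun r _ => ?_
    exact intervalIntegral.abs_integral_le_integral_abs (by linarith)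
  refine (ENNReal.ofReal_le_ofReal hle).trans (le_of_eq ?_)
  have hJ0 : ∀ r, 0 ≤ J r := fun r =>
    intervalIntegral.integral_nonneg (by linarith) fun t _ => abs_nonneg _
  have hmeas : Measurable fun x => ENNReal.ofReal |jacobianDet v x| :=
    (continuous_abs.measurable.comp (measurable_jacobianDet v)).ennreal_ofReal
  rw [← setLIntegral_Ioo_ofReal hs0 hJ fun r _ => hJ0 r, setLIntegral_ball_polar hmeas s a]
  refine setLIntegral_congr_fun measurableSet_Ioo fun r hr => ?_
  rw [← setLIntegral_Ioo_ofReal (by linarith) (hXr r).abs fun t _ => abs_nonneg _,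
    ← lintegral_const_mul' _ _ ENNReal.ofReal_ne_top]
  refine lintegral_congr fun t => ?_
  have h1 : cross (radialDeriv v r t) (angularDeriv v r t) = r * jacobianDet v (polarPoint r t) :=
    cross_polar_eq v (polarPoint r t) r t
  rw [hcr r (Set.Ioo_subset_Icc_self hr), h1, abs_mul, abs_of_pos hr.1, ENNReal.ofReal_mul hr.1.le]

end Green

/-! ### The lower bound for the relaxed area -/

lemma continuousOn_areaDensity {v : Plane → Plane} {Ω : Set Plane} (hΩ : IsOpen Ω)
    (hv : ContDiffOn ℝ 1 v Ω) : ContinuousOn (areaDensity v) Ω := by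
  have h := continuousOn_partialD hΩ hv
  have h1 : ContinuousOn (gradSq v) Ω := continuousOn_finsetSum _ fun i _ =>
    continuousOn_finsetSum _ fun j _ => (h i j).pow 2
  have h2 : ContinuousOn (jacobianDet v) Ω :=
    ((h 0 0).mul (h 1 1)).sub ((h 0 1).mul (h 1 0))
  exact ((continuousOn_const.add h1).add (h2.pow 2)).sqrt

lemma measurable_norm_angularDeriv (v : Plane → Plane) :
    Measurable fun p : ℝ × ℝ => ‖angularDeriv v p.1 p.2‖ := by
  have hP : Measurable fun p : ℝ × ℝ => polarPoint p.1 p.2 := continuous_polarPoint.measurable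
  have hc : ∀ i, Measurable fun p : ℝ × ℝ => angularDeriv v p.1 p.2 i := by
    intro i
    simp only [angularDeriv, fderiv_apply_coord, polarPoint_zero_coord, polarPoint_one_coord]
    have h0 := (measurable_partialD v i 0).comp hP
    have h1 := (measurable_partialD v i 1).comp hP
    have e0 : Measurable fun p : ℝ × ℝ => p.1 * Real.cos (p.2 + Real.pi / 2) := by fun_prop
    have e1 : Measurable fun p : ℝ × ℝ => p.1 * Real.sin (p.2 + Real.pi / 2) := by fun_prop
    exact (e0.mul h0).add (e1.mul h1)
  have : (fun p : ℝ × ℝ => ‖angularDeriv v p.1 p.2‖) =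
      fun p : ℝ × ℝ => √(angularDeriv v p.1 p.2 0 ^ 2 + angularDeriv v p.1 p.2 1 ^ 2) := by
    ext p
    rw [← norm_sq_plane, Real.sqrt_sq (norm_nonneg _)]
  rw [this]
  exact (((hc 0).pow_const 2).add ((hc 1).pow_const 2)).sqrt

/-- The integral over one period dominates the contributions `x j` of neighbourhoods of width `2δ` of
the interfaces and of a constant lower bound elsewhere. -/
lemma sum_add_le_integral_period {f : ℝ → ℝ} (hf : Continuous f) {θ ω δ c : ℝ} {n : ℕ} {x : ℕ → ℝ}
    (hδω : 2 * δ ≤ ω) (hc : ∀ t, c ≤ f t)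
    (hx : ∀ j : ℕ, x j ≤ ∫ t in (θ + ω * j - δ)..(θ + ω * j + δ), f t) :
    ∑ j ∈ Finset.range n, x j + n * ((ω - 2 * δ) * c) ≤
      ∫ t in (θ - δ)..(θ - δ + ω * n), f t := by
  have hii : ∀ a b, IntervalIntegrable f volume a b := fun a b => hf.intervalIntegrable a b
  have h0 := intervalIntegral.sum_integral_adjacent_intervals (μ := volume) (f := f)
    (a := fun j : ℕ => θ - δ + ω * j) (n := n) fun m _ => hii _ _
  simp only [Nat.cast_zero, mul_zero, add_zero] at h0
  rw [← h0]
  have h1 : ∑ j ∈ Finset.range n, x j + n * ((ω - 2 * δ) * c) =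
      ∑ j ∈ Finset.range n, (x j + (ω - 2 * δ) * c) := by
    rw [Finset.sum_add_distrib]; simp
  rw [h1]
  refine Finset.sum_le_sum fun j _ => ?_
  have e1 : θ - δ + ω * j = θ + ω * j - δ := by ring
  rw [e1, ← intervalIntegral.integral_add_adjacent_intervals (hii _ (θ + ω * j + δ)) (hii _ _)]
  refine add_le_add (hx j) ?_
  have e2 : θ + ω * j + δ ≤ θ - δ + ω * (j + 1 : ℕ) := by push_cast; linarith
  have h2 := intervalIntegral.integral_mono_on e2 (intervalIntegrable_const (c := c)) (hii _ _)
    fun t _ => hc t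
  rw [intervalIntegral.integral_const, smul_eq_mul] at h2
  refine le_trans (le_of_eq ?_) h2
  push_cast
  ring

namespace IsJunction

variable {n : ℕ} {θ ℓ : ℝ} {b : ℤ → Plane} {L κ : ℝ} {u : Plane → Plane} {v : ℕ → Plane → Plane}

/-- Convergence at the two sides of all interfaces, for almost every radius and for arbitrarily thin
neighbourhoods of the interfaces. -/
lemma exists_good_angle (h : IsJunction n θ ℓ b L κ u)
    (hconv : ∀ᵐ x ∂(volume.restrict (Metric.ball (0 : Plane) ℓ)),
      Tendsto (fun k => v k x) atTop (𝓝 (u x))) {η : ℝ} (hη : 0 < η) :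
    ∃ δ : ℝ, 0 < δ ∧ δ < η ∧ 2 * δ < 2 * Real.pi / n ∧
      ∀ᵐ r ∂(volume.restrict (Set.Ioo 0 ℓ)), ∀ m : ℤ,
        Tendsto (fun k => v k (polarPoint r (θ + 2 * Real.pi / n * m + δ))) atTop (𝓝 (b m)) ∧
        Tendsto (fun k => v k (polarPoint r (θ + 2 * Real.pi / n * m - δ))) atTop
          (𝓝 (b (m - 1))) := by
  have hω := h.angle_pos
  set ω := 2 * Real.pi / n with hωdef
  let p : ℝ → Prop := fun t => ∀ᵐ r ∂(volume.restrict (Set.Ioo 0 ℓ)),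
    Tendsto (fun k => v k (polarPoint r t)) atTop (𝓝 (u (polarPoint r t)))
  have hp : ∀ᵐ t, p t := ae_angle_ae_radius hconv
  have hadd : ∀ᵐ δ : ℝ, ∀ m : ℤ, p (θ + ω * m + δ) := ae_all_iff.2 fun m =>
    (measurePreserving_add_left volume (θ + ω * m)).quasiMeasurePreserving.ae hp
  have hsub : ∀ᵐ δ : ℝ, ∀ m : ℤ, p (θ + ω * m - δ) := ae_all_iff.2 fun m =>
    (Measure.measurePreserving_sub_left volume (θ + ω * m)).quasiMeasurePreserving.ae hp
  have hpos : 0 < min η (ω / 2) := lt_min hη (half_pos hω)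
  have hne : (ae (volume.restrict (Set.Ioo 0 (min η (ω / 2))))).NeBot := by
    rw [ae_restrict_neBot, Real.volume_Ioo, sub_zero]
    exact (ENNReal.ofReal_pos.2 hpos).ne'
  obtain ⟨δ, hδ, hδa, hδs⟩ := ((ae_restrict_mem (μ := volume)
    (measurableSet_Ioo (a := (0 : ℝ)) (b := min η (ω / 2)))).and
    ((ae_restrict_of_ae hadd).and (ae_restrict_of_ae hsub))).exists
  have hδω : δ < ω / 2 := hδ.2.trans_le (min_le_right _ _)
  refine ⟨δ, hδ.1, hδ.2.trans_le (min_le_left _ _), by linarith, ?_⟩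
  filter_upwards [ae_restrict_mem measurableSet_Ioo, ae_all_iff.2 hδa, ae_all_iff.2 hδs]
    with r hr hra hrs m
  have h1 := hra m
  have h2 := hrs m
  have hδ0 := hδ.1
  rw [h.apply_polarPoint m r _ hr.1 hr.2 (by linarith) (by linarith)] at h1
  rw [h.apply_polarPoint (m - 1) r _ hr.1 hr.2 (by push_cast; linarith)
    (by push_cast; linarith)] at h2
  exact ⟨h1, h2⟩

/-- The sum of the jumps of `v` across the neighbourhoods of width `2δ` of the interfaces, on the
circle of radius `r`. -/
noncomputable def jumpSum (n : ℕ) (θ δ : ℝ) (v : Plane → Plane) (r : ℝ) : ℝ :=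
  ∑ j ∈ Finset.range n, ‖v (polarPoint r (θ + 2 * Real.pi / n * j + δ)) -
    v (polarPoint r (θ + 2 * Real.pi / n * j - δ))‖

lemma tendsto_jumpSum (h : IsJunction n θ ℓ b L κ u) {δ r : ℝ}
    (hconv : ∀ m : ℤ,
        Tendsto (fun k => v k (polarPoint r (θ + 2 * Real.pi / n * m + δ))) atTop (𝓝 (b m)) ∧
        Tendsto (fun k => v k (polarPoint r (θ + 2 * Real.pi / n * m - δ))) atTop
          (𝓝 (b (m - 1)))) :
    Tendsto (fun k => jumpSum n θ δ (v k) r) atTop (𝓝 (n * L)) := by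
  have h1 : Tendsto (fun k => jumpSum n θ δ (v k) r) atTop
      (𝓝 (∑ j ∈ Finset.range n, ‖b (j : ℤ) - b ((j : ℤ) - 1)‖)) := by
    refine tendsto_finsetSum _ fun j _ => ?_
    have := hconv j
    push_cast at this
    exact (this.1.sub this.2).norm
  have h2 : ∀ j : ℕ, ‖b (j : ℤ) - b ((j : ℤ) - 1)‖ = L := fun j => by
    have := h.norm_sub ((j : ℤ) - 1)
    rwa [sub_add_cancel] at this
  simpa [h2] using h1

section Circle

variable {w : Plane → Plane} {δ r : ℝ}

lemma norm_sub_le_arc (hw : ContDiffOn ℝ 1 w (Metric.ball 0 ℓ)) (hr : |r| < ℓ) (hδ : 0 ≤ δ)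
    (t : ℝ) : ‖w (polarPoint r (t + δ)) - w (polarPoint r (t - δ))‖ ≤
      ∫ τ in (t - δ)..(t + δ), ‖angularDeriv w r τ‖ :=
  norm_sub_le_integral_norm (w := fun t => w (polarPoint r t)) (w' := angularDeriv w r)
    (by linarith) (hasDerivAt_angle (hw.differentiableOn one_ne_zero) hr) (continuous_angularDeriv hw hr)

lemma jumpSum_le_length (h : IsJunction n θ ℓ b L κ u) (hw : ContDiffOn ℝ 1 w (Metric.ball 0 ℓ))
    (hr : |r| < ℓ) (hδ : 0 ≤ δ) (hδω : 2 * δ ≤ 2 * Real.pi / n) :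
    jumpSum n θ δ w r ≤ ∫ t in (θ - δ)..(θ - δ + 2 * Real.pi), ‖angularDeriv w r t‖ := by
  have := sum_add_le_integral_period (f := fun t => ‖angularDeriv w r t‖) (θ := θ) (c := 0) (n := n)
    (continuous_angularDeriv hw hr).norm hδω (fun t => norm_nonneg _)
    fun j => norm_sub_le_arc hw hr hδ (θ + 2 * Real.pi / n * j)
  rw [h.angle_mul] at this
  simpa [jumpSum] using this

/-- On a circle, the area density dominates the jumps near the interfaces and the length of the arcs
away from them. -/
lemma jumpSum_add_le_area (h : IsJunction n θ ℓ b L κ u)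
    (hw : ContDiffOn ℝ 1 w (Metric.ball 0 ℓ)) (hr0 : 0 ≤ r) (hr : r < ℓ) (hδ : 0 ≤ δ)
    (hδω : 2 * δ ≤ 2 * Real.pi / n) :
    ENNReal.ofReal (jumpSum n θ δ w r + n * ((2 * Real.pi / n - 2 * δ) * r)) ≤
      ENNReal.ofReal r * ∫⁻ t in Set.Ioo (θ - δ) (θ - δ + 2 * Real.pi),
        ENNReal.ofReal (areaDensity w (polarPoint r t)) := by
  have hpi := Real.two_pi_pos
  have hr' : |r| < ℓ := by rwa [abs_of_nonneg hr0]
  have hc : Continuous fun t => r * areaDensity w (polarPoint r t) := by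
    refine continuous_const.mul ?_
    rw [← continuousOn_univ]
    refine (continuousOn_areaDensity Metric.isOpen_ball hw).comp (Continuous.continuousOn ?_)
      fun t _ => polarPoint_mem_ball.2 hr'
    exact continuous_polarPoint.comp (f := fun t : ℝ => (r, t)) (by fun_prop)
  have h1 := sum_add_le_integral_period (θ := θ) (c := r) (n := n) hc hδω
    (fun t => le_mul_of_one_le_right hr0 (one_le_areaDensity w _))
    (x := fun j => ‖w (polarPoint r (θ + 2 * Real.pi / n * j + δ)) -
      w (polarPoint r (θ + 2 * Real.pi / n * j - δ))‖) fun j => by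
      refine (norm_sub_le_arc hw hr' hδ (θ + 2 * Real.pi / n * j)).trans ?_
      refine intervalIntegral.integral_mono_on (by linarith)
        ((continuous_angularDeriv hw hr').norm.intervalIntegrable _ _)
        (hc.intervalIntegrable _ _) fun t _ => ?_
      exact (norm_angular_le w _ hr0 t).trans
        (mul_le_mul_of_nonneg_left (gradNorm_le_areaDensity w _) hr0)
  rw [h.angle_mul] at h1
  refine (ENNReal.ofReal_le_ofReal h1).trans (le_of_eq ?_)
  rw [← setLIntegral_Ioo_ofReal (by linarith) hc fun t _ =>
    mul_nonneg hr0 (Real.sqrt_nonneg _), ← lintegral_const_mul' _ _ ENNReal.ofReal_ne_top]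
  exact lintegral_congr fun t => ENNReal.ofReal_mul hr0

lemma setLIntegral_length_le (hw : ContDiffOn ℝ 1 w (Metric.ball 0 ℓ)) (a : ℝ) :
    ∫⁻ r in Set.Ioo 0 ℓ, ∫⁻ t in Set.Ioo a (a + 2 * Real.pi),
      ENNReal.ofReal ‖angularDeriv w r t‖ ≤ totalVariation w (Metric.ball 0 ℓ) := by
  refine le_trans ?_ (lintegral_gradNorm_le_totalVariation hw)
  rw [setLIntegral_ball_polar (measurable_gradNorm w).ennreal_ofReal ℓ a]
  refine setLIntegral_mono' measurableSet_Ioo fun r hr => ?_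
  rw [← lintegral_const_mul' _ _ ENNReal.ofReal_ne_top]
  refine lintegral_mono fun t => ?_
  rw [← ENNReal.ofReal_mul hr.1.le]
  exact ENNReal.ofReal_le_ofReal (norm_angular_le w _ hr.1.le t)

end Circle

/-- Strict convergence passes to almost every circle: there, the lengths of the images under `v k`
have the perimeter of the polygon as their lower limit. -/
lemma ae_liminf_length_eq (h : IsJunction n θ ℓ b L κ u)
    (hv : ∀ k, ContDiffOn ℝ 1 (v k) (Metric.ball 0 ℓ))
    (hTV : Tendsto (fun k => totalVariation (v k) (Metric.ball 0 ℓ)) atTop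
      (𝓝 (ENNReal.ofReal (ℓ * (n * L))))) {δ : ℝ} (hδ : 0 ≤ δ) (hδω : 2 * δ ≤ 2 * Real.pi / n)
    (hconv : ∀ᵐ r ∂(volume.restrict (Set.Ioo 0 ℓ)),
      Tendsto (fun k => jumpSum n θ δ (v k) r) atTop (𝓝 (n * L))) :
    ∀ᵐ r ∂(volume.restrict (Set.Ioo 0 ℓ)),
      liminf (fun k => ENNReal.ofReal
        (∫ t in (θ - δ)..(θ - δ + 2 * Real.pi), ‖angularDeriv (v k) r t‖)) atTop =
        ENNReal.ofReal (n * L) := by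
  have hpi := Real.two_pi_pos
  set F : ℕ → ℝ → ℝ≥0∞ := fun k r => ∫⁻ t in Set.Ioo (θ - δ) (θ - δ + 2 * Real.pi),
    ENNReal.ofReal ‖angularDeriv (v k) r t‖ with hF
  have hFm : ∀ k, Measurable (F k) := fun k =>
    (measurable_norm_angularDeriv (v k)).ennreal_ofReal.lintegral_prod_right'
  have hFeq : ∀ k, ∀ r ∈ Set.Ioo 0 ℓ, F k r = ENNReal.ofReal
      (∫ t in (θ - δ)..(θ - δ + 2 * Real.pi), ‖angularDeriv (v k) r t‖) := fun k r hr =>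
    setLIntegral_Ioo_ofReal (by linarith)
      (continuous_angularDeriv (hv k) (by rw [abs_of_pos hr.1]; exact hr.2)).norm
      fun t _ => norm_nonneg _
  have hge : (fun _ => ENNReal.ofReal (n * L)) ≤ᵐ[volume.restrict (Set.Ioo 0 ℓ)]
      fun r => liminf (fun k => F k r) atTop := by
    filter_upwards [hconv, ae_restrict_mem measurableSet_Ioo] with r hr hrℓ
    rw [← (ENNReal.tendsto_ofReal hr).liminf_eq]
    refine liminf_le_liminf (Eventually.of_forall fun k => ?_)
    rw [hFeq k r hrℓ]
    exact ENNReal.ofReal_le_ofReal (h.jumpSum_le_length (hv k)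
      (by rw [abs_of_pos hrℓ.1]; exact hrℓ.2) hδ hδω)
  have hconst : ∫⁻ _ in Set.Ioo 0 ℓ, ENNReal.ofReal (n * L) = ENNReal.ofReal (ℓ * (n * L)) := by
    rw [setLIntegral_const, Real.volume_Ioo, sub_zero, mul_comm,
      ENNReal.ofReal_mul h.radius_pos.le]
  have hle : ∫⁻ r in Set.Ioo 0 ℓ, liminf (fun k => F k r) atTop ≤
      ∫⁻ _ in Set.Ioo 0 ℓ, ENNReal.ofReal (n * L) := by
    rw [hconst, ← hTV.liminf_eq]
    exact (lintegral_liminf_le hFm).trans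
      (liminf_le_liminf (Eventually.of_forall fun k => setLIntegral_length_le (hv k) _))
  have hae := ae_eq_of_ae_le_of_lintegral_le hge (by rw [hconst]; exact ENNReal.ofReal_ne_top)
    (Measurable.liminf hFm).aemeasurable hle
  filter_upwards [hae, ae_restrict_mem measurableSet_Ioo] with r hr hrℓ
  rw [hr]
  simp only [hFeq _ r hrℓ]

end IsJunction

lemma add_liminf_le_of_tendsto {x y : ℕ → ℝ≥0∞} {a c : ℝ≥0∞} (hx : Tendsto x atTop (𝓝 a))
    (ha : a ≠ ∞) (hxt : ∀ k, x k ≠ ∞) (h : ∀ k, x k + y k ≤ c) : a + liminf y atTop ≤ c := by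
  have h1 : liminf y atTop ≤ c - a := by
    rw [← (ENNReal.Tendsto.sub (tendsto_const_nhds (x := c)) hx (Or.inr ha)).liminf_eq]
    exact liminf_le_liminf (Eventually.of_forall fun k =>
      ENNReal.le_sub_of_add_le_left (hxt k) (h k))
  have h2 : a ≤ c := le_of_tendsto hx (Eventually.of_forall fun k => le_self_add.trans (h k))
  calc a + liminf y atTop ≤ a + (c - a) := by gcongr
    _ = c := add_tsub_cancel_of_le h2

/-- Splitting of the graph area along a circle. -/
lemma ofReal_add_le_graphArea {v : Plane → Plane} {ℓ : ℝ} (hv : ContDiffOn ℝ 1 v (Metric.ball 0 ℓ))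
    {s : ℝ} (hs0 : 0 < s) (hs : s < ℓ) (a : ℝ) :
    ENNReal.ofReal (|circleCross v a s| / 2) +
      ∫⁻ r in Set.Ioo s ℓ, ENNReal.ofReal r * ∫⁻ t in Set.Ioo a (a + 2 * Real.pi),
        ENNReal.ofReal (areaDensity v (polarPoint r t)) ≤ graphArea v (Metric.ball 0 ℓ) := by
  have hm := (measurable_areaDensity v).ennreal_ofReal
  have h1 : ENNReal.ofReal (|circleCross v a s| / 2) ≤ ∫⁻ r in Set.Ioo 0 s, ENNReal.ofReal r *
      ∫⁻ t in Set.Ioo a (a + 2 * Real.pi), ENNReal.ofReal (areaDensity v (polarPoint r t)) := by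
    rw [← setLIntegral_ball_polar hm s a]
    exact (ofReal_abs_circleCross_le hv a hs0.le hs).trans
      (lintegral_mono fun x => ENNReal.ofReal_le_ofReal (abs_jacobianDet_le_areaDensity v x))
  rw [graphArea_eq, setLIntegral_ball_polar hm ℓ a]
  refine (add_le_add_left h1 _).trans ?_
  rw [← lintegral_union measurableSet_Ioo]
  · exact lintegral_mono_set (Set.union_subset (Set.Ioo_subset_Ioo_right hs.le)
      (Set.Ioo_subset_Ioo_left hs0.le))
  · exact Set.disjoint_left.2 fun x hx hx' => (lt_asymm hx.2 hx'.1).elim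

namespace IsJunction

variable {n : ℕ} {θ ℓ : ℝ} {b : ℤ → Plane} {L κ : ℝ} {u : Plane → Plane} {v : ℕ → Plane → Plane}

/-- On a circle where the lengths converge along a subsequence, so do the swept areas. -/
lemma exists_subseq_circleCross (h : IsJunction n θ ℓ b L κ u)
    (hv : ∀ k, ContDiffOn ℝ 1 (v k) (Metric.ball 0 ℓ)) {δ : ℝ} (hδ : 0 ≤ δ)
    (hδω : 2 * δ ≤ 2 * Real.pi / n) {s : ℝ} (hs0 : 0 < s) (hs : s < ℓ)
    (hconv : ∀ m : ℤ,
        Tendsto (fun k => v k (polarPoint s (θ + 2 * Real.pi / n * m + δ))) atTop (𝓝 (b m)) ∧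
        Tendsto (fun k => v k (polarPoint s (θ + 2 * Real.pi / n * m - δ))) atTop
          (𝓝 (b (m - 1))))
    (hlen : liminf (fun k => ENNReal.ofReal
        (∫ t in (θ - δ)..(θ - δ + 2 * Real.pi), ‖angularDeriv (v k) s t‖)) atTop =
        ENNReal.ofReal (n * L)) :
    ∃ φ : ℕ → ℕ, StrictMono φ ∧
      Tendsto (fun k => circleCross (v (φ k)) (θ - δ) s) atTop (𝓝 (n * κ)) := by
  have hL := h.length_pos
  have hω := h.angle_pos
  have hs' : |s| < ℓ := by rwa [abs_of_pos hs0]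
  have hfreq : ∀ m : ℕ, ∃ᶠ k in atTop, ENNReal.ofReal
      (∫ t in (θ - δ)..(θ - δ + 2 * Real.pi), ‖angularDeriv (v k) s t‖) <
      ENNReal.ofReal (n * L + 1 / (m + 1 : ℝ)) := by
    intro m
    refine frequently_lt_of_liminf_lt (by isBoundedDefault) ?_
    rw [hlen, ENNReal.ofReal_lt_ofReal_iff (by positivity)]
    have : (0 : ℝ) < 1 / (m + 1) := by positivity
    linarith
  obtain ⟨φ, hφ, hφlt⟩ := extraction_forall_of_frequently hfreq
  refine ⟨φ, hφ, ?_⟩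
  have hlim : Tendsto (fun k => ∫ t in (θ - δ)..(θ - δ + 2 * Real.pi),
      ‖angularDeriv (v (φ k)) s t‖) atTop (𝓝 (n * L)) := by
    refine tendsto_of_tendsto_of_tendsto_of_le_of_le
      ((h.tendsto_jumpSum hconv).comp hφ.tendsto_atTop)
      (h := fun k : ℕ => n * L + 1 / (k + 1 : ℝ)) ?_
      (fun k => h.jumpSum_le_length (hv (φ k)) hs' hδ hδω) (fun k => ?_)
    · simpa using tendsto_one_div_add_atTop_nhds_zero_nat.const_add (n * L)
    · exact ((ENNReal.ofReal_lt_ofReal_iff (by positivity)).1 (hφlt k)).le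
  have hτ : Monotone fun j : ℕ => θ - δ + 2 * Real.pi / n * j := fun i j hij => by
    dsimp only; gcongr
  have hnorm : ∀ j : ℕ, ‖b (((j + 1 : ℕ) : ℤ) - 1) - b ((j : ℤ) - 1)‖ = L := fun j => by
    have := h.norm_sub ((j : ℤ) - 1)
    rw [sub_add_cancel] at this
    rw [← this]
    push_cast
    rw [add_sub_cancel_right]
  have hcross : ∀ j : ℕ, cross (b ((j : ℤ) - 1)) (b (((j + 1 : ℕ) : ℤ) - 1)) = κ := fun j => by
    have := h.cross_eq ((j : ℤ) - 1)
    rw [sub_add_cancel] at this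
    rw [← this]
    push_cast
    rw [add_sub_cancel_right]
  have hpoly := tendsto_integral_cross_polygon (w := fun k t => v (φ k) (polarPoint s t))
    (w' := fun k => angularDeriv (v (φ k)) s) hτ (c := fun j => b ((j : ℤ) - 1)) (n := n)
    (fun k => hasDerivAt_angle ((hv (φ k)).differentiableOn one_ne_zero) hs')
    (fun k => continuous_angularDeriv (hv (φ k)) hs')
    (fun j he => by
      have h1 := hnorm j
      rw [← he, sub_self, norm_zero] at h1
      exact hL.ne h1)
    (fun j => by
      have h1 := ((hconv j).2).comp hφ.tendsto_atTop
      have e : θ - δ + 2 * Real.pi / n * j = θ + 2 * Real.pi / n * (j : ℤ) - δ := by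
        push_cast; ring
      rw [e]
      exact h1)
    (by
      simp only [hnorm, Finset.sum_const, Finset.card_range, nsmul_eq_mul, Nat.cast_zero, mul_zero,
        add_zero, h.angle_mul]
      exact hlim)
  simp only [hcross, Finset.sum_const, Finset.card_range, nsmul_eq_mul, Nat.cast_zero, mul_zero,
    add_zero, h.angle_mul] at hpoly
  exact hpoly

/-- The three contributions to the area: the polygon swept inside a good circle, the jumps at the
interfaces, and the area of the domain away from the interfaces. -/
lemma area_lower_bound_of_good_circle (h : IsJunction n θ ℓ b L κ u)
    (hv : ∀ k, ContDiffOn ℝ 1 (v k) (Metric.ball 0 ℓ)) {δ : ℝ} (hδ : 0 ≤ δ)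
    (hδω : 2 * δ ≤ 2 * Real.pi / n)
    (hae : ∀ᵐ r ∂(volume.restrict (Set.Ioo 0 ℓ)),
      Tendsto (fun k => jumpSum n θ δ (v k) r) atTop (𝓝 (n * L)))
    {s : ℝ} (hs0 : 0 < s) (hs : s < ℓ)
    (hconv : ∀ m : ℤ,
        Tendsto (fun k => v k (polarPoint s (θ + 2 * Real.pi / n * m + δ))) atTop (𝓝 (b m)) ∧
        Tendsto (fun k => v k (polarPoint s (θ + 2 * Real.pi / n * m - δ))) atTop
          (𝓝 (b (m - 1))))
    (hlen : liminf (fun k => ENNReal.ofReal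
        (∫ t in (θ - δ)..(θ - δ + 2 * Real.pi), ‖angularDeriv (v k) s t‖)) atTop =
        ENNReal.ofReal (n * L))
    {c : ℝ≥0∞} (hc : ∀ k, graphArea (v k) (Metric.ball 0 ℓ) ≤ c) :
    ENNReal.ofReal (1 / 2 * (n * |κ|)) + ENNReal.ofReal (n * L * (ℓ - s) +
      (2 * Real.pi - 2 * n * δ) * ((ℓ ^ 2 - s ^ 2) / 2)) ≤ c := by
  have hL := h.length_pos
  obtain ⟨φ, hφ, hφc⟩ := h.exists_subseq_circleCross hv hδ hδω hs0 hs hconv hlen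
  set A : ℕ → ℝ → ℝ≥0∞ := fun k r => ENNReal.ofReal r *
    ∫⁻ t in Set.Ioo (θ - δ) (θ - δ + 2 * Real.pi),
      ENNReal.ofReal (areaDensity (v (φ k)) (polarPoint r t)) with hA
  have hAm : ∀ k, Measurable (A k) := fun k => by
    refine measurable_id.ennreal_ofReal.mul (Measurable.lintegral_prod_right'
      (f := fun p : ℝ × ℝ => ENNReal.ofReal (areaDensity (v (φ k)) (polarPoint p.1 p.2))) ?_)
    exact (measurable_areaDensity _).ennreal_ofReal.comp continuous_polarPoint.measurable
  have hx : Tendsto (fun k => ENNReal.ofReal (|circleCross (v (φ k)) (θ - δ) s| / 2)) atTop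
      (𝓝 (ENNReal.ofReal (1 / 2 * (n * |κ|)))) := by
    have e : 1 / 2 * (n * |κ|) = |n * κ| / 2 := by
      rw [abs_mul, Nat.abs_cast]; ring
    rw [e]
    exact ENNReal.tendsto_ofReal (hφc.abs.div_const 2)
  have hsum := add_liminf_le_of_tendsto (y := fun k => ∫⁻ r in Set.Ioo s ℓ, A k r) hx
    ENNReal.ofReal_ne_top (fun k => ENNReal.ofReal_ne_top) fun k =>
    (ofReal_add_le_graphArea (hv (φ k)) hs0 hs (θ - δ)).trans (hc (φ k))
  refine le_trans ?_ hsum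
  gcongr
  refine le_trans ?_ (lintegral_liminf_le hAm)
  have hcont : Continuous fun r : ℝ => n * L + n * ((2 * Real.pi / n - 2 * δ) * r) := by fun_prop
  have hnn : 0 ≤ 2 * Real.pi / n - 2 * δ := by linarith
  have hint : ∫ r in s..ℓ, (n * L + n * ((2 * Real.pi / n - 2 * δ) * r)) =
      n * L * (ℓ - s) + (2 * Real.pi - 2 * n * δ) * ((ℓ ^ 2 - s ^ 2) / 2) := by
    rw [intervalIntegral.integral_add (by simp) ((by fun_prop : Continuous fun r : ℝ =>
      n * ((2 * Real.pi / n - 2 * δ) * r)).intervalIntegrable _ _),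
      intervalIntegral.integral_const, intervalIntegral.integral_const_mul,
      intervalIntegral.integral_const_mul, integral_id, smul_eq_mul]
    linear_combination ((ℓ ^ 2 - s ^ 2) / 2) * h.angle_mul
  rw [← hint, ← setLIntegral_Ioo_ofReal hs.le hcont fun r hr => by
    have := hs0.trans hr.1
    positivity]
  have hae' : ∀ᵐ r ∂(volume.restrict (Set.Ioo s ℓ)),
      Tendsto (fun k => jumpSum n θ δ (v k) r) atTop (𝓝 (n * L)) :=
    ae_restrict_of_ae_restrict_of_subset (Set.Ioo_subset_Ioo_left hs0.le) hae
  refine lintegral_mono_ae ?_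
  filter_upwards [hae', ae_restrict_mem measurableSet_Ioo] with r hr hrs
  have hlim := ENNReal.tendsto_ofReal
    ((hr.comp hφ.tendsto_atTop).add_const (n * ((2 * Real.pi / n - 2 * δ) * r)))
  rw [← hlim.liminf_eq]
  exact liminf_le_liminf (Eventually.of_forall fun k =>
    h.jumpSum_add_le_area (hv (φ k)) (hs0.trans hrs.1).le hrs.2 hδ hδω)

/-- The lower bound along a sequence that converges almost everywhere, by letting the good circle and
the neighbourhoods of the interfaces shrink. -/
lemma le_of_forall_graphArea_le (h : IsJunction n θ ℓ b L κ u)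
    (hv : ∀ k, ContDiffOn ℝ 1 (v k) (Metric.ball 0 ℓ))
    (hconv : ∀ᵐ x ∂(volume.restrict (Metric.ball (0 : Plane) ℓ)),
      Tendsto (fun k => v k x) atTop (𝓝 (u x)))
    (hTV : Tendsto (fun k => totalVariation (v k) (Metric.ball 0 ℓ)) atTop
      (𝓝 (ENNReal.ofReal (ℓ * (n * L)))))
    {c : ℝ≥0∞} (hc : ∀ k, graphArea (v k) (Metric.ball 0 ℓ) ≤ c) :
    ENNReal.ofReal (1 / 2 * (n * |κ|)) + ENNReal.ofReal (n * L * ℓ + Real.pi * ℓ ^ 2) ≤ c := by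
  have hL := h.length_pos
  have hℓ := h.radius_pos
  have hn : (0 : ℝ) < n := Nat.cast_pos.2 h.n_pos
  have hpi := Real.pi_pos
  have key : ∀ η : ℝ, 0 < η → η < ℓ → n * η < Real.pi →
      ENNReal.ofReal (1 / 2 * (n * |κ|)) + ENNReal.ofReal (n * L * (ℓ - η) +
        (2 * Real.pi - 2 * n * η) * ((ℓ ^ 2 - η ^ 2) / 2)) ≤ c := by
    intro η hη hηℓ hηn
    obtain ⟨δ, hδ0, hδη, hδω, hgood⟩ := h.exists_good_angle hconv hη
    have hjump : ∀ᵐ r ∂(volume.restrict (Set.Ioo 0 ℓ)),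
        Tendsto (fun k => jumpSum n θ δ (v k) r) atTop (𝓝 (n * L)) := by
      filter_upwards [hgood] with r hr using h.tendsto_jumpSum hr
    have hlen := h.ae_liminf_length_eq hv hTV hδ0.le hδω.le hjump
    have hne : (ae (volume.restrict (Set.Ioo 0 η))).NeBot := by
      rw [ae_restrict_neBot, Real.volume_Ioo, sub_zero]
      exact (ENNReal.ofReal_pos.2 hη).ne'
    have hsub : Set.Ioo 0 η ⊆ Set.Ioo 0 ℓ := Set.Ioo_subset_Ioo_right hηℓ.le
    obtain ⟨s, hs, hs1, hs2⟩ := ((ae_restrict_mem (μ := volume)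
      (measurableSet_Ioo (a := (0 : ℝ)) (b := η))).and
      ((ae_restrict_of_ae_restrict_of_subset hsub hgood).and
        (ae_restrict_of_ae_restrict_of_subset hsub hlen))).exists
    refine le_trans ?_ (h.area_lower_bound_of_good_circle hv hδ0.le hδω.le hjump hs.1
      (hs.2.trans hηℓ) hs1 hs2 hc)
    have h1 : n * L * (ℓ - η) ≤ n * L * (ℓ - s) :=
      mul_le_mul_of_nonneg_left (by linarith [hs.2]) (by positivity)
    have h2 : (n : ℝ) * δ ≤ n * η := mul_le_mul_of_nonneg_left hδη.le hn.le
    have h3 : s ^ 2 ≤ η ^ 2 := pow_le_pow_left₀ hs.1.le hs.2.le 2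
    have h4 : η ^ 2 ≤ ℓ ^ 2 := pow_le_pow_left₀ hη.le hηℓ.le 2
    have h5 : (2 * Real.pi - 2 * n * η) * ((ℓ ^ 2 - η ^ 2) / 2) ≤
        (2 * Real.pi - 2 * n * δ) * ((ℓ ^ 2 - s ^ 2) / 2) :=
      mul_le_mul (by linarith) (by linarith) (by linarith) (by linarith)
    exact add_le_add le_rfl (ENNReal.ofReal_le_ofReal (add_le_add h1 h5))
  have hlim : Tendsto (fun η : ℝ => ENNReal.ofReal (1 / 2 * (n * |κ|)) +
      ENNReal.ofReal (n * L * (ℓ - η) + (2 * Real.pi - 2 * n * η) * ((ℓ ^ 2 - η ^ 2) / 2)))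
      (𝓝[>] 0) (𝓝 (ENNReal.ofReal (1 / 2 * (n * |κ|)) +
        ENNReal.ofReal (n * L * ℓ + Real.pi * ℓ ^ 2))) := by
    refine Tendsto.const_add _ (ENNReal.tendsto_ofReal (tendsto_nhdsWithin_of_tendsto_nhds ?_))
    have hcont : Continuous fun η : ℝ => n * L * (ℓ - η) +
      (2 * Real.pi - 2 * n * η) * ((ℓ ^ 2 - η ^ 2) / 2) := by fun_prop
    have := hcont.tendsto 0
    convert this using 2
    ring
  refine le_of_tendsto hlim ?_
  have hpos : 0 < min ℓ (Real.pi / n) := lt_min hℓ (by positivity)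
  filter_upwards [Ioo_mem_nhdsGT hpos] with η hη
  refine key η hη.1 (hη.2.trans_le (min_le_left _ _)) ?_
  have := hη.2.trans_le (min_le_right _ _)
  rw [lt_div_iff₀ hn] at this
  linarith

/-- The lower bound for the relaxed area. If it failed, a strictly convergent sequence would have a
subsequence of uniformly smaller area that converges almost everywhere. -/
lemma le_relaxedAreaBV (h : IsJunction n θ ℓ b L κ u) :
    volume (Metric.ball (0 : Plane) ℓ) + ENNReal.ofReal (ℓ * (n * L)) +
      ENNReal.ofReal (1 / 2 * (n * |κ|)) ≤ relaxedAreaBV u (Metric.ball 0 ℓ) := by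
  have hL := h.length_pos
  have hℓ := h.radius_pos
  have hpi := Real.pi_pos
  have htarget : volume (Metric.ball (0 : Plane) ℓ) + ENNReal.ofReal (ℓ * (n * L)) +
      ENNReal.ofReal (1 / 2 * (n * |κ|)) = ENNReal.ofReal (1 / 2 * (n * |κ|)) +
        ENNReal.ofReal (n * L * ℓ + Real.pi * ℓ ^ 2) := by
    rw [EuclideanSpace.volume_ball_fin_two, ← ENNReal.ofReal_pow hℓ.le,
      ← ENNReal.ofReal_mul (by positivity), add_comm,
      ← ENNReal.ofReal_add (by positivity) (by positivity)]
    congr 2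
    ring
  rw [htarget]
  refine le_iInf fun v => le_iInf fun hv => le_iInf fun hS => ?_
  by_contra! hlt
  obtain ⟨c, hc1, hc2⟩ := exists_between hlt
  obtain ⟨φ, hφ, hφc⟩ := extraction_of_frequently_atTop
    (frequently_lt_of_liminf_lt (by isBoundedDefault) hc1)
  have hmeas : TendstoInMeasure (volume.restrict (Metric.ball 0 ℓ)) (fun k => v (φ k)) atTop u :=
    tendstoInMeasure_of_tendsto_eLpNorm one_ne_zero
      (fun k => (hS.memBV_seq (φ k)).1.aestronglyMeasurable)
      hS.memBV_limit.1.aestronglyMeasurable (hS.tendsto_L1.comp hφ.tendsto_atTop)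
  obtain ⟨ψ, hψ, hψae⟩ := hmeas.exists_seq_tendsto_ae
  refine absurd hc2 (not_lt.2 (h.le_of_forall_graphArea_le (v := fun k => v (φ (ψ k)))
    (fun k => hv _) hψae ?_ fun k => (hφc (ψ k)).le))
  rw [← h.totalVariation_eq]
  exact hS.tendsto_variation.comp (hφ.tendsto_atTop.comp hψ.tendsto_atTop)

lemma relaxedAreaBV_eq (h : IsJunction n θ ℓ b L κ u) :
    relaxedAreaBV u (Metric.ball 0 ℓ) = volume (Metric.ball (0 : Plane) ℓ) +
      totalVariation u (Metric.ball 0 ℓ) + ENNReal.ofReal (1 / 2 * (n * |κ|)) := by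
  rw [h.totalVariation_eq]
  exact le_antisymm (h.relaxedAreaBV_le h.totalVariation_eq) h.le_relaxedAreaBV

end IsJunction

/-! ### Regular polygons -/

lemma norm_sub_polarPoint (p q : ℝ) :
    ‖polarPoint 1 p - polarPoint 1 q‖ = 2 * |Real.sin ((p - q) / 2)| := by
  rw [← sq_eq_sq₀ (norm_nonneg _) (by positivity), norm_sq_plane, mul_pow, sq_abs,
    Real.sin_sq_eq_half_sub, mul_div_cancel₀ _ two_ne_zero, Real.cos_sub]
  simp only [PiLp.sub_apply, polarPoint_zero_coord, polarPoint_one_coord]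
  linear_combination Real.cos_sq_add_sin_sq p + Real.cos_sq_add_sin_sq q

lemma norm_add_polarPoint (p q : ℝ) :
    ‖polarPoint 1 p + polarPoint 1 q‖ = 2 * |Real.cos ((p - q) / 2)| := by
  rw [← sq_eq_sq₀ (norm_nonneg _) (by positivity), norm_sq_plane, mul_pow, sq_abs,
    Real.cos_sq, mul_div_cancel₀ _ two_ne_zero, Real.cos_sub]
  simp only [PiLp.add_apply, polarPoint_zero_coord, polarPoint_one_coord]
  linear_combination Real.cos_sq_add_sin_sq p + Real.cos_sq_add_sin_sq q

lemma cross_polarPoint (p q : ℝ) :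
    cross (polarPoint 1 p) (polarPoint 1 q) = Real.sin (q - p) := by
  rw [cross, Real.sin_sub]
  simp only [polarPoint_zero_coord, polarPoint_one_coord]
  ring

/-- The foot of the perpendicular from the origin to a chord of a circle is the midpoint. -/
lemma infDist_zero_chord {x y : Plane} (h : ‖x‖ = ‖y‖) :
    Metric.infDist 0 (affineSpan ℝ {x, y} : Set Plane) = ‖x + y‖ / 2 := by
  have hmid : midpoint ℝ x y = (2⁻¹ : ℝ) • (x + y) := by simp [midpoint_eq_smul_add]
  have hmem : midpoint ℝ x y ∈ (affineSpan ℝ {x, y} : Set Plane) :=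
    AffineMap.lineMap_mem_affineSpan_pair _ _ _
  have hn : ‖midpoint ℝ x y‖ = ‖x + y‖ / 2 := by
    rw [hmid, norm_smul, Real.norm_of_nonneg (by positivity)]
    ring
  refine le_antisymm ?_ ((Metric.le_infDist ⟨_, hmem⟩).2 fun z hz => ?_)
  · refine (Metric.infDist_le_dist_of_mem hmem).trans_eq ?_
    rw [dist_zero_left, hn]
  · obtain ⟨c, rfl⟩ := mem_affineSpan_pair_iff_exists_lineMap_eq.1 hz
    rw [dist_zero_left, ← hn, ← sq_le_sq₀ (norm_nonneg _) (norm_nonneg _), hmid]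
    have h2 : ‖x‖ ^ 2 = ‖y‖ ^ 2 := by rw [h]
    rw [norm_sq_plane, norm_sq_plane] at h2 ⊢
    simp only [AffineMap.lineMap_apply, vsub_eq_sub, vadd_eq_add, PiLp.add_apply, PiLp.smul_apply,
      PiLp.sub_apply, smul_eq_mul]
    -- By Pythagoras, the difference of the two sides is `(c - 1/2)² ‖y - x‖²`.
    have h3 := congrArg (fun z => (c - 1 / 2) * z) h2
    simp only at h3
    linarith [sq_nonneg ((c - 1 / 2) * (y 0 - x 0)), sq_nonneg ((c - 1 / 2) * (y 1 - x 1))]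

/-- The vertices of the regular `n`-gon inscribed in the unit circle with a vertex at angle `φ`,
numbered by the integers, so that each vertex occurs infinitely often. -/
noncomputable def regularVertex (n : ℕ) (φ : ℝ) (m : ℤ) : Plane :=
  polarPoint 1 (φ + 2 * Real.pi / n * m)

section RegularPolygon

variable {n : ℕ} {φ : ℝ}

/-- No vertex of a regular polygon lies beyond the line carrying a side. -/
lemma cos_vertex_le (hn : 3 ≤ n) (j : ℤ) :
    Real.cos (2 * Real.pi / n * (j - 1 / 2)) ≤ Real.cos (Real.pi / n) := by
  have hn0 : (0 : ℝ) < n := by positivity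
  have hpi := Real.pi_pos
  -- Modulo `n` the angle is `-π/n`, or lies between `π/n` and `2π - π/n`.
  obtain ⟨q, i, hi0, hin, rfl⟩ : ∃ q i : ℤ, 0 ≤ i ∧ i < n ∧ j = i + n * q :=
    ⟨j / n, j % n, Int.emod_nonneg _ (by omega), Int.emod_lt_of_pos _ (by omega),
      (Int.emod_add_mul_ediv j n).symm⟩
  have e : 2 * Real.pi / n * (((i + n * q : ℤ) : ℝ) - 1 / 2) =
      2 * Real.pi / n * (i - 1 / 2) + q * (2 * Real.pi) := by
    push_cast
    field_simp
    ring
  rw [e, Real.cos_add_int_mul_two_pi]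
  rcases hi0.eq_or_lt with rfl | hi1
  · refine le_of_eq ?_
    rw [← Real.cos_neg]
    congr 1
    push_cast
    ring
  · have h1 : (1 : ℝ) ≤ i := by exact_mod_cast hi1
    have h2 : (i : ℝ) + 1 ≤ n := by exact_mod_cast hin
    have hc : 0 < Real.pi / n := by positivity
    have h3 : Real.pi / n * n = Real.pi := div_mul_cancel₀ _ hn0.ne'
    have h4 : Real.pi / n * 1 ≤ Real.pi / n * i := mul_le_mul_of_nonneg_left h1 hc.le
    have h5 : Real.pi / n * (i + 1) ≤ Real.pi / n * n := mul_le_mul_of_nonneg_left h2 hc.le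
    have e2 : 2 * Real.pi / n * ((i : ℝ) - 1 / 2) = 2 * (Real.pi / n * i) - Real.pi / n := by ring
    rw [e2]
    rcases le_total (2 * (Real.pi / n * i) - Real.pi / n) Real.pi with h | h
    · exact Real.cos_le_cos_of_nonneg_of_le_pi hc.le h (by linarith)
    · rw [← Real.cos_two_pi_sub]
      exact Real.cos_le_cos_of_nonneg_of_le_pi hc.le (by linarith) (by linarith)

lemma cos_pi_div_pos (hn : 3 ≤ n) : 0 < Real.cos (Real.pi / n) := by
  have hn' : (3 : ℝ) ≤ n := by exact_mod_cast hn
  have hpi := Real.pi_pos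
  refine Real.cos_pos_of_mem_Ioo ⟨?_, ?_⟩
  · have : 0 < Real.pi / n := by positivity
    linarith
  · rw [div_lt_div_iff₀ (by linarith) two_pos]
    nlinarith

lemma sin_pi_div_pos (hn : 3 ≤ n) : 0 < Real.sin (Real.pi / n) := by
  have hn' : (3 : ℝ) ≤ n := by exact_mod_cast hn
  refine Real.sin_pos_of_pos_of_lt_pi (by positivity) (div_lt_self Real.pi_pos (by linarith))

/-- The regular polygon lies on one side of the line carrying a side. -/
lemma convexHull_regularVertex_subset (hn : 3 ≤ n) (φ : ℝ) (m : ℤ) :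
    convexHull ℝ (Set.range (regularVertex n φ)) ⊆
      {x | Real.cos (φ + 2 * Real.pi / n * (m + 1 / 2)) * x 0 +
        Real.sin (φ + 2 * Real.pi / n * (m + 1 / 2)) * x 1 ≤ Real.cos (Real.pi / n)} := by
  refine convexHull_min ?_ ?_
  · rintro _ ⟨k, rfl⟩
    have h := cos_vertex_le hn (k - m)
    have e : 2 * Real.pi / n * (((k - m : ℤ) : ℝ) - 1 / 2) =
        (φ + 2 * Real.pi / n * k) - (φ + 2 * Real.pi / n * (m + 1 / 2)) := by
      push_cast; ring
    rw [e, Real.cos_sub] at h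
    simp only [Set.mem_ofPred_eq, regularVertex, polarPoint_zero_coord, polarPoint_one_coord]
    linarith
  · refine convex_halfSpace_le (f := fun x : Plane => _ * x 0 + _ * x 1) ⟨fun x y => ?_,
      fun c x => ?_⟩ _
    · simp only [PiLp.add_apply]; ring
    · simp only [PiLp.smul_apply, smul_eq_mul]; ring

/-- The centroid of the vertices is the origin: multiplied by `2 sin (π/n)`, the sums of their
coordinates telescope. -/
lemma zero_mem_convexHull_regularVertex (hn : 3 ≤ n) (φ : ℝ) :
    (0 : Plane) ∈ convexHull ℝ (Set.range (regularVertex n φ)) := by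
  have hs := sin_pi_div_pos hn
  have hn0 : (0 : ℝ) < n := by positivity
  have e : ∀ k : ℕ, φ + 2 * Real.pi / n * (k + 1 : ℕ) - Real.pi / n =
      φ + 2 * Real.pi / n * k + Real.pi / n := fun k => by push_cast; ring
  have e' : φ + 2 * Real.pi / n * n - Real.pi / n = φ - Real.pi / n + 2 * Real.pi := by
    field_simp
    ring
  have hcos : ∑ k ∈ Finset.range n, Real.cos (φ + 2 * Real.pi / n * k) = 0 := by
    have h := Finset.sum_range_sub
      (fun k : ℕ => Real.sin (φ + 2 * Real.pi / n * k - Real.pi / n)) n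
    simp only [e, e', Real.sin_add_two_pi, Nat.cast_zero, mul_zero, add_zero, sub_self] at h
    have h2 : ∀ k : ℕ, Real.sin (φ + 2 * Real.pi / n * k + Real.pi / n) -
        Real.sin (φ + 2 * Real.pi / n * k - Real.pi / n) =
        2 * Real.sin (Real.pi / n) * Real.cos (φ + 2 * Real.pi / n * k) := fun k => by
      rw [Real.sin_add, Real.sin_sub]; ring
    rw [Finset.sum_congr rfl fun k _ => h2 k, ← Finset.mul_sum] at h
    exact (mul_eq_zero.1 h).resolve_left (by positivity)
  have hsin : ∑ k ∈ Finset.range n, Real.sin (φ + 2 * Real.pi / n * k) = 0 := by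
    have h := Finset.sum_range_sub
      (fun k : ℕ => -Real.cos (φ + 2 * Real.pi / n * k - Real.pi / n)) n
    simp only [e, e', Real.cos_add_two_pi, Nat.cast_zero, mul_zero, add_zero, sub_self] at h
    have h2 : ∀ k : ℕ, -Real.cos (φ + 2 * Real.pi / n * k + Real.pi / n) -
        -Real.cos (φ + 2 * Real.pi / n * k - Real.pi / n) =
        2 * Real.sin (Real.pi / n) * Real.sin (φ + 2 * Real.pi / n * k) := fun k => by
      rw [Real.cos_add, Real.cos_sub]; ring
    rw [Finset.sum_congr rfl fun k _ => h2 k, ← Finset.mul_sum] at h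
    exact (mul_eq_zero.1 h).resolve_left (by positivity)
  have hmem := (convex_convexHull ℝ (Set.range (regularVertex n φ))).sum_mem
    (t := Finset.range n) (w := fun _ => (n : ℝ)⁻¹) (z := fun k : ℕ => regularVertex n φ k)
    (fun _ _ => by positivity) (by simp [hn0.ne'])
    fun k _ => subset_convexHull _ _ (Set.mem_range_self _)
  rw [← Finset.smul_sum] at hmem
  convert hmem
  ext i
  fin_cases i <;> simp [regularVertex, hcos, hsin]

/-- The triangle with vertices at the origin and at two consecutive vertices of the polygon, in
polar coordinates. -/
lemma polarPoint_mem_convexHull_iff (hn : 3 ≤ n) (m : ℤ) {r t : ℝ} (hr : 0 ≤ r)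
    (h1 : φ + 2 * Real.pi / n * m ≤ t) (h2 : t ≤ φ + 2 * Real.pi / n * (m + 1)) :
    polarPoint r t ∈ convexHull ℝ (Set.range (regularVertex n φ)) ↔
      r * Real.cos (t - (φ + 2 * Real.pi / n * (m + 1 / 2))) ≤ Real.cos (Real.pi / n) := by
  constructor
  · intro h
    have := convexHull_regularVertex_subset hn φ m h
    simp only [Set.mem_ofPred_eq, polarPoint_zero_coord, polarPoint_one_coord] at this
    rw [Real.cos_sub]
    linarith
  intro h
  have hn3 : (3 : ℝ) ≤ n := by exact_mod_cast hn
  have hpi := Real.pi_pos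
  have hs := sin_pi_div_pos hn
  have hc := cos_pi_div_pos hn
  have hω : 2 * Real.pi / n = 2 * (Real.pi / n) := by ring
  have hωπ : 2 * (Real.pi / n) < Real.pi := by
    rw [← hω, div_lt_iff₀ (by linarith)]
    nlinarith
  have hsω : 0 < Real.sin (2 * (Real.pi / n)) := by
    rw [Real.sin_two_mul]; positivity
  obtain ⟨τ, rfl⟩ : ∃ τ, t = φ + 2 * Real.pi / n * m + τ := ⟨_, (add_sub_cancel _ _).symm⟩
  set p := φ + 2 * Real.pi / n * m with hp
  have hp1 : φ + 2 * Real.pi / n * (m + 1) = p + 2 * (Real.pi / n) := by rw [hp]; ring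
  have hp2 : φ + 2 * Real.pi / n * (m + 1 / 2) = p + Real.pi / n := by rw [hp]; ring
  rw [hp1] at h2
  rw [hp2] at h
  set γ := Real.pi / n
  have hτ0 : 0 ≤ Real.sin τ := Real.sin_nonneg_of_nonneg_of_le_pi (by linarith) (by linarith)
  have hτ1 : 0 ≤ Real.sin (2 * γ - τ) :=
    Real.sin_nonneg_of_nonneg_of_le_pi (by linarith) (by linarith)
  have hsum : r * Real.sin (2 * γ - τ) / Real.sin (2 * γ) + r * Real.sin τ / Real.sin (2 * γ) ≤
      1 := by
    rw [← add_div, div_le_one hsω]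
    have e1 : Real.sin (2 * γ - τ) + Real.sin τ = 2 * Real.sin γ * Real.cos (τ - γ) := by
      have e2 : 2 * γ - τ = γ - (τ - γ) := by ring
      have e3 : Real.sin τ = Real.sin (γ + (τ - γ)) := by rw [add_sub_cancel]
      rw [e2, e3, Real.sin_sub, Real.sin_add]
      ring
    have e4 : p + τ - (p + γ) = τ - γ := by ring
    rw [e4] at h
    calc r * Real.sin (2 * γ - τ) + r * Real.sin τ
        = 2 * Real.sin γ * (r * Real.cos (τ - γ)) := by linear_combination r * e1
      _ ≤ 2 * Real.sin γ * Real.cos γ := by gcongr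
      _ = Real.sin (2 * γ) := (Real.sin_two_mul γ).symm
  have hmem := (convex_convexHull ℝ (Set.range (regularVertex n φ))).sum_mem
    (t := Finset.univ) (w := ![r * Real.sin (2 * γ - τ) / Real.sin (2 * γ),
      r * Real.sin τ / Real.sin (2 * γ), 1 - (r * Real.sin (2 * γ - τ) / Real.sin (2 * γ) +
        r * Real.sin τ / Real.sin (2 * γ))])
    (z := ![regularVertex n φ m, regularVertex n φ (m + 1), 0])
    (by
      intro i _
      fin_cases i
      · exact div_nonneg (mul_nonneg hr hτ1) hsω.le
      · exact div_nonneg (mul_nonneg hr hτ0) hsω.le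
      · exact sub_nonneg.2 hsum)
    (by simp [Fin.sum_univ_three])
    (by
      intro i _
      fin_cases i
      · exact subset_convexHull _ _ (Set.mem_range_self _)
      · exact subset_convexHull _ _ (Set.mem_range_self _)
      · exact zero_mem_convexHull_regularVertex hn φ)
  convert hmem
  have ev : regularVertex n φ (m + 1) = polarPoint 1 (p + 2 * γ) := by
    rw [regularVertex]; push_cast; rw [hp1]
  have ev' : regularVertex n φ m = polarPoint 1 p := rfl
  have e5 : Real.sin (2 * γ - τ) = Real.sin (2 * γ) * Real.cos τ - Real.cos (2 * γ) * Real.sin τ :=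
    Real.sin_sub _ _
  ext i
  fin_cases i
  · simp only [Fin.sum_univ_three, ev, ev', Fin.zero_eta, PiLp.add_apply, PiLp.smul_apply,
      Matrix.cons_val_zero, Matrix.cons_val_one, Matrix.cons_val, polarPoint_zero_coord,
      smul_eq_mul, PiLp.zero_apply, Real.cos_add p, e5]
    field_simp
    ring
  · simp only [Fin.sum_univ_three, ev, ev', Fin.mk_one, PiLp.add_apply, PiLp.smul_apply,
      Matrix.cons_val_zero, Matrix.cons_val_one, Matrix.cons_val, polarPoint_one_coord,
      smul_eq_mul, PiLp.zero_apply, Real.sin_add p, e5]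
    field_simp
    ring

lemma periodic_add_mul {X : Type*} {b : ℤ → X} (hb : ∀ m, b (m + n) = b m) (m q : ℤ) :
    b (m + n * q) = b m := by
  have : Function.Periodic b (n : ℤ) := hb
  rw [mul_comm]
  exact this.int_mul q m

lemma range_eq_of_periodic {X : Type*} {α : Fin n → X} {b : ℤ → X} (hn : 0 < n)
    (hb : ∀ m, b (m + n) = b m) (hα : ∀ k : Fin n, α k = b (k : ℕ)) :
    Set.range α = Set.range b := by
  ext x
  constructor
  · rintro ⟨k, rfl⟩
    exact ⟨_, (hα k).symm⟩
  · rintro ⟨m, rfl⟩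
    have hm0 := Int.emod_nonneg m (b := n) (by omega)
    have hmn := Int.emod_lt_of_pos m (b := n) (by omega)
    refine ⟨⟨(m % n).toNat, by omega⟩, ?_⟩
    rw [hα]
    simp only [Int.toNat_of_nonneg hm0]
    rw [← periodic_add_mul hb (m % n) (m / n), Int.emod_add_mul_ediv]

lemma regularVertex_periodic (hn : 0 < n) (φ : ℝ) (m : ℤ) :
    regularVertex n φ (m + n) = regularVertex n φ m := by
  have hn0 : (n : ℝ) ≠ 0 := Nat.cast_ne_zero.2 hn.ne'
  have e : φ + 2 * Real.pi / n * ((m + n : ℤ) : ℝ) =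
      φ + 2 * Real.pi / n * m + 2 * Real.pi := by
    push_cast
    field_simp
    ring
  rw [regularVertex, e, polarPoint_add_two_pi, regularVertex]

lemma setLIntegral_Ioc_eq_mul {a ω : ℝ} (hω : 0 ≤ ω) {F : ℝ → ℝ≥0∞} {c : ℝ≥0∞} (n : ℕ)
    (h : ∀ k : ℕ, ∫⁻ t in Set.Ioc (a + ω * k) (a + ω * (k + 1)), F t = c) :
    ∫⁻ t in Set.Ioc a (a + ω * n), F t = n * c := by
  induction n with
  | zero => simp
  | succ n ih =>
    have h1 : a ≤ a + ω * n := by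
      have : 0 ≤ ω * n := by positivity
      linarith
    have h2 : a + ω * n ≤ a + ω * (n + 1) := by linarith
    push_cast
    rw [← Set.Ioc_union_Ioc_eq_Ioc h1 h2, lintegral_union measurableSet_Ioc
      (Set.Ioc_disjoint_Ioc_of_le le_rfl), ih, h n, add_mul, one_mul]

lemma integral_inv_cos_sq {γ : ℝ} (h0 : 0 ≤ γ) (h1 : γ < Real.pi / 2) :
    ∫ t in (-γ)..γ, 1 / Real.cos t ^ 2 = 2 * Real.tan γ := by
  have hcos : ∀ t ∈ Set.uIcc (-γ) γ, Real.cos t ≠ 0 := fun t ht => by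
    rw [Set.uIcc_of_le (by linarith)] at ht
    exact (Real.cos_pos_of_mem_Ioo ⟨by linarith [ht.1], by linarith [ht.2]⟩).ne'
  rw [intervalIntegral.integral_eq_sub_of_hasDerivAt (f := Real.tan)
    (fun t ht => Real.hasDerivAt_tan (hcos t ht)), Real.tan_neg]
  · ring
  · refine ContinuousOn.intervalIntegrable ?_
    exact continuousOn_const.div (by fun_prop) fun t ht => pow_ne_zero 2 (hcos t ht)

/-- The area of a regular polygon, computed in polar coordinates. -/
lemma volume_convexHull_regularVertex (hn : 3 ≤ n) (φ : ℝ) :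
    volume (convexHull ℝ (Set.range (regularVertex n φ))) =
      ENNReal.ofReal (n / 2 * Real.sin (2 * Real.pi / n)) := by
  have hn3 : (3 : ℝ) ≤ n := by exact_mod_cast hn
  have hn0 : (0 : ℝ) < n := by linarith
  have hpi := Real.pi_pos
  have hc := cos_pi_div_pos hn
  have hs := sin_pi_div_pos hn
  have hγ0 : 0 < Real.pi / n := by positivity
  have hγ1 : Real.pi / n < Real.pi / 2 := by
    rw [div_lt_div_iff₀ hn0 two_pos]
    nlinarith
  have hω : 2 * Real.pi / n = 2 * (Real.pi / n) := by ring
  have hωn : 2 * Real.pi / n * n = 2 * Real.pi := div_mul_cancel₀ _ hn0.ne'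
  set P := convexHull ℝ (Set.range (regularVertex n φ)) with hP
  have hfin : (Set.range (regularVertex n φ)).Finite := by
    rw [← range_eq_of_periodic (α := fun k : Fin n => regularVertex n φ (k : ℕ)) (by omega)
      (regularVertex_periodic (by omega) φ) fun _ => rfl]
    exact Set.finite_range _
  have hPm : MeasurableSet P := (hfin.isCompact_convexHull (𝕜 := ℝ)).isClosed.measurableSet
  have hP1 : P ⊆ Metric.ball 0 2 := by
    refine (convexHull_min ?_ (convex_closedBall (0 : Plane) 1)).trans
      (Metric.closedBall_subset_ball one_lt_two)
    rintro _ ⟨m, rfl⟩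
    simp [regularVertex, norm_polarPoint]
  set f : Plane → ℝ≥0∞ := P.indicator 1 with hf
  have hfm : Measurable f := measurable_one.indicator hPm
  have hfpm : Measurable fun p : ℝ × ℝ => ENNReal.ofReal p.1 * f (polarPoint p.1 p.2) :=
    measurable_fst.ennreal_ofReal.mul (hfm.comp continuous_polarPoint.measurable)
  set F : ℝ → ℝ≥0∞ := fun t => ∫⁻ r in Set.Ioo (0 : ℝ) 2, ENNReal.ofReal r * f (polarPoint r t)
    with hF
  have hvol : volume P = ∫⁻ t in Set.Ioc φ (φ + 2 * Real.pi / n * n), F t := by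
    rw [hωn, ← setLIntegral_congr (Ioo_ae_eq_Ioc (μ := volume)), hF,
      ← lintegral_lintegral_swap hfpm.aemeasurable, ← Set.inter_eq_left.2 hP1,
      ← Measure.restrict_apply hPm, ← lintegral_indicator_one hPm, setLIntegral_ball_polar hfm 2 φ]
    exact lintegral_congr fun r => (lintegral_const_mul' _ _ ENNReal.ofReal_ne_top).symm
  have hpiece : ∀ k : ℕ, ∫⁻ t in Set.Ioc (φ + 2 * Real.pi / n * k) (φ + 2 * Real.pi / n * (k + 1)),
      F t = ENNReal.ofReal (Real.sin (2 * Real.pi / n) / 2) := by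
    intro k
    set c := φ + 2 * Real.pi / n * (k + 1 / 2) with hcdef
    have e1 : φ + 2 * Real.pi / n * k = c - Real.pi / n := by rw [hcdef]; ring
    have e2 : φ + 2 * Real.pi / n * (k + 1) = c + Real.pi / n := by rw [hcdef]; ring
    rw [e1, e2]
    have hcos : ∀ t ∈ Set.Icc (c - Real.pi / n) (c + Real.pi / n),
        Real.cos (Real.pi / n) ≤ Real.cos (t - c) := fun t ht => by
      rw [← Real.cos_abs (t - c)]
      refine Real.cos_le_cos_of_nonneg_of_le_pi (abs_nonneg _) (by linarith) (abs_le.2 ?_)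
      exact ⟨by linarith [ht.1], by linarith [ht.2]⟩
    -- On each ray the polygon is the segment of length `cos (π/n) / cos (t - c)`.
    have hFt : ∀ t ∈ Set.Ioc (c - Real.pi / n) (c + Real.pi / n), F t =
        ENNReal.ofReal (Real.cos (Real.pi / n) ^ 2 / 2 * (1 / Real.cos (t - c) ^ 2)) := by
      intro t ht
      have hct := hcos t ⟨ht.1.le, ht.2⟩
      have hct0 := hc.trans_le hct
      set ρ := Real.cos (Real.pi / n) / Real.cos (t - c) with hρ
      have hρ0 : 0 ≤ ρ := by positivity
      have hρ1 : ρ ≤ 1 := (div_le_one hct0).2 hct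
      have hmem : ∀ r ∈ Set.Ioo (0 : ℝ) 2, ENNReal.ofReal r * f (polarPoint r t) =
          (Set.Iic ρ).indicator (fun r => ENNReal.ofReal r) r := fun r hr => by
        have hiff := polarPoint_mem_convexHull_iff hn k hr.1.le (φ := φ) (t := t)
          (by push_cast; linarith [ht.1]) (by push_cast; linarith [ht.2])
        push_cast at hiff
        rw [← hcdef, ← le_div_iff₀ hct0, ← hρ, ← hP] at hiff
        by_cases h : r ≤ ρ
        · rw [Set.indicator_of_mem (by exact h), hf, Set.indicator_of_mem (hiff.2 h), Pi.one_apply,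
            mul_one]
        · rw [Set.indicator_of_notMem (by exact h), hf,
            Set.indicator_of_notMem (fun hh => h (hiff.1 hh)), mul_zero]
      rw [hF]
      simp only
      rw [setLIntegral_congr_fun measurableSet_Ioo hmem, lintegral_indicator measurableSet_Iic,
        Measure.restrict_restrict measurableSet_Iic]
      have hset : Set.Iic ρ ∩ Set.Ioo 0 2 = Set.Ioc 0 ρ := by
        ext r
        simp only [Set.mem_inter_iff, Set.mem_Iic, Set.mem_Ioo, Set.mem_Ioc]
        exact ⟨fun h => ⟨h.2.1, h.1⟩, fun h => ⟨h.2, h.1, by linarith [h.2]⟩⟩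
      rw [hset, ← setLIntegral_congr (Ioo_ae_eq_Ioc (μ := volume)),
        setLIntegral_Ioo_ofReal hρ0 continuous_id' (fun r hr => hr.1.le), integral_id, hρ]
      congr 1
      field_simp
      ring
    rw [setLIntegral_congr_fun measurableSet_Ioc hFt, ← ofReal_integral_eq_lintegral_ofReal,
      ← intervalIntegral.integral_of_le (by linarith), intervalIntegral.integral_const_mul,
      intervalIntegral.integral_comp_sub_right (fun t => 1 / Real.cos t ^ 2),
      sub_sub_cancel_left, add_sub_cancel_left, integral_inv_cos_sq hγ0.le hγ1,
      Real.tan_eq_sin_div_cos, hω, Real.sin_two_mul]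
    · congr 1
      field_simp
    · refine (ContinuousOn.integrableOn_Icc ?_).mono_set Set.Ioc_subset_Icc_self
      exact continuousOn_const.mul (continuousOn_const.div (by fun_prop) fun t ht =>
        pow_ne_zero 2 (hc.trans_le (hcos t ht)).ne')
    · exact Eventually.of_forall fun t => by positivity
  rw [hvol, setLIntegral_Ioc_eq_mul (by positivity) n hpiece, ← ENNReal.ofReal_natCast,
    ← ENNReal.ofReal_mul hn0.le]
  congr 1
  ring

/-! ### Symmetric junction maps -/

/-- The next vertex, numbered cyclically, is the value of the periodic extension at the next
integer. -/
lemma apply_finRotate {X : Type*} {α : Fin n → X} {b : ℤ → X} (hb : ∀ m, b (m + n) = b m)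
    (hα : ∀ k : Fin n, α k = b (k : ℕ)) (k : Fin n) : α (finRotate n k) = b ((k : ℕ) + 1) := by
  obtain _ | n := n
  · exact k.elim0
  rw [hα, finRotate_apply]
  by_cases hk : k = Fin.last n
  · subst hk
    have := hb 0
    rw [Fin.last_add_one, Fin.val_zero, Fin.val_last, Nat.cast_zero, ← this]
    push_cast
    rw [zero_add]
  · rw [Fin.val_add_one_of_lt (Fin.lt_last_iff_ne_last.2 hk)]
    push_cast
    rfl

namespace IsSymmetricJunctionMap

variable {α : Fin n → Plane} {ℓ : ℝ} {u : Plane → Plane}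

/-- The vertices of the polygon, extended periodically to the integers, are the values in the
description of the junction map in polar coordinates. -/
lemma exists_isJunction (hu : IsSymmetricJunctionMap α ℓ u) (hn : 3 ≤ n) (hℓ : 0 < ℓ) :
    ∃ θ φ s : ℝ, (s = 1 ∨ s = -1) ∧
      (∀ k : Fin n, α k = polarPoint 1 (φ + s * (2 * Real.pi / n * ((k : ℕ) : ℤ)))) ∧
      IsJunction n θ ℓ (fun m => polarPoint 1 (φ + s * (2 * Real.pi / n * m)))
        (2 * Real.sin (Real.pi / n)) (s * Real.sin (2 * Real.pi / n)) u := by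
  obtain ⟨φ, s, hs, hα⟩ := hu.regular
  obtain ⟨θ, hθ⟩ := hu.eq_on_sectors
  have hn0 : (0 : ℝ) < n := by positivity
  have hpi := Real.pi_pos
  have hsin := sin_pi_div_pos hn
  have hα' : ∀ k : Fin n, α k = polarPoint 1 (φ + s * (2 * Real.pi / n * ((k : ℕ) : ℤ))) :=
    fun k => by
      rw [hα k, Int.cast_natCast]
      congr 2
      ring
  have hper : ∀ m : ℤ, polarPoint 1 (φ + s * (2 * Real.pi / n * ((m + n : ℤ) : ℝ))) =
      polarPoint 1 (φ + s * (2 * Real.pi / n * m)) := fun m => by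
    have e : 2 * Real.pi / n * ((m + n : ℤ) : ℝ) = 2 * Real.pi / n * m + 2 * Real.pi := by
      push_cast
      field_simp
    rw [e]
    rcases hs with rfl | rfl
    · rw [← polarPoint_add_two_pi_mul_int 1 (φ + 1 * (2 * Real.pi / n * m)) 1]
      congr 1
      push_cast
      ring
    · rw [← polarPoint_add_two_pi_mul_int 1 (φ + -1 * (2 * Real.pi / n * m)) (-1)]
      congr 1
      push_cast
      ring
  refine ⟨θ, φ, s, hs, hα', ?_⟩
  refine ⟨by omega, hℓ, by positivity, hper, fun m => ?_, fun m => ?_, fun m => ?_, ?_⟩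
  · simp [norm_polarPoint]
  · have e : (φ + s * (2 * Real.pi / n * ((m + 1 : ℤ) : ℝ)) -
        (φ + s * (2 * Real.pi / n * m))) / 2 = s * (Real.pi / n) := by
      push_cast
      ring
    rw [norm_sub_polarPoint, e]
    rcases hs with rfl | rfl
    · rw [one_mul, abs_of_pos hsin]
    · rw [neg_one_mul, Real.sin_neg, abs_neg, abs_of_pos hsin]
  · have e : φ + s * (2 * Real.pi / n * ((m + 1 : ℤ) : ℝ)) -
        (φ + s * (2 * Real.pi / n * m)) = s * (2 * Real.pi / n) := by
      push_cast
      ring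
    rw [cross_polarPoint, e]
    rcases hs with rfl | rfl
    · rw [one_mul, one_mul]
    · rw [neg_one_mul, neg_one_mul, Real.sin_neg]
  · intro m r t hr0 hr h1 h2
    -- Reduce `m` modulo `n`, shifting the angle by the corresponding multiple of `2π`.
    have hm0 := Int.emod_nonneg m (b := n) (by omega)
    have hmn := Int.emod_lt_of_pos m (b := n) (by omega)
    have hk : ((m % n).toNat : ℤ) = m % n := Int.toNat_of_nonneg hm0
    have hm : m = m % n + n * (m / n) := (Int.emod_add_mul_ediv m n).symm
    have hmR : (m : ℝ) = (m % n).toNat + n * (m / n : ℤ) := by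
      rw [← Int.cast_natCast, hk]
      exact_mod_cast hm
    have hmω : 2 * Real.pi / n * m = 2 * Real.pi * (m % n).toNat / n + 2 * Real.pi * (m / n : ℤ) := by
      rw [hmR]
      field_simp
    have e1 : polarPoint r t = polarPoint r (t - 2 * Real.pi * (m / n : ℤ)) := by
      rw [← polarPoint_add_two_pi_mul_int r (t - 2 * Real.pi * (m / n : ℤ)) (m / n),
        sub_add_cancel]
    have hmem : polarPoint r t ∈ openSector n θ (m % n).toNat := by
      refine ⟨r, hr0, t - 2 * Real.pi * (m / n : ℤ), ?_, ?_, e1⟩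
      · rw [hmω] at h1
        linarith
      · have e2 : 2 * Real.pi * (((m % n).toNat : ℝ) + 1) / n =
            2 * Real.pi * (m % n).toNat / n + 2 * Real.pi / n := by ring
        rw [mul_add, hmω] at h2
        rw [e2]
        linarith
    have hball : polarPoint r t ∈ Metric.ball (0 : Plane) ℓ :=
      polarPoint_mem_ball.2 (by rwa [abs_of_pos hr0])
    rw [hθ ⟨(m % n).toNat, by omega⟩ _ ⟨hball, hmem⟩, hα']
    simp only [hk]
    have := periodic_add_mul (b := fun m : ℤ => polarPoint 1 (φ + s * (2 * Real.pi / n * m))) hper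
      (m % n) (m / n)
    rw [← hm] at this
    exact this.symm

end IsSymmetricJunctionMap

/-- The two orientations of a regular polygon give the same set of vertices. -/
lemma range_polarPoint_eq {s : ℝ} (hs : s = 1 ∨ s = -1) :
    Set.range (fun m : ℤ => polarPoint 1 (φ + s * (2 * Real.pi / n * m))) =
      Set.range (regularVertex n φ) := by
  rcases hs with rfl | rfl
  · simp only [one_mul]
    rfl
  · rw [← (Equiv.neg ℤ).surjective.range_comp (regularVertex n φ)]
    congr 1
    ext1 m
    simp [regularVertex]

end RegularPolygon

theorem corollary5p3 (n : ℕ) (hn : 3 ≤ n) (ℓ : ℝ) (hℓ : 0 < ℓ) (α : Fin n → Plane)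
    (u : Plane → Plane) (hu : IsSymmetricJunctionMap α ℓ u) :
    relaxedAreaBV u (Metric.ball 0 ℓ) =
        volume (Metric.ball (0 : Plane) ℓ) + totalVariation u (Metric.ball 0 ℓ) +
          volume (convexHull ℝ (Set.range α)) ∧
      ∀ k : Fin n,
        volume (Metric.ball (0 : Plane) ℓ) + totalVariation u (Metric.ball 0 ℓ) +
            volume (convexHull ℝ (Set.range α)) =
          ENNReal.ofReal (Real.pi * ℓ ^ 2 + n * sideLength α k * ℓ +
            n / 2 * triangleHeight α k * sideLength α k) := by
  obtain ⟨θ, φ, s, hs, hα, hJ⟩ := hu.exists_isJunction hn hℓ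
  set b : ℤ → Plane := fun m => polarPoint 1 (φ + s * (2 * Real.pi / n * m)) with hb
  have hαb : ∀ k : Fin n, α k = b (k : ℕ) := hα
  have hpi := Real.pi_pos
  have hcos := cos_pi_div_pos hn
  have hsin := sin_pi_div_pos hn
  have h2 : Real.sin (2 * Real.pi / n) = 2 * Real.sin (Real.pi / n) * Real.cos (Real.pi / n) := by
    rw [mul_div_assoc, Real.sin_two_mul]
  have hs1 : |s| = 1 := by rcases hs with rfl | rfl <;> simp
  have hvol : volume (convexHull ℝ (Set.range α)) =
      ENNReal.ofReal (n / 2 * Real.sin (2 * Real.pi / n)) := by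
    rw [range_eq_of_periodic (by omega) hJ.periodic hαb, hb, range_polarPoint_eq hs,
      volume_convexHull_regularVertex hn]
  refine ⟨?_, fun k => ?_⟩
  · rw [hJ.relaxedAreaBV_eq, hvol, abs_mul, hs1, abs_of_pos (by rw [h2]; positivity)]
    congr 2
    ring
  · have hnext := apply_finRotate hJ.periodic hαb k
    have hside : sideLength α k = 2 * Real.sin (Real.pi / n) := by
      rw [sideLength, dist_comm, dist_eq_norm, hnext, hαb]
      exact hJ.norm_sub _
    have hheight : triangleHeight α k = Real.cos (Real.pi / n) := by
      have e : (φ + s * (2 * Real.pi / n * (((k : ℕ) : ℤ) : ℝ)) -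
          (φ + s * (2 * Real.pi / n * ((((k : ℕ) : ℤ) + 1 : ℤ) : ℝ)))) / 2 =
            -(s * (Real.pi / n)) := by
        push_cast
        ring
      rw [triangleHeight, hnext, hα, hb, infDist_zero_chord (by simp only [norm_polarPoint]),
        norm_add_polarPoint, e, Real.cos_neg]
      rcases hs with rfl | rfl
      · rw [one_mul, abs_of_pos hcos]
        ring
      · rw [neg_one_mul, Real.cos_neg, abs_of_pos hcos]
        ring
    rw [hside, hheight, hvol, hJ.totalVariation_eq, EuclideanSpace.volume_ball_fin_two,
      ← ENNReal.ofReal_pow hℓ.le, ← ENNReal.ofReal_mul (by positivity),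
      ← ENNReal.ofReal_add (by positivity) (by positivity),
      ← ENNReal.ofReal_add (by positivity) (by rw [h2]; positivity), h2]
    congr 1
    ring
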